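/- Let $M$ be a smooth ($C^\infty$) Riemannian surface, not necessarily complete, of constant Gauss curvature $K$. Let $\Gamma$ be a closed geodesic of length $L>0$ in $M$, parametrized by a unit speed $L$-periodic geodesic $\gamma\colon\mathbf{R}\to M$ (not necessarily simple), and suppose that some open neighborhood of $\Gamma$ in $M$ is orientable. A vertex of a regular smooth closed curve $c\colon\mathbf{R}/L\mathbf{Z}\to M$ is a parameter $t\in\mathbf{R}/L\mathbf{Z}$ which is a critical point of the geodesic curvature of $c$ (which is well defined near $t$ up to a sign). Then the following are equivalent: (i) for every open neighborhood $U$ of $\Gamma$ in $M$ and every neighborhood $\mathcal{N}$ of $\gamma$ in the $C^\infty$ topology (uniform closeness, in local coordinates, of the curves and of their derivatives up to any finite order) there is a regular smooth closed curve $c\colon\mathbf{R}/L\mathbf{Z}\to M$ in $\mathcal{N}$ whose image lies in $U$ and which has exactly two vertices; (ii) $K\neq(2\pi/L)^2$. -/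

import Mathlib

open Set Topology
open scoped Manifold ContDiff Bundle

noncomputable section

/-! ### Riemannian geometry of a coordinate patch of the plane -/

/-- The coordinate plane on which surfaces are modelled. -/
abbrev Plane : Type := EuclideanSpace ℝ (Fin 2)

namespace CoordMetric

/-- The partial derivative `∂ᵢ f` at `x`. -/
def partialDeriv (i : Fin 2) (f : Plane → ℝ) (x : Plane) : ℝ :=
  fderiv ℝ f x (EuclideanSpace.single i 1)

/-- Christoffel symbols `Γᵏᵢⱼ = ½ ∑ₗ gᵏˡ (∂ᵢ gⱼₗ + ∂ⱼ gᵢₗ - ∂ₗ gᵢⱼ)` of the metric with coordinate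
matrix `G`. -/
def christoffel (G : Plane → Matrix (Fin 2) (Fin 2) ℝ) (k i j : Fin 2) (x : Plane) : ℝ :=
  (1 / 2) * ∑ l, (G x)⁻¹ k l *
    (partialDeriv i (fun y => G y j l) x + partialDeriv j (fun y => G y i l) x
      - partialDeriv l (fun y => G y i j) x)

/-- Components `Rˡₖᵢⱼ` of the curvature tensor, where `R(∂ᵢ, ∂ⱼ)∂ₖ = ∑ₗ Rˡₖᵢⱼ ∂ₗ` and
`R(X, Y)Z = ∇_X ∇_Y Z - ∇_Y ∇_X Z - ∇_[X,Y] Z`. -/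
def riemann (G : Plane → Matrix (Fin 2) (Fin 2) ℝ) (l k i j : Fin 2) (x : Plane) : ℝ :=
  partialDeriv i (christoffel G l j k) x - partialDeriv j (christoffel G l i k) x
    + ∑ m, (christoffel G l i m x * christoffel G m j k x
      - christoffel G l j m x * christoffel G m i k x)

/-- Gauss curvature `⟨R(∂₀, ∂₁)∂₁, ∂₀⟩ / det g`. -/
def gaussCurvature (G : Plane → Matrix (Fin 2) (Fin 2) ℝ) (x : Plane) : ℝ :=
  (∑ l, G x 0 l * riemann G l 1 0 1 x) / (G x).det

/-- The `k`-th component of the velocity of a curve. -/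
def velocity (c : ℝ → Plane) (t : ℝ) (k : Fin 2) : ℝ := deriv (fun s => c s k) t

/-- The `k`-th component of the covariant acceleration `∇_{c'} c'`. -/
def acceleration (G : Plane → Matrix (Fin 2) (Fin 2) ℝ) (c : ℝ → Plane) (t : ℝ) (k : Fin 2) : ℝ :=
  deriv (fun s => velocity c s k) t
    + ∑ i, ∑ j, christoffel G k i j (c t) * velocity c t i * velocity c t j

/-- The speed `|c'|` with respect to the metric `G`. -/
def speed (G : Plane → Matrix (Fin 2) (Fin 2) ℝ) (c : ℝ → Plane) (t : ℝ) : ℝ :=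
  Real.sqrt (∑ i, ∑ j, G (c t) i j * velocity c t i * velocity c t j)

/-- Geodesic curvature `ω(c', ∇_{c'} c') / |c'|³` of a regular curve, where `ω` is the area form
`√(det g) dx⁰ ∧ dx¹` for the coordinate orientation. This is the component of the
derivative of the unit tangent vector with respect to arclength along the positively oriented unit
normal. -/
def geodesicCurvature (G : Plane → Matrix (Fin 2) (Fin 2) ℝ) (c : ℝ → Plane) (t : ℝ) : ℝ :=
  Real.sqrt (G (c t)).det
      * (velocity c t 0 * acceleration G c t 1 - velocity c t 1 * acceleration G c t 0)
    / speed G c t ^ 3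

end CoordMetric

/-! ### Riemannian surfaces -/

section Surface

variable {M : Type*} [TopologicalSpace M] [ChartedSpace Plane M] [IsManifold (𝓡 2) ∞ M]

/-- Coordinate matrix, in the chart `e`, of the Riemannian metric `g`. -/
def metricMatrix (g : Bundle.ContMDiffRiemannianMetric (𝓡 2) ∞ Plane
      (fun p : M => TangentSpace (𝓡 2) p))
    (e : OpenPartialHomeomorph M Plane) (x : Plane) : Matrix (Fin 2) (Fin 2) ℝ :=
  Matrix.of fun i j => g.inner (e.symm x)
    (mfderiv (𝓡 2) (𝓡 2) e.symm x (EuclideanSpace.single i (1 : ℝ) : Plane))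
    (mfderiv (𝓡 2) (𝓡 2) e.symm x (EuclideanSpace.single j (1 : ℝ) : Plane))

/-- The Gauss curvature of `g` equals `K` at every point. -/
def HasConstantCurvature (g : Bundle.ContMDiffRiemannianMetric (𝓡 2) ∞ Plane
      (fun p : M => TangentSpace (𝓡 2) p)) (K : ℝ) : Prop :=
  ∀ p : M, CoordMetric.gaussCurvature (metricMatrix g (chartAt Plane p)) (chartAt Plane p p) = K

/-- An open subset `U` of a smooth surface is orientable: it is covered by smooth charts all of
whose transition maps have positive Jacobian determinant. -/
def IsOrientableOn (U : Set M) : Prop :=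
  ∃ A ⊆ IsManifold.maximalAtlas (𝓡 2) ∞ M,
    (∀ e ∈ A, e.source ⊆ U) ∧ (∀ p ∈ U, ∃ e ∈ A, p ∈ e.source) ∧
    ∀ e ∈ A, ∀ e' ∈ A, ∀ x ∈ (e.symm.trans e').source, 0 < (fderiv ℝ (e' ∘ e.symm) x).det

variable (M) in
/-- Smooth maps from the line to the surface. Closed curves are the periodic ones. -/
abbrev SmoothCurve : Type _ := C^∞⟮𝓘(ℝ, ℝ), ℝ; 𝓡 2, M⟯

/-- `c`, regarded as a map on `ℝ / Lℤ`, is a regular (immersed) smooth closed curve. -/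
structure IsClosedCurve (c : SmoothCurve M) (L : ℝ) : Prop where
  periodic : Function.Periodic c L
  regular : ∀ t, mfderiv 𝓘(ℝ, ℝ) (𝓡 2) c t (1 : ℝ) ≠ 0

/-- `γ`, regarded as a map on `ℝ / Lℤ`, is a unit speed closed geodesic; so its length is `L`. It
need not be simple. -/
structure IsClosedGeodesic (g : Bundle.ContMDiffRiemannianMetric (𝓡 2) ∞ Plane
      (fun p : M => TangentSpace (𝓡 2) p)) (γ : SmoothCurve M) (L : ℝ) : Prop where
  length_pos : 0 < L
  periodic : Function.Periodic γ L
  unit_speed : ∀ t, g.inner (γ t) (mfderiv 𝓘(ℝ, ℝ) (𝓡 2) γ t (1 : ℝ))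
    (mfderiv 𝓘(ℝ, ℝ) (𝓡 2) γ t (1 : ℝ)) = 1
  geodesic : ∀ t k, CoordMetric.acceleration (metricMatrix g (chartAt Plane (γ t)))
    (chartAt Plane (γ t) ∘ γ) t k = 0

/-- `t` is a vertex of the regular curve `c`: a critical point of geodesic curvature. The geodesic
curvature near `t` is computed in a chart around `c t`; another chart changes it at most by a
sign. -/
def IsVertex (g : Bundle.ContMDiffRiemannianMetric (𝓡 2) ∞ Plane
      (fun p : M => TangentSpace (𝓡 2) p)) (c : SmoothCurve M) (t : ℝ) : Prop :=
  deriv (CoordMetric.geodesicCurvature (metricMatrix g (chartAt Plane (c t)))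
    (chartAt Plane (c t) ∘ c)) t = 0

/-- The closed curve `c : ℝ / Lℤ → M` has exactly two vertices. -/
def HasOnlyTwoVertices (g : Bundle.ContMDiffRiemannianMetric (𝓡 2) ∞ Plane
      (fun p : M => TangentSpace (𝓡 2) p)) (c : SmoothCurve M) (L : ℝ) : Prop :=
  {t ∈ Ico 0 L | IsVertex g c t}.encard = 2

/-- Basic neighborhood of `f`: the curves `c` which map the compact set `S` into the domain of the
chart `e` and whose coordinate expression is `ε`-close to that of `f` on `S`, together with its
derivatives of order at most `r`. -/
def basicNeighborhood (f : SmoothCurve M) (e : OpenPartialHomeomorph M Plane) (S : Set ℝ) (r : ℕ)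
    (ε : ℝ) : Set (SmoothCurve M) :=
  {c | ∀ t ∈ S, c t ∈ e.source ∧
    ∀ j ≤ r, ‖iteratedDeriv j (e ∘ c) t - iteratedDeriv j (e ∘ f) t‖ < ε}

variable (M) in
/-- The `C^∞` topology on smooth curves: uniform convergence, on compact sets of parameters, of
coordinate expressions and all of their derivatives. On the curves of a given period this is the
`C^∞` topology on maps of a circle. -/
abbrev smoothTopology : TopologicalSpace (SmoothCurve M) :=
  TopologicalSpace.generateFrom
    {N | ∃ (f : SmoothCurve M) (e : OpenPartialHomeomorph M Plane) (S : Set ℝ) (r : ℕ) (ε : ℝ),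
      e ∈ IsManifold.maximalAtlas (𝓡 2) ∞ M ∧ IsCompact S ∧ MapsTo f S e.source ∧ 0 < ε ∧
      N = basicNeighborhood f e S r ε}

end Surface

end

noncomputable section
set_option synthInstance.maxHeartbeats 400000

/-! ### The Levi-Civita connection and the curvature tensor of a metric on a plane domain. -/

namespace CoordMetric

/-! Everything is moved to a strip around the axis of the plane. Orientability near the geodesic
gives an immersion `E` of such a strip into `M`, invariant under translation by `L` and restricting
to `γ` on the axis; the pulled back metric is standard along the axis (`exists_isStripMetric`). The
map `E` need not be injective, so `γ` need not be simple. Since `E` is a local isometry, curvature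
and vertices can be computed in the strip, and closed curves near `γ` correspond to curves `b` near
the axis with `b (t + L) = b t + (L, 0)` (`exists_lift`). Write `l = 2π / L`.

If `K ≠ l²`: the geodesic curvature of the graph of `x f` is `x (f'' + K f) + o(x)`, the Jacobi
operator of the axis applied to `f`. The choice `f = cos (l t) / (K - l²)` makes the linear term
`cos (l t)`. Hence the derivative of the curvature is `C¹` close, relative to the size of `x`, to
`-x l sin (l t)`, and a function that close to a sine has exactly two zeros per period
(`exists_zeros_of_near_sin`). These graphs converge to the axis as `x → 0`.

If `K = l²`: the equation `∇ df = -K f g` is given by a flat connection on pairs `(f, df)`, because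
the curvature is constantly `K`. It therefore has solutions near the axis with axis values `cos (l
t)` and `sin (l t)`, and these are `L`-periodic precisely because `K = l²`; on the model sphere they
are restrictions of linear functions. Along a closed curve `b` with geodesic curvature `k` and unit
normal `n`, the Frenet equation and the Hessian equation give `(k f + df(n))' = k' f`, so the
integral of `k' f` over a period vanishes; the same holds after subtracting a constant from `f`.

Suppose that `b` is close to the axis and has only two vertices. Some combination `cos θ f₁ + sin θ
f₂`, minus a constant, vanishes at both. Its derivative along `b` is `C¹` close to `-l sin (l t -
θ)` and has only two zeros per period, so by Rolle it changes sign exactly at the two vertices.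
Either `k'` changes sign there too, and then `k'` times this function has constant sign off the
vertices, or `k` is strictly monotone over a period; both are impossible for periodic functions
(`exists_encard_ne_two`). -/

theorem contDiffOn_smul_const {E F : Type*} [NormedAddCommGroup E] [NormedSpace ℝ E]
    [NormedAddCommGroup F] [NormedSpace ℝ F] {f : E → ℝ} {s : Set E} {n : WithTop ℕ∞}
    (hf : ContDiffOn ℝ n f s) (T : F) : ContDiffOn ℝ n (fun x => f x • T) s :=
  hf.smul contDiffOn_const

/-- The bilinear form on the plane with matrix `A`. -/
def bil (A : Matrix (Fin 2) (Fin 2) ℝ) : Plane →L[ℝ] Plane →L[ℝ] ℝ :=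
  ∑ i, ∑ j, A i j • (EuclideanSpace.proj i : Plane →L[ℝ] ℝ).smulRight
    (EuclideanSpace.proj j : Plane →L[ℝ] ℝ)

/-- The Christoffel symbols as a bilinear map. -/
def gam (G : Plane → Matrix (Fin 2) (Fin 2) ℝ) (x : Plane) : Plane →L[ℝ] Plane →L[ℝ] Plane :=
  ∑ k, ∑ i, ∑ j, christoffel G k i j x • (EuclideanSpace.proj i : Plane →L[ℝ] ℝ).smulRight
    ((EuclideanSpace.proj j : Plane →L[ℝ] ℝ).smulRight (EuclideanSpace.single k 1 : Plane))

/-- The standard basis vectors of the plane. -/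
abbrev e_ (i : Fin 2) : Plane := EuclideanSpace.single i 1

theorem bil_apply (A : Matrix (Fin 2) (Fin 2) ℝ) (u w : Plane) :
    bil A u w = A 0 0 * u 0 * w 0 + A 0 1 * u 0 * w 1 + A 1 0 * u 1 * w 0 + A 1 1 * u 1 * w 1 := by
  simp [bil, Fin.sum_univ_two]; ring

theorem bil_single (A : Matrix (Fin 2) (Fin 2) ℝ) (i j : Fin 2) : bil A (e_ i) (e_ j) = A i j := by
  fin_cases i <;> fin_cases j <;> simp [bil_apply]

theorem gam_apply (G : Plane → Matrix (Fin 2) (Fin 2) ℝ) (x u w : Plane) (k : Fin 2) :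
    gam G x u w k = ∑ i, ∑ j, christoffel G k i j x * u i * w j := by
  fin_cases k <;> simp [gam, Fin.sum_univ_two] <;> ring

theorem gam_single (G : Plane → Matrix (Fin 2) (Fin 2) ℝ) (x : Plane) (i j k : Fin 2) :
    gam G x (e_ i) (e_ j) k = christoffel G k i j x := by
  rw [gam_apply]; fin_cases i <;> fin_cases j <;> simp

theorem eq_smul_add_smul (u : Plane) : u = u 0 • e_ 0 + u 1 • e_ 1 := by
  ext i; fin_cases i <;> simp

theorem fderiv_eq_partialDeriv (f : Plane → ℝ) (x u : Plane) :
    fderiv ℝ f x u = u 0 * partialDeriv 0 f x + u 1 * partialDeriv 1 f x := by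
  conv_lhs => rw [eq_smul_add_smul u]
  simp [partialDeriv]

/-- `G` is a smooth field of symmetric positive definite matrices on the open set `O`. -/
structure MetricOn (G : Plane → Matrix (Fin 2) (Fin 2) ℝ) (O : Set Plane) : Prop where
  isOpen : IsOpen O
  smooth : ∀ i j, ContDiffOn ℝ ∞ (fun y => G y i j) O
  symm : ∀ x ∈ O, G x 1 0 = G x 0 1
  pos : ∀ x ∈ O, ∀ u : Plane, u ≠ 0 → 0 < bil (G x) u u

variable {G : Plane → Matrix (Fin 2) (Fin 2) ℝ} {O : Set Plane}

theorem MetricOn.mono (hG : MetricOn G O) {O' : Set Plane} (h : IsOpen O') (hO : O' ⊆ O) :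
    MetricOn G O' :=
  ⟨h, fun i j => (hG.smooth i j).mono hO, fun x hx => hG.symm x (hO hx),
    fun x hx => hG.pos x (hO hx)⟩

theorem MetricOn.smoothAt (hG : MetricOn G O) {x : Plane} (hx : x ∈ O) (i j : Fin 2) :
    ContDiffAt ℝ ∞ (fun y => G y i j) x :=
  (hG.smooth i j).contDiffAt (hG.isOpen.mem_nhds hx)

theorem MetricOn.bil_symm (hG : MetricOn G O) {x : Plane} (hx : x ∈ O) (u w : Plane) :
    bil (G x) u w = bil (G x) w u := by
  rw [bil_apply, bil_apply, hG.symm x hx]; ring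

theorem MetricOn.det_pos (hG : MetricOn G O) {x : Plane} (hx : x ∈ O) : 0 < (G x).det := by
  have h0 : 0 < G x 0 0 := by
    have := hG.pos x hx (e_ 0) (by intro h; simpa using congrArg (fun v : Plane => v 0) h)
    rwa [bil_single] at this
  -- On this vector the form takes the value `G x 0 0 * (G x).det`.
  have h1 := hG.pos x hx (!₂[-(G x 0 1), G x 0 0]) (by
    intro h; have := congrArg (fun v : Plane => v 1) h; simp at this; linarith)
  rw [bil_apply] at h1
  simp at h1
  rw [Matrix.det_fin_two]
  rw [hG.symm x hx] at h1 ⊢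
  by_contra hc
  push Not at hc
  nlinarith [mul_nonneg h0.le (neg_nonneg.mpr hc)]

theorem MetricOn.nondeg (hG : MetricOn G O) {x : Plane} (hx : x ∈ O) {u w : Plane}
    (h : ∀ z, bil (G x) u z = bil (G x) w z) : u = w := by
  by_contra hne
  have := hG.pos x hx (u - w) (sub_ne_zero.mpr hne)
  have h' : bil (G x) (u - w) (u - w) = bil (G x) u (u - w) - bil (G x) w (u - w) := by
    rw [(bil (G x)).map_sub]; rfl
  rw [h', h, sub_self] at this
  exact lt_irrefl _ this

theorem MetricOn.contDiffOn_bil (hG : MetricOn G O) : ContDiffOn ℝ ∞ (fun x => bil (G x)) O := by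
  unfold bil
  refine ContDiffOn.sum fun i _ => ContDiffOn.sum fun j _ => ?_
  exact contDiffOn_smul_const (hG.smooth i j) _

theorem MetricOn.contDiffAt_bil (hG : MetricOn G O) {x : Plane} (hx : x ∈ O) :
    ContDiffAt ℝ ∞ (fun x => bil (G x)) x :=
  hG.contDiffOn_bil.contDiffAt (hG.isOpen.mem_nhds hx)

theorem contDiffOn_partialDeriv {f : Plane → ℝ} (hO : IsOpen O) (hf : ContDiffOn ℝ ∞ f O)
    (i : Fin 2) : ContDiffOn ℝ ∞ (partialDeriv i f) O :=
  (hf.fderiv_of_isOpen hO (by simp)).clm_apply contDiffOn_const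

theorem MetricOn.contDiffOn_inv (hG : MetricOn G O) (i j : Fin 2) :
    ContDiffOn ℝ ∞ (fun x => (G x)⁻¹ i j) O := by
  have hdet : ContDiffOn ℝ ∞ (fun x => (G x).det) O := by
    simp only [Matrix.det_fin_two]
    exact ((hG.smooth 0 0).mul (hG.smooth 1 1)).sub ((hG.smooth 0 1).mul (hG.smooth 1 0))
  have hinv := hdet.inv (fun x hx => (hG.det_pos hx).ne')
  simp only [Matrix.inv_def, Ring.inverse_eq_inv', Matrix.adjugate_fin_two, Matrix.smul_apply,
    smul_eq_mul]
  refine hinv.mul ?_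
  fin_cases i <;> fin_cases j <;> simp
  exacts [hG.smooth 1 1, (hG.smooth 0 1).neg, (hG.smooth 1 0).neg, hG.smooth 0 0]

theorem MetricOn.contDiffOn_christoffel (hG : MetricOn G O) (k i j : Fin 2) :
    ContDiffOn ℝ ∞ (christoffel G k i j) O := by
  unfold christoffel
  refine contDiffOn_const.mul (ContDiffOn.sum fun l _ => (hG.contDiffOn_inv k l).mul ?_)
  have := fun i j l => contDiffOn_partialDeriv hG.isOpen (hG.smooth j l) i
  exact ((this i j l).add (this j i l)).sub (this l i j)

theorem MetricOn.contDiffOn_gam (hG : MetricOn G O) : ContDiffOn ℝ ∞ (gam G) O := by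
  unfold gam
  refine ContDiffOn.sum fun k _ => ContDiffOn.sum fun i _ => ContDiffOn.sum fun j _ => ?_
  exact contDiffOn_smul_const (hG.contDiffOn_christoffel k i j) _

theorem MetricOn.contDiffAt_gam (hG : MetricOn G O) {x : Plane} (hx : x ∈ O) :
    ContDiffAt ℝ ∞ (gam G) x :=
  hG.contDiffOn_gam.contDiffAt (hG.isOpen.mem_nhds hx)

theorem MetricOn.differentiableAt_gam (hG : MetricOn G O) {x : Plane} (hx : x ∈ O) :
    DifferentiableAt ℝ (gam G) x :=
  (hG.contDiffAt_gam hx).differentiableAt (by simp)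

theorem MetricOn.differentiableAt_bil (hG : MetricOn G O) {x : Plane} (hx : x ∈ O) :
    DifferentiableAt ℝ (fun x => bil (G x)) x :=
  (hG.contDiffAt_bil hx).differentiableAt (by simp)

theorem MetricOn.partialDeriv_symm (hG : MetricOn G O) {x : Plane} (hx : x ∈ O) (m : Fin 2) :
    partialDeriv m (fun y => G y 1 0) x = partialDeriv m (fun y => G y 0 1) x := by
  unfold partialDeriv
  have : (fun y => G y 1 0) =ᶠ[𝓝 x] fun y => G y 0 1 := by
    filter_upwards [hG.isOpen.mem_nhds hx] with y hy using hG.symm y hy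
  rw [this.fderiv_eq]

theorem MetricOn.fderiv_bil (hG : MetricOn G O) {x : Plane} (hx : x ∈ O) (u w z : Plane) :
    fderiv ℝ (fun x => bil (G x)) x u w z =
      bil (Matrix.of fun i j => fderiv ℝ (fun y => G y i j) x u) w z := by
  have hd : ∀ i j, HasFDerivAt (fun y => G y i j) (fderiv ℝ (fun y => G y i j) x) x := fun i j =>
    ((hG.smoothAt hx i j).differentiableAt (by simp)).hasFDerivAt
  have h1 : HasFDerivAt (fun y => bil (G y) w z)
      (((fderiv ℝ (fun x => bil (G x)) x).flip w).flip z) x := by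
    have := ((hG.differentiableAt_bil hx).hasFDerivAt.clm_apply (hasFDerivAt_const w x)).clm_apply
      (hasFDerivAt_const z x)
    exact this.congr_fderiv (by ext v; simp)
  have h2 := ((((hd 0 0).mul_const (w 0)).mul_const (z 0)).add
    (((hd 0 1).mul_const (w 0)).mul_const (z 1))).add
    (((hd 1 0).mul_const (w 1)).mul_const (z 0)) |>.add
    (((hd 1 1).mul_const (w 1)).mul_const (z 1))
  have h3 : (fun y => bil (G y) w z) = _ := funext fun y => bil_apply (G y) w z
  rw [h3] at h1
  have := congrArg (fun T => T u) (h1.unique h2)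
  simp at this
  rw [this, bil_apply]; simp only [Matrix.of_apply]; ring

/-- Lowering the upper index cancels the inverse matrix in `christoffel`; the right side is the
Christoffel symbol of the first kind. -/
theorem MetricOn.lower_christoffel (hG : MetricOn G O) {x : Plane} (hx : x ∈ O) (l i j : Fin 2) :
    G x l 0 * christoffel G 0 i j x + G x l 1 * christoffel G 1 i j x =
      (1 / 2) * (partialDeriv i (fun y => G y j l) x + partialDeriv j (fun y => G y i l) x
      - partialDeriv l (fun y => G y i j) x) := by
  have h : G x * (G x)⁻¹ = 1 := Matrix.mul_nonsing_inv _ (hG.det_pos hx).ne'.isUnit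
  have h' : ∀ m, G x l 0 * (G x)⁻¹ 0 m + G x l 1 * (G x)⁻¹ 1 m = if l = m then 1 else 0 := by
    intro m
    have := congrFun (congrFun h l) m
    rwa [Matrix.mul_apply, Fin.sum_univ_two, Matrix.one_apply] at this
  have h0 := h' 0
  have h1 := h' 1
  simp only [christoffel, Fin.sum_univ_two]
  fin_cases l
  · simp at h0 h1 ⊢
    linear_combination (1/2) * (partialDeriv i (fun y => G y j 0) x +
      partialDeriv j (fun y => G y i 0) x - partialDeriv 0 (fun y => G y i j) x) * h0 +
      (1/2) * (partialDeriv i (fun y => G y j 1) x +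
      partialDeriv j (fun y => G y i 1) x - partialDeriv 1 (fun y => G y i j) x) * h1
  · simp at h0 h1 ⊢
    linear_combination (1/2) * (partialDeriv i (fun y => G y j 0) x +
      partialDeriv j (fun y => G y i 0) x - partialDeriv 0 (fun y => G y i j) x) * h0 +
      (1/2) * (partialDeriv i (fun y => G y j 1) x +
      partialDeriv j (fun y => G y i 1) x - partialDeriv 1 (fun y => G y i j) x) * h1

/-- The Koszul formula. -/
theorem MetricOn.koszul (hG : MetricOn G O) {x : Plane} (hx : x ∈ O) (u w z : Plane) :
    2 * bil (G x) (gam G x u w) z = fderiv ℝ (fun x => bil (G x)) x u w z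
      + fderiv ℝ (fun x => bil (G x)) x w u z - fderiv ℝ (fun x => bil (G x)) x z u w := by
  simp only [hG.fderiv_bil hx, bil_apply, Matrix.of_apply, gam_apply, Fin.sum_univ_two, fderiv_eq_partialDeriv]
  have h := hG.lower_christoffel hx
  have hs := hG.partialDeriv_symm hx
  have h000 := h 0 0 0
  have h001 := h 0 0 1
  have h010 := h 0 1 0
  have h011 := h 0 1 1
  have h100 := h 1 0 0
  have h101 := h 1 0 1
  have h110 := h 1 1 0
  have h111 := h 1 1 1
  simp only [hs, hG.symm x hx] at h000 h001 h010 h011 h100 h101 h110 h111 ⊢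
  linear_combination 2 * z 0 * (u 0 * w 0 * h000 + u 0 * w 1 * h001 + u 1 * w 0 * h010
    + u 1 * w 1 * h011) + 2 * z 1 * (u 0 * w 0 * h100 + u 0 * w 1 * h101 + u 1 * w 0 * h110
    + u 1 * w 1 * h111)

theorem MetricOn.fderiv_bil_symm (hG : MetricOn G O) {x : Plane} (hx : x ∈ O) (u w z : Plane) :
    fderiv ℝ (fun x => bil (G x)) x u w z = fderiv ℝ (fun x => bil (G x)) x u z w := by
  simp only [hG.fderiv_bil hx, bil_apply, Matrix.of_apply, fderiv_eq_partialDeriv, hG.partialDeriv_symm hx]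
  ring

theorem MetricOn.gam_symm (hG : MetricOn G O) {x : Plane} (hx : x ∈ O) (u w : Plane) :
    gam G x u w = gam G x w u := by
  refine hG.nondeg hx fun z => ?_
  have h1 := hG.koszul hx u w z
  have h2 := hG.koszul hx w u z
  rw [hG.fderiv_bil_symm hx z w u] at h2
  linarith

/-- The Levi-Civita connection is metric. -/
theorem MetricOn.compat (hG : MetricOn G O) {x : Plane} (hx : x ∈ O) (u w z : Plane) :
    fderiv ℝ (fun x => bil (G x)) x u w z =
      bil (G x) (gam G x u w) z + bil (G x) w (gam G x u z) := by
  have h1 := hG.koszul hx u w z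
  have h2 := hG.koszul hx u z w
  rw [hG.bil_symm hx w]
  rw [hG.fderiv_bil_symm hx u z w] at h2
  linarith

/-- The curvature tensor. -/
def curv (G : Plane → Matrix (Fin 2) (Fin 2) ℝ) (x u w z : Plane) : Plane :=
  fderiv ℝ (gam G) x u w z - fderiv ℝ (gam G) x w u z
    + (gam G x u (gam G x w z) - gam G x w (gam G x u z))

theorem MetricOn.hasFDerivAt_gam (hG : MetricOn G O) {x : Plane} (hx : x ∈ O) (w z : Plane) :
    HasFDerivAt (fun y => gam G y w z) (((fderiv ℝ (gam G) x).flip w).flip z) x := by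
  have := ((hG.differentiableAt_gam hx).hasFDerivAt.clm_apply (hasFDerivAt_const w x)).clm_apply
    (hasFDerivAt_const z x)
  exact this.congr_fderiv (by ext v; simp)

theorem MetricOn.hasFDerivAt_bil (hG : MetricOn G O) {x : Plane} (hx : x ∈ O) (w z : Plane) :
    HasFDerivAt (fun y => bil (G y) w z) (((fderiv ℝ (fun x => bil (G x)) x).flip w).flip z) x := by
  have := ((hG.differentiableAt_bil hx).hasFDerivAt.clm_apply (hasFDerivAt_const w x)).clm_apply
    (hasFDerivAt_const z x)
  exact this.congr_fderiv (by ext v; simp)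

/-- Ties the component formula used in the definition of Gauss curvature to the multilinear `curv`,
with which all later arguments work. -/
theorem MetricOn.riemann_eq (hG : MetricOn G O) {x : Plane} (hx : x ∈ O) (l k i j : Fin 2) :
    riemann G l k i j x = curv G x (e_ i) (e_ j) (e_ k) l := by
  have hp : ∀ i j k, partialDeriv i (christoffel G l j k) x
      = fderiv ℝ (gam G) x (e_ i) (e_ j) (e_ k) l := by
    intro i j k
    have h1 := (EuclideanSpace.proj l : Plane →L[ℝ] ℝ).hasFDerivAt.comp x
      (hG.hasFDerivAt_gam hx (e_ j) (e_ k))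
    have h2 : (⇑(EuclideanSpace.proj l : Plane →L[ℝ] ℝ) ∘ fun y => gam G y (e_ j) (e_ k))
        = christoffel G l j k := by
      funext y; exact gam_single G y j k l
    rw [h2] at h1
    rw [partialDeriv, h1.fderiv]; simp
  have hq : ∀ i j k, gam G x (e_ i) (gam G x (e_ j) (e_ k)) l
      = ∑ m, christoffel G l i m x * christoffel G m j k x := by
    intro i j k
    rw [gam_apply]
    simp only [gam_single]
    fin_cases i <;> simp [Fin.sum_univ_two]
  simp only [riemann, curv, hp, PiLp.add_apply, PiLp.sub_apply, hq, Finset.sum_sub_distrib]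

end CoordMetric

/-! ### Symmetries of the curvature tensor in dimension two, and naturality under local isometries.
-/

namespace CoordMetric

theorem two_le_infty : (2 : WithTop ℕ∞) ≤ ∞ := ENat.LEInfty.out

theorem fderiv_comp_plane {F : Type*} [NormedAddCommGroup F] [NormedSpace ℝ F] {T : Plane → F}
    {φ : Plane → Plane} {x : Plane} (hT : DifferentiableAt ℝ T (φ x))
    (hφ : DifferentiableAt ℝ φ x) : DifferentiableAt ℝ (fun y => T (φ y)) x ∧
      ∀ u, fderiv ℝ (fun y => T (φ y)) x u = fderiv ℝ T (φ x) (fderiv ℝ φ x u) := by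
  have h := hT.hasFDerivAt.comp x hφ.hasFDerivAt
  exact ⟨h.differentiableAt, fun u => by rw [show (fun y => T (φ y)) = T ∘ φ from rfl, h.fderiv]; rfl⟩

variable {G G' : Plane → Matrix (Fin 2) (Fin 2) ℝ} {O O' : Set Plane}

theorem fderiv_bilinear_apply {F : Type*} [NormedAddCommGroup F] [NormedSpace ℝ F]
    {T : Plane → Plane →L[ℝ] Plane →L[ℝ] F} {a b : Plane → Plane} {x : Plane}
    (hT : DifferentiableAt ℝ T x) (ha : DifferentiableAt ℝ a x) (hb : DifferentiableAt ℝ b x)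
    (u : Plane) :
    DifferentiableAt ℝ (fun y => T y (a y) (b y)) x ∧
    fderiv ℝ (fun y => T y (a y) (b y)) x u =
      fderiv ℝ T x u (a x) (b x) + T x (fderiv ℝ a x u) (b x) + T x (a x) (fderiv ℝ b x u) := by
  have h := (hT.hasFDerivAt.clm_apply ha.hasFDerivAt).clm_apply hb.hasFDerivAt
  refine ⟨h.differentiableAt, ?_⟩
  rw [h.fderiv]
  simp
  abel

/-- The second derivatives of `y ↦ g_y(z, z)` in the directions `u`, `w` commute. Expressed through
the metric connection, their difference is twice the left side. -/
theorem MetricOn.bil_curv_self (hG : MetricOn G O) {x : Plane} (hx : x ∈ O) (u w z : Plane) :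
    bil (G x) (curv G x u w z) z = 0 := by
  set b : Plane → ℝ := fun y => bil (G y) z z with hb
  have hbs : ContDiffAt ℝ ∞ b x :=
    ((hG.contDiffAt_bil hx).clm_apply contDiffAt_const).clm_apply contDiffAt_const
  have hsym : IsSymmSndFDerivAt ℝ b x := hbs.isSymmSndFDerivAt (by
    rw [minSmoothness_of_isRCLikeNormedField]; exact two_le_infty)
  have hD : ∀ y ∈ O, ∀ w, fderiv ℝ b y w = 2 * bil (G y) (gam G y w z) z := by
    intro y hy w
    rw [(hG.hasFDerivAt_bil hy z z).fderiv]
    simp only [ContinuousLinearMap.flip_apply]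
    rw [hG.compat hy, hG.bil_symm hy z]; ring
  have hdd : DifferentiableAt ℝ (fderiv ℝ b) x :=
    (hbs.fderiv_right (m := ∞) (by simp)).differentiableAt (by simp)
  have hS : ∀ u w, fderiv ℝ (fderiv ℝ b) x u w =
      2 * (bil (G x) (gam G x u (gam G x w z)) z + bil (G x) (gam G x w z) (gam G x u z)
        + bil (G x) (fderiv ℝ (gam G) x u w z) z) := by
    intro u w
    have h1 : fderiv ℝ (fderiv ℝ b) x u w = fderiv ℝ (fun y => fderiv ℝ b y w) x u := by
      rw [fderiv_clm_apply hdd (differentiableAt_const _)]; simp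
    have h2 : (fun y => fderiv ℝ b y w) =ᶠ[𝓝 x] fun y => 2 * bil (G y) (gam G y w z) z := by
      filter_upwards [hG.isOpen.mem_nhds hx] with y hy using hD y hy w
    rw [h1, h2.fderiv_eq]
    have hg := hG.hasFDerivAt_gam hx w z
    have h3 := fderiv_bilinear_apply (T := fun y => bil (G y)) (a := fun y => gam G y w z)
      (b := fun _ => z) (hG.differentiableAt_bil hx) hg.differentiableAt
      (differentiableAt_const _) u
    rw [fderiv_const_mul h3.1, smul_apply, h3.2, hg.fderiv, hG.compat hx]
    simp only [ContinuousLinearMap.flip_apply, fderiv_fun_const, Pi.zero_apply, smul_eq_mul,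
      zero_apply, map_zero]
    ring
  have key := hsym u w
  rw [hS, hS, hG.bil_symm hx (gam G x u z)] at key
  simp only [curv, map_add, map_sub, add_apply,
    sub_apply]
  linarith

/-- In dimension two the Gauss curvature determines the curvature tensor. -/
theorem MetricOn.curv_eq (hG : MetricOn G O) {x : Plane} (hx : x ∈ O) (u w z : Plane) :
    curv G x u w z = gaussCurvature G x • (bil (G x) w z • u - bil (G x) u z • w) := by
  -- The tensor is alternating in `u, w`, and by `bil_curv_self` the operator `curv G x u w` is skew
  -- for the metric. In dimension two each of these symmetries leaves a single degree of freedom, so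
  -- one number, normalized in `hK`, determines everything.
  have hlin : curv G x u w z = (u 0 * w 1 - u 1 * w 0) • curv G x (e_ 0) (e_ 1) z := by
    conv_lhs => rw [eq_smul_add_smul u, eq_smul_add_smul w]
    simp only [curv, map_add, map_smul, add_apply,
      smul_apply]
    module
  have hadd : ∀ a b : Plane, curv G x (e_ 0) (e_ 1) (a + b)
      = curv G x (e_ 0) (e_ 1) a + curv G x (e_ 0) (e_ 1) b := by
    intro a b; simp only [curv, map_add]; abel
  have hsm : ∀ (r : ℝ) (a : Plane), curv G x (e_ 0) (e_ 1) (r • a)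
      = r • curv G x (e_ 0) (e_ 1) a := by
    intro a b; simp only [curv, map_smul]; module
  have hself := hG.bil_curv_self hx (e_ 0) (e_ 1)
  have hanti : ∀ a b, bil (G x) (curv G x (e_ 0) (e_ 1) a) b
      = - bil (G x) (curv G x (e_ 0) (e_ 1) b) a := by
    intro a b
    have := hself (a + b)
    rw [hadd] at this
    simp only [map_add, add_apply, hself] at this
    linarith
  have hK : bil (G x) (curv G x (e_ 0) (e_ 1) (e_ 1)) (e_ 0)
      = gaussCurvature G x * (G x).det := by
    rw [gaussCurvature, div_mul_cancel₀ _ (hG.det_pos hx).ne', bil_apply]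
    simp [Fin.sum_univ_two, hG.riemann_eq hx, hG.symm x hx]
  refine hG.nondeg hx fun v => ?_
  have hzv : bil (G x) (curv G x (e_ 0) (e_ 1) z) v
      = (z 1 * v 0 - z 0 * v 1) * (gaussCurvature G x * (G x).det) := by
    rw [← hK]
    conv_lhs => rw [eq_smul_add_smul z, eq_smul_add_smul v]
    rw [hadd, hsm, hsm]
    simp only [map_add, map_smul, add_apply,
      smul_apply, smul_eq_mul, hself]
    rw [hanti (e_ 0) (e_ 1)]
    ring
  rw [hlin, map_smul, smul_apply, hzv]
  simp only [map_sub, map_smul, sub_apply,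
      smul_apply, smul_eq_mul]
  simp only [bil_apply, Matrix.det_fin_two, hG.symm x hx]
  ring

/-- `φ` pulls the metric `G'` on `O'` back to the metric `G` on `O`. -/
structure IsLocalIsometry (G : Plane → Matrix (Fin 2) (Fin 2) ℝ) (O : Set Plane)
    (G' : Plane → Matrix (Fin 2) (Fin 2) ℝ) (O' : Set Plane) (φ : Plane → Plane) : Prop where
  metric : MetricOn G O
  metric' : MetricOn G' O'
  smooth : ContDiffOn ℝ ∞ φ O
  mapsTo : MapsTo φ O O'
  isometry : ∀ x ∈ O, ∀ u w, bil (G x) u w = bil (G' (φ x)) (fderiv ℝ φ x u) (fderiv ℝ φ x w)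

variable {φ : Plane → Plane}

theorem IsLocalIsometry.smoothAt (h : IsLocalIsometry G O G' O' φ) {x : Plane} (hx : x ∈ O) :
    ContDiffAt ℝ ∞ φ x :=
  h.smooth.contDiffAt (h.metric.isOpen.mem_nhds hx)

theorem IsLocalIsometry.differentiableAt (h : IsLocalIsometry G O G' O' φ) {x : Plane}
    (hx : x ∈ O) : DifferentiableAt ℝ φ x :=
  (h.smoothAt hx).differentiableAt (by simp)

theorem IsLocalIsometry.smoothAt_fderiv (h : IsLocalIsometry G O G' O' φ) {x : Plane}
    (hx : x ∈ O) : ContDiffAt ℝ ∞ (fderiv ℝ φ) x :=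
  (h.smoothAt hx).fderiv_right (m := ∞) (by simp)

theorem IsLocalIsometry.injective (h : IsLocalIsometry G O G' O' φ) {x : Plane} (hx : x ∈ O) :
    Function.Injective (fderiv ℝ φ x) := by
  refine (injective_iff_map_eq_zero _).mpr fun u hu => ?_
  by_contra hne
  have := h.metric.pos x hx u hne
  rw [h.isometry x hx, hu] at this
  simp at this

theorem IsLocalIsometry.surjective (h : IsLocalIsometry G O G' O' φ) {x : Plane} (hx : x ∈ O) :
    Function.Surjective (fderiv ℝ φ x) :=
  LinearMap.surjective_of_injective (f := (fderiv ℝ φ x : Plane →ₗ[ℝ] Plane)) (h.injective hx)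

theorem fderiv_fderiv_apply {F : Type*} [NormedAddCommGroup F] [NormedSpace ℝ F]
    {ψ : Plane → Plane →L[ℝ] F} {x : Plane} (h : DifferentiableAt ℝ ψ x) (w : Plane) :
    DifferentiableAt ℝ (fun y => ψ y w) x ∧
    ∀ u, fderiv ℝ (fun y => ψ y w) x u = fderiv ℝ ψ x u w := by
  refine ⟨h.clm_apply (differentiableAt_const _), fun u => ?_⟩
  rw [fderiv_clm_apply h (differentiableAt_const _)]; simp

theorem IsLocalIsometry.fderiv_bil (h : IsLocalIsometry G O G' O' φ) {x : Plane} (hx : x ∈ O)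
    (z u w : Plane) :
    fderiv ℝ (fun x => bil (G x)) x z u w =
      fderiv ℝ (fun x => bil (G' x)) (φ x) (fderiv ℝ φ x z) (fderiv ℝ φ x u) (fderiv ℝ φ x w)
      + bil (G' (φ x)) (fderiv ℝ (fderiv ℝ φ) x z u) (fderiv ℝ φ x w)
      + bil (G' (φ x)) (fderiv ℝ φ x u) (fderiv ℝ (fderiv ℝ φ) x z w) := by
  have hdd : DifferentiableAt ℝ (fderiv ℝ φ) x := (h.smoothAt_fderiv hx).differentiableAt (by simp)
  have h1 : fderiv ℝ (fun x => bil (G x)) x z u w = fderiv ℝ (fun y => bil (G y) u w) x z := by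
    rw [(h.metric.hasFDerivAt_bil hx u w).fderiv]; rfl
  have h2 : (fun y => bil (G y) u w) =ᶠ[𝓝 x]
      fun y => bil (G' (φ y)) (fderiv ℝ φ y u) (fderiv ℝ φ y w) := by
    filter_upwards [h.metric.isOpen.mem_nhds hx] with y hy using h.isometry y hy u w
  have hb := h.metric'.differentiableAt_bil (h.mapsTo hx)
  have h4 := fderiv_comp_plane (T := fun y => bil (G' y)) hb (h.differentiableAt hx)
  have h3 := fderiv_bilinear_apply (T := fun y => bil (G' (φ y))) (a := fun y => fderiv ℝ φ y u)
      (b := fun y => fderiv ℝ φ y w) h4.1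
      (fderiv_fderiv_apply hdd u).1 (fderiv_fderiv_apply hdd w).1 z
  rw [h1, h2.fderiv_eq, h3.2, (fderiv_fderiv_apply hdd u).2, (fderiv_fderiv_apply hdd w).2, h4.2]

theorem IsLocalIsometry.snd_symm (h : IsLocalIsometry G O G' O' φ) {x : Plane} (hx : x ∈ O)
    (u w : Plane) : fderiv ℝ (fderiv ℝ φ) x u w = fderiv ℝ (fderiv ℝ φ) x w u :=
  (h.smoothAt hx).isSymmSndFDerivAt (by
    rw [minSmoothness_of_isRCLikeNormedField]; exact two_le_infty) u w

/-- Transformation law of the Christoffel symbols. -/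
theorem IsLocalIsometry.map_gam (h : IsLocalIsometry G O G' O' φ) {x : Plane} (hx : x ∈ O)
    (u w : Plane) :
    fderiv ℝ φ x (gam G x u w) = gam G' (φ x) (fderiv ℝ φ x u) (fderiv ℝ φ x w)
      + fderiv ℝ (fderiv ℝ φ) x u w := by
  -- The differential is onto, so it suffices to pair with vectors `dφ z` and compare the two Koszul
  -- formulas. Of the second derivatives of `φ` produced by the pulled back metric, all cancel
  -- except `2 ⟨D²φ(u, w), dφ z⟩`.
  refine h.metric'.nondeg (h.mapsTo hx) fun z' => ?_
  obtain ⟨z, rfl⟩ := h.surjective hx z'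
  rw [← h.isometry x hx]
  have h1 := h.metric.koszul hx u w z
  have h2 := h.metric'.koszul (h.mapsTo hx) (fderiv ℝ φ x u) (fderiv ℝ φ x w) (fderiv ℝ φ x z)
  rw [h.fderiv_bil hx, h.fderiv_bil hx, h.fderiv_bil hx, h.snd_symm hx w u, h.snd_symm hx z u,
    h.snd_symm hx z w] at h1
  simp only [map_add, add_apply]
  rw [h.metric'.bil_symm (h.mapsTo hx) (fderiv ℝ φ x w),
    h.metric'.bil_symm (h.mapsTo hx) (fderiv ℝ φ x u) (fderiv ℝ (fderiv ℝ φ) x w z)] at h1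
  linarith

/-- The curvature tensor is natural under local isometries. -/
theorem IsLocalIsometry.map_curv (h : IsLocalIsometry G O G' O' φ) {x : Plane} (hx : x ∈ O)
    (u w z : Plane) :
    fderiv ℝ φ x (curv G x u w z) =
      curv G' (φ x) (fderiv ℝ φ x u) (fderiv ℝ φ x w) (fderiv ℝ φ x z) := by
  have hdd : DifferentiableAt ℝ (fderiv ℝ φ) x := (h.smoothAt_fderiv hx).differentiableAt (by simp)
  have hddd : DifferentiableAt ℝ (fderiv ℝ (fderiv ℝ φ)) x :=
    ((h.smoothAt_fderiv hx).fderiv_right (m := ∞) (by simp)).differentiableAt (by simp)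
  have hsym3 : ∀ u w, fderiv ℝ (fderiv ℝ (fderiv ℝ φ)) x u w
      = fderiv ℝ (fderiv ℝ (fderiv ℝ φ)) x w u :=
    (h.smoothAt_fderiv hx).isSymmSndFDerivAt (by
      rw [minSmoothness_of_isRCLikeNormedField]; exact two_le_infty)
  have hgam := h.metric'.differentiableAt_gam (h.mapsTo hx)
  -- This is the derivative of the transformation law `map_gam` in the direction `u`.
  -- Antisymmetrizing in `u, w` removes the third derivative and the term in `D²φ(u, w)`; the other
  -- second derivatives are absorbed by `map_gam` applied to the iterated products `m1`, `m2`.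
  have key : ∀ u w z, fderiv ℝ (fderiv ℝ φ) x u (gam G x w z)
      + fderiv ℝ φ x (fderiv ℝ (gam G) x u w z) =
      fderiv ℝ (gam G') (φ x) (fderiv ℝ φ x u) (fderiv ℝ φ x w) (fderiv ℝ φ x z)
      + gam G' (φ x) (fderiv ℝ (fderiv ℝ φ) x u w) (fderiv ℝ φ x z)
      + gam G' (φ x) (fderiv ℝ φ x w) (fderiv ℝ (fderiv ℝ φ) x u z)
      + fderiv ℝ (fderiv ℝ (fderiv ℝ φ)) x u w z := by
    intro u w z
    have h1 : (fun y => fderiv ℝ φ y (gam G y w z)) =ᶠ[𝓝 x] fun y =>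
        gam G' (φ y) (fderiv ℝ φ y w) (fderiv ℝ φ y z) + fderiv ℝ (fderiv ℝ φ) y w z := by
      filter_upwards [h.metric.isOpen.mem_nhds hx] with y hy using h.map_gam hy w z
    have hg := h.metric.hasFDerivAt_gam hx w z
    have h2 := congrArg (fun T : Plane →L[ℝ] Plane => T u) h1.fderiv_eq
    have h4 := fderiv_comp_plane (T := gam G') hgam (h.differentiableAt hx)
    have h3 := fderiv_bilinear_apply (T := fun y => gam G' (φ y)) (a := fun y => fderiv ℝ φ y w)
      (b := fun y => fderiv ℝ φ y z) h4.1
      (fderiv_fderiv_apply hdd w).1 (fderiv_fderiv_apply hdd z).1 u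
    have h5 := fderiv_fderiv_apply (F := Plane) (ψ := fun y => fderiv ℝ (fderiv ℝ φ) y w)
      (fderiv_fderiv_apply hddd w).1 z
    have h6 := fderiv_fderiv_apply hddd w
    rw [fderiv_clm_apply hdd hg.differentiableAt, fderiv_fun_add h3.1 h5.1, hg.fderiv] at h2
    simp only [add_apply, ContinuousLinearMap.comp_apply, ContinuousLinearMap.flip_apply] at h2
    rw [h3.2, h4.2, (fderiv_fderiv_apply hdd w).2, (fderiv_fderiv_apply hdd z).2, h5.2, h6.2] at h2
    rw [add_comm, h2]
  have k1 := key u w z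
  have k2 := key w u z
  rw [hsym3 w u, h.snd_symm hx w u] at k2
  have m1 := h.map_gam hx u (gam G x w z)
  have m2 := h.map_gam hx w (gam G x u z)
  rw [h.map_gam hx w z, map_add] at m1
  rw [h.map_gam hx u z, map_add] at m2
  simp only [curv, map_add, map_sub]
  linear_combination (norm := module) k1 - k2 + m1 - m2

/-- By `curv_eq`, the first component of `R(∂₀, ∂₁)∂₁` is the Gauss curvature times the positive
number `G x 1 1`, so naturality of the curvature tensor and injectivity of the differential
determine the curvature. -/
theorem IsLocalIsometry.gaussCurvature_eq (h : IsLocalIsometry G O G' O' φ) {x : Plane}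
    (hx : x ∈ O) : gaussCurvature G' (φ x) = gaussCurvature G x := by
  have h1 := h.map_curv hx (e_ 0) (e_ 1) (e_ 1)
  rw [h.metric.curv_eq hx, h.metric'.curv_eq (h.mapsTo hx), ← h.isometry x hx, ← h.isometry x hx,
    ← map_smul, ← map_smul, ← map_sub, ← map_smul] at h1
  have h2 := congrArg (fun v : Plane => v 0) (h.injective hx h1)
  simp [bil_single] at h2
  have h3 := h.metric.pos x hx (e_ 1) (by intro h; simpa using congrArg (fun v : Plane => v 1) h)
  rw [bil_single] at h3
  rcases h2 with h2 | h2
  · exact h2.symm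
  · exact absurd h2 h3.ne'

end CoordMetric

/-! ### Acceleration, geodesic curvature and the unit normal of a curve. -/

namespace CoordMetric
variable {G G' : Plane → Matrix (Fin 2) (Fin 2) ℝ} {O O' : Set Plane} {φ : Plane → Plane}

/-- The standard area form of the plane. -/
def cross (u w : Plane) : ℝ := u 0 * w 1 - u 1 * w 0

theorem cross_map (A : Plane →L[ℝ] Plane) (u w : Plane) :
    cross (A u) (A w) = cross (A (e_ 0)) (A (e_ 1)) * cross u w := by
  conv_lhs => rw [eq_smul_add_smul u, eq_smul_add_smul w]
  simp only [cross, map_add, map_smul, PiLp.add_apply, PiLp.smul_apply, smul_eq_mul]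
  ring

/-- The covariant acceleration of a curve, as a vector. -/
def acc (G : Plane → Matrix (Fin 2) (Fin 2) ℝ) (c : ℝ → Plane) (t : ℝ) : Plane :=
  deriv (deriv c) t + gam G (c t) (deriv c t) (deriv c t)

variable {c : ℝ → Plane} {t : ℝ}

theorem velocity_eq (h : DifferentiableAt ℝ c t) (k : Fin 2) : velocity c t k = deriv c t k := by
  have := (EuclideanSpace.proj k : Plane →L[ℝ] ℝ).hasFDerivAt.comp_hasDerivAt t h.hasDerivAt
  exact this.deriv

theorem differentiableAt_deriv {F : Type*} [NormedAddCommGroup F] [NormedSpace ℝ F] {c : ℝ → F}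
    (h : ContDiffAt ℝ 2 c t) :
    (∀ᶠ s in 𝓝 t, DifferentiableAt ℝ c s) ∧ DifferentiableAt ℝ (deriv c) t := by
  refine ⟨(h.eventually (by simp)).mono fun s hs => hs.differentiableAt (by simp), ?_⟩
  have : ContDiffAt ℝ 1 (fderiv ℝ c) t := h.fderiv_right (by norm_num)
  exact (this.differentiableAt (by simp)).clm_apply (differentiableAt_const (1 : ℝ))

theorem acceleration_eq (h : ContDiffAt ℝ 2 c t) (k : Fin 2) :
    acceleration G c t k = acc G c t k := by
  obtain ⟨h0, h2⟩ := differentiableAt_deriv h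
  have h1 : (fun s => velocity c s k) =ᶠ[𝓝 t] fun s => deriv c s k := by
    filter_upwards [h0] with s hs using velocity_eq hs k
  have := ((EuclideanSpace.proj k : Plane →L[ℝ] ℝ).hasFDerivAt.comp_hasDerivAt t
    h2.hasDerivAt).deriv
  rw [acceleration, h1.deriv_eq, acc, PiLp.add_apply, gam_apply]
  simp only [velocity_eq h0.self_of_nhds]
  congr 1

theorem speed_eq (h : DifferentiableAt ℝ c t) :
    speed G c t = Real.sqrt (bil (G (c t)) (deriv c t) (deriv c t)) := by
  rw [speed, bil_apply]
  simp only [velocity_eq h, Fin.sum_univ_two]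
  congr 1; ring

theorem geodesicCurvature_eq (h : ContDiffAt ℝ 2 c t) :
    geodesicCurvature G c t = Real.sqrt (G (c t)).det * cross (deriv c t) (acc G c t)
      / Real.sqrt (bil (G (c t)) (deriv c t) (deriv c t)) ^ 3 := by
  have hd := h.differentiableAt (by simp)
  simp only [geodesicCurvature, velocity_eq hd, acceleration_eq h, speed_eq hd, cross]


theorem IsLocalIsometry.deriv_comp (h : IsLocalIsometry G O G' O' φ) (hx : c t ∈ O)
    (hc : DifferentiableAt ℝ c t) : deriv (φ ∘ c) t = fderiv ℝ φ (c t) (deriv c t) :=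
  ((h.differentiableAt hx).hasFDerivAt.comp_hasDerivAt t hc.hasDerivAt).deriv

/-- The second derivative of `φ` created by differentiating `dφ(c')` is the inhomogeneous term in
the transformation law of the Christoffel symbols. -/
theorem IsLocalIsometry.acc_comp (h : IsLocalIsometry G O G' O' φ) (hx : c t ∈ O)
    (hc : ContDiffAt ℝ 2 c t) : acc G' (φ ∘ c) t = fderiv ℝ φ (c t) (acc G c t) := by
  obtain ⟨h0, h2⟩ := differentiableAt_deriv hc
  have hd := h0.self_of_nhds
  have h1 : deriv (φ ∘ c) =ᶠ[𝓝 t] fun s => fderiv ℝ φ (c s) (deriv c s) := by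
    filter_upwards [h0, hd.continuousAt.preimage_mem_nhds (h.metric.isOpen.mem_nhds hx)] with s hs
      hs' using h.deriv_comp hs' hs
  have h3 : HasDerivAt (fun s => fderiv ℝ φ (c s)) (fderiv ℝ (fderiv ℝ φ) (c t) (deriv c t)) t :=
    (((h.smoothAt_fderiv hx).differentiableAt (by simp)).hasFDerivAt).comp_hasDerivAt t
      hd.hasDerivAt
  rw [acc, h1.deriv_eq, (h3.clm_apply h2.hasDerivAt).deriv, h.deriv_comp hx hd, acc, map_add,
    h.map_gam hx, Function.comp_apply]
  abel

theorem IsLocalIsometry.det_eq (h : IsLocalIsometry G O G' O' φ) {x : Plane} (hx : x ∈ O) :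
    (G x).det = (G' (φ x)).det * cross (fderiv ℝ φ x (e_ 0)) (fderiv ℝ φ x (e_ 1)) ^ 2 := by
  have h' := fun i j => (bil_single (G x) i j).symm.trans (h.isometry x hx (e_ i) (e_ j))
  simp only [Matrix.det_fin_two, h', bil_apply, cross]
  ring

theorem IsLocalIsometry.cross_ne_zero (h : IsLocalIsometry G O G' O' φ) {x : Plane} (hx : x ∈ O) :
    cross (fderiv ℝ φ x (e_ 0)) (fderiv ℝ φ x (e_ 1)) ≠ 0 := by
  intro h0
  have := h.det_eq hx
  rw [h0] at this
  have := h.metric.det_pos hx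
  simp_all

/-- Geodesic curvature is preserved by orientation preserving local isometries and changes its
sign under orientation reversing ones. -/
theorem IsLocalIsometry.geodesicCurvature_comp (h : IsLocalIsometry G O G' O' φ) (hx : c t ∈ O)
    (hc : ContDiffAt ℝ 2 c t) : geodesicCurvature G' (φ ∘ c) t =
      SignType.sign (cross (fderiv ℝ φ (c t) (e_ 0)) (fderiv ℝ φ (c t) (e_ 1)))
        * geodesicCurvature G c t := by
  have hφc : ContDiffAt ℝ 2 (φ ∘ c) t := ((h.smoothAt hx).of_le two_le_infty).comp t hc
  rw [geodesicCurvature_eq hφc, geodesicCurvature_eq hc, h.acc_comp hx hc,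
    h.deriv_comp hx (hc.differentiableAt (by simp)), cross_map, h.det_eq hx, Function.comp_apply,
    ← h.isometry _ hx, Real.sqrt_mul (h.metric'.det_pos (h.mapsTo hx)).le, Real.sqrt_sq_eq_abs]
  rcases lt_or_gt_of_ne (h.cross_ne_zero hx) with h0 | h0
  · rw [abs_of_neg h0, sign_neg h0]; simp; ring
  · rw [abs_of_pos h0, sign_pos h0]; simp; ring

/-- Being a vertex is independent of the coordinates: the sign of the Jacobian is locally constant
along the curve, so near `t` the two curvatures differ by a constant factor `±1`. -/
theorem IsLocalIsometry.deriv_geodesicCurvature_comp (h : IsLocalIsometry G O G' O' φ)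
    (hx : c t ∈ O) (hc : ContDiffAt ℝ 2 c t) :
    deriv (geodesicCurvature G' (φ ∘ c)) t = 0 ↔ deriv (geodesicCurvature G c) t = 0 := by
  have hcont : ContinuousAt (fun s => cross (fderiv ℝ φ (c s) (e_ 0)) (fderiv ℝ φ (c s) (e_ 1)))
      t := by
    have h1 : ContinuousAt (fun s => fderiv ℝ φ (c s)) t :=
      ContinuousAt.comp (f := c) (g := fderiv ℝ φ) (h.smoothAt_fderiv hx).continuousAt
        hc.continuousAt
    have h2 : ∀ i j, ContinuousAt (fun s => fderiv ℝ φ (c s) (e_ i) j) t := fun i j =>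
      (EuclideanSpace.proj j : Plane →L[ℝ] ℝ).continuous.continuousAt.comp
        (h1.clm_apply continuousAt_const)
    exact ((h2 0 0).mul (h2 1 1)).sub ((h2 0 1).mul (h2 1 0))
  set s0 : ℝ :=
    ((SignType.sign (cross (fderiv ℝ φ (c t) (e_ 0)) (fderiv ℝ φ (c t) (e_ 1))) : SignType) : ℝ)
  have hs0 : s0 ≠ 0 := by
    have := sign_ne_zero.mpr (h.cross_ne_zero hx)
    simp only [s0]
    rcases lt_or_gt_of_ne (h.cross_ne_zero hx) with h0 | h0
    · simp [sign_neg h0]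
    · simp [sign_pos h0]
  have hev : geodesicCurvature G' (φ ∘ c) =ᶠ[𝓝 t] fun s => s0 * geodesicCurvature G c s := by
    have hsign : ∀ᶠ s in 𝓝 t, SignType.sign (cross (fderiv ℝ φ (c s) (e_ 0))
        (fderiv ℝ φ (c s) (e_ 1))) =
        SignType.sign (cross (fderiv ℝ φ (c t) (e_ 0)) (fderiv ℝ φ (c t) (e_ 1))) := by
      rcases lt_or_gt_of_ne (h.cross_ne_zero hx) with h0 | h0
      · filter_upwards [hcont.eventually_lt continuousAt_const h0] with s hs
        rw [sign_neg h0, sign_neg hs]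
      · filter_upwards [continuousAt_const.eventually_lt hcont h0] with s hs
        rw [sign_pos h0, sign_pos hs]
    filter_upwards [hsign, hc.eventually (by simp),
      hc.continuousAt.preimage_mem_nhds (h.metric.isOpen.mem_nhds hx)] with s hs hs1 hs2
    rw [h.geodesicCurvature_comp hs2 hs1, hs]
  rw [hev.deriv_eq, deriv_const_mul_field]
  simp [hs0]

theorem hasDerivAt_comp_plane {F : Type*} [NormedAddCommGroup F] [NormedSpace ℝ F] {T : Plane → F}
    {v : Plane} (hT : DifferentiableAt ℝ T (c t)) (hc : HasDerivAt c v t) :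
    HasDerivAt (fun s => T (c s)) (fderiv ℝ T (c t) v) t :=
  hT.hasFDerivAt.comp_hasDerivAt t hc

/-- The unit normal of a curve. -/
def nrm (G : Plane → Matrix (Fin 2) (Fin 2) ℝ) (c : ℝ → Plane) (t : ℝ) : Plane :=
  (Real.sqrt (G (c t)).det * Real.sqrt (bil (G (c t)) (deriv c t) (deriv c t)))⁻¹ •
    (bil (G (c t)) (deriv c t) (e_ 0) • e_ 1 - bil (G (c t)) (deriv c t) (e_ 1) • e_ 0)

/-- Pairing with the normal is the area form against the unit tangent. This gives orthogonality to
the velocity and matches the orientation used in `geodesicCurvature`. -/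
theorem MetricOn.bil_nrm (hG : MetricOn G O) (hx : c t ∈ O) (hv : deriv c t ≠ 0) :
    bil (G (c t)) (nrm G c t) (nrm G c t) = 1 ∧
    (∀ u, bil (G (c t)) (nrm G c t) u = Real.sqrt (G (c t)).det * cross (deriv c t) u /
      Real.sqrt (bil (G (c t)) (deriv c t) (deriv c t))) ∧ cross (deriv c t) (nrm G c t) ≠ 0 := by
  have hd := hG.det_pos hx
  have hb := hG.pos _ hx _ hv
  have hs1 := Real.sq_sqrt hd.le
  have hs2 := Real.sq_sqrt hb.le
  have hp1 := Real.sqrt_pos.mpr hd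
  have hp2 := Real.sqrt_pos.mpr hb
  have h0 : ∀ u, bil (G (c t)) (nrm G c t) u = Real.sqrt (G (c t)).det * cross (deriv c t) u /
      Real.sqrt (bil (G (c t)) (deriv c t) (deriv c t)) := by
    intro u
    have : bil (G (c t)) (bil (G (c t)) (deriv c t) (e_ 0) • e_ 1
        - bil (G (c t)) (deriv c t) (e_ 1) • e_ 0) u
        = (G (c t)).det * cross (deriv c t) u := by
      simp only [bil_apply, cross, Matrix.det_fin_two, hG.symm _ hx]
      simp
      ring
    rw [nrm, map_smul, smul_apply, this, smul_eq_mul]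
    nth_rw 2 [← hs1]
    field_simp
  have h1 : cross (deriv c t) (nrm G c t) = Real.sqrt (bil (G (c t)) (deriv c t) (deriv c t))
      / Real.sqrt (G (c t)).det := by
    have : cross (deriv c t) (nrm G c t) = (Real.sqrt (G (c t)).det *
        Real.sqrt (bil (G (c t)) (deriv c t) (deriv c t)))⁻¹ *
        bil (G (c t)) (deriv c t) (deriv c t) := by
      simp only [cross, nrm, PiLp.smul_apply, PiLp.sub_apply, smul_eq_mul]
      rw [bil_apply _ (deriv c t) (deriv c t)]
      simp only [bil_apply _ _ (e_ _)]
      simp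
      ring
    rw [this]
    nth_rw 2 [← hs2]
    field_simp
  refine ⟨?_, h0, ?_⟩
  · rw [h0, h1]; field_simp
  · rw [h1]; positivity

theorem eq_zero_of_bil_eq_zero (hG : MetricOn G O) {x : Plane} (hx : x ∈ O) {X v n : Plane}
    (hvn : cross v n ≠ 0) (h1 : bil (G x) X v = 0) (h2 : bil (G x) X n = 0) : X = 0 := by
  refine hG.nondeg hx fun z => ?_
  have hz : cross v n • z = cross z n • v + cross v z • n := by
    ext i; fin_cases i <;> simp [cross] <;> ring
  have := congrArg (bil (G x) X) hz
  rw [map_add, map_smul, map_smul, map_smul, h1, h2] at this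
  simpa [hvn] using this

/-- The Frenet equation for the unit normal. -/
theorem MetricOn.hasDerivAt_nrm (hG : MetricOn G O) (hx : c t ∈ O) (hc : ContDiffAt ℝ 2 c t)
    (hv : deriv c t ≠ 0) : HasDerivAt (nrm G c)
      (-(geodesicCurvature G c t • deriv c t) - gam G (c t) (deriv c t) (nrm G c t)) t := by
  obtain ⟨hd, h2⟩ := differentiableAt_deriv hc
  have hd0 := hd.self_of_nhds
  have hev : ∀ᶠ s in 𝓝 t, c s ∈ O ∧ deriv c s ≠ 0 :=
    (hc.continuousAt.eventually_mem (hG.isOpen.mem_nhds hx)).and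
      (h2.continuousAt.eventually_ne hv)
  have hB : HasDerivAt (fun s => bil (G (c s)))
      (fderiv ℝ (fun x => bil (G x)) (c t) (deriv c t)) t :=
    hasDerivAt_comp_plane (T := fun x => bil (G x)) (hG.differentiableAt_bil hx) hd0.hasDerivAt
  have hdet : DifferentiableAt ℝ (fun s => (G (c s)).det) t := by
    have := fun i j => ((hG.smoothAt hx i j).differentiableAt (by simp)).comp t hd0
    simp only [Matrix.det_fin_two]
    exact ((this 0 0).mul (this 1 1)).sub ((this 0 1).mul (this 1 0))
  have hbv : DifferentiableAt ℝ (fun s => bil (G (c s)) (deriv c s)) t :=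
    hB.differentiableAt.clm_apply h2
  have hn : DifferentiableAt ℝ (nrm G c) t := by
    unfold nrm
    refine DifferentiableAt.fun_smul (DifferentiableAt.fun_inv (DifferentiableAt.fun_mul
      (hdet.sqrt (hG.det_pos hx).ne') ((hbv.clm_apply h2).sqrt (hG.pos _ hx _ hv).ne')) ?_) ?_
    · have := Real.sqrt_pos.mpr (hG.det_pos hx)
      have := Real.sqrt_pos.mpr (hG.pos _ hx _ hv)
      positivity
    · exact ((hbv.clm_apply (differentiableAt_const _)).fun_smul (differentiableAt_const _)).fun_sub
        ((hbv.clm_apply (differentiableAt_const _)).fun_smul (differentiableAt_const _))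
  obtain ⟨hnn, hnu, hcr⟩ := hG.bil_nrm hx hv
  have hnv : bil (G (c t)) (nrm G c t) (deriv c t) = 0 := by
    rw [hnu]; simp [cross, mul_comm]
  -- Differentiating `⟨n, n⟩ = 1` and `⟨n, c'⟩ = 0` yields the components of the covariant
  -- derivative of `n` along `n` and along `c'`.
  have e1 : (fun s => bil (G (c s)) (nrm G c s) (nrm G c s)) =ᶠ[𝓝 t] fun _ => 1 := by
    filter_upwards [hev] with s hs using (hG.bil_nrm hs.1 hs.2).1
  have e2 : (fun s => bil (G (c s)) (nrm G c s) (deriv c s)) =ᶠ[𝓝 t] fun _ => 0 := by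
    filter_upwards [hev] with s hs
    rw [(hG.bil_nrm hs.1 hs.2).2.1]; simp [cross, mul_comm]
  have d1 := e1.deriv_eq
  have d2 := e2.deriv_eq
  rw [((hB.clm_apply hn.hasDerivAt).clm_apply hn.hasDerivAt).deriv, deriv_const] at d1
  rw [((hB.clm_apply hn.hasDerivAt).clm_apply h2.hasDerivAt).deriv, deriv_const] at d2
  simp only [add_apply] at d1 d2
  rw [hG.compat hx] at d1 d2
  rw [hG.bil_symm hx (nrm G c t) (gam G (c t) (deriv c t) (nrm G c t)),
    hG.bil_symm hx (nrm G c t) (deriv (nrm G c) t)] at d1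
  have hκ : bil (G (c t)) (nrm G c t) (acc G c t) =
      geodesicCurvature G c t * bil (G (c t)) (deriv c t) (deriv c t) := by
    rw [hnu, geodesicCurvature_eq hc]
    nth_rw 3 [← Real.sq_sqrt (hG.pos _ hx _ hv).le]
    have := Real.sqrt_pos.mpr (hG.pos _ hx _ hv)
    field_simp
  rw [acc, map_add] at hκ
  have key : deriv (nrm G c) t + gam G (c t) (deriv c t) (nrm G c t)
      + geodesicCurvature G c t • deriv c t = 0 := by
    refine eq_zero_of_bil_eq_zero hG hx hcr ?_ ?_
    · simp only [map_add, map_smul, add_apply, smul_apply, smul_eq_mul]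
      linarith
    · simp only [map_add, map_smul, add_apply, smul_apply, smul_eq_mul]
      rw [hG.bil_symm hx (deriv c t), hnv]
      linarith
  refine hn.hasDerivAt.congr_deriv ?_
  linear_combination (norm := module) key

/-- `f` solves `∇² f = - K f g` on `O` and `η` is its differential. -/
structure IsHessianSolution (G : Plane → Matrix (Fin 2) (Fin 2) ℝ) (O : Set Plane) (K : ℝ)
    (f : Plane → ℝ) (η : Plane → Plane →L[ℝ] ℝ) : Prop where
  hasFDerivAt : ∀ x ∈ O, HasFDerivAt f (η x) x
  differentiableAt : ∀ x ∈ O, DifferentiableAt ℝ η x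
  hessian : ∀ x ∈ O, ∀ u z, fderiv ℝ η x u z = η x (gam G x u z) - K * f x * bil (G x) u z

/-- The Hessian contributes a multiple of `g(c', n) = 0`, so only the Frenet term survives. Together
with the derivative `η(c')` of `f` along the curve this makes `k f + η(n)` a primitive of `k' f`,
where `k` is the geodesic curvature. -/
theorem IsHessianSolution.hasDerivAt_normal {K : ℝ} {f : Plane → ℝ} {η : Plane → Plane →L[ℝ] ℝ}
    (h : IsHessianSolution G O K f η) (hG : MetricOn G O) (hx : c t ∈ O)
    (hc : ContDiffAt ℝ 2 c t) (hv : deriv c t ≠ 0) :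
    HasDerivAt (fun s => η (c s) (nrm G c s))
      (-(geodesicCurvature G c t * η (c t) (deriv c t))) t := by
  have h1 : HasDerivAt (fun s => η (c s)) (fderiv ℝ η (c t) (deriv c t)) t :=
    (h.differentiableAt _ hx).hasFDerivAt.comp_hasDerivAt t
      (hc.differentiableAt (by simp)).hasDerivAt
  refine (h1.clm_apply (hG.hasDerivAt_nrm hx hc hv)).congr_deriv ?_
  have hnv : bil (G (c t)) (deriv c t) (nrm G c t) = 0 := by
    rw [hG.bil_symm hx, (hG.bil_nrm hx hv).2.1]; simp [cross, mul_comm]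
  rw [h.hessian _ hx, hnv, map_sub, map_neg, map_smul, smul_eq_mul]
  ring

end CoordMetric

/-! ### Pulling the metric of the surface back to the plane. -/

section Surface
open CoordMetric
variable {M : Type*} [TopologicalSpace M] [ChartedSpace Plane M] [IsManifold (𝓡 2) ∞ M]

/-- Coordinate matrix of the pullback of the metric `g` by the map `F`. -/
def pullMatrix (g : Bundle.ContMDiffRiemannianMetric (𝓡 2) ∞ Plane
      (fun p : M => TangentSpace (𝓡 2) p))
    (F : Plane → M) (x : Plane) : Matrix (Fin 2) (Fin 2) ℝ :=
  Matrix.of fun i j => g.inner (F x)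
    (mfderiv (𝓡 2) (𝓡 2) F x (EuclideanSpace.single i (1 : ℝ) : Plane))
    (mfderiv (𝓡 2) (𝓡 2) F x (EuclideanSpace.single j (1 : ℝ) : Plane))

variable {g : Bundle.ContMDiffRiemannianMetric (𝓡 2) ∞ Plane (fun p : M => TangentSpace (𝓡 2) p)}
  {F F' : Plane → M} {O O' : Set Plane}

theorem metricMatrix_eq (e : OpenPartialHomeomorph M Plane) :
    metricMatrix g e = pullMatrix g e.symm := rfl

theorem bil_pullMatrix (x u w : Plane) : bil (pullMatrix g F x) u w =
    g.inner (F x) (mfderiv (𝓡 2) (𝓡 2) F x u) (mfderiv (𝓡 2) (𝓡 2) F x w) := by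
  have key : ∀ A : TangentSpace (𝓡 2) x →L[ℝ] TangentSpace (𝓡 2) (F x),
      bil (Matrix.of fun i j => g.inner (F x)
      (A (EuclideanSpace.single i (1 : ℝ) : Plane))
      (A (EuclideanSpace.single j (1 : ℝ) : Plane))) u w = g.inner (F x) (A u) (A w) := by
    intro A
    have hu : A u = u 0 • A (e_ 0 : Plane) + u 1 • A (e_ 1 : Plane) := by
      conv_lhs => rw [eq_smul_add_smul u]
      exact (A.map_add _ _).trans (congrArg₂ _ (A.map_smul _ _) (A.map_smul _ _))
    have hw : A w = w 0 • A (e_ 0 : Plane) + w 1 • A (e_ 1 : Plane) := by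
      conv_lhs => rw [eq_smul_add_smul w]
      exact (A.map_add _ _).trans (congrArg₂ _ (A.map_smul _ _) (A.map_smul _ _))
    rw [hu, hw, bil_apply]
    simp only [map_add, map_smul, add_apply, smul_apply, smul_eq_mul, Matrix.of_apply]
    ring
  exact key _

theorem contDiffOn_pullMatrix (hO : IsOpen O) (hF : ContMDiffOn (𝓡 2) (𝓡 2) ∞ F O) (i j : Fin 2) :
    ContDiffOn ℝ ∞ (fun x => pullMatrix g F x i j) O := by
  -- The coordinate fields along `F` are the tangent map of `F` composed with constant sections of
  -- the tangent bundle of the plane.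
  have hsec : ∀ i, ContMDiffOn (𝓡 2) ((𝓡 2).prod 𝓘(ℝ, Plane)) ∞
      (fun x => (⟨F x, mfderiv (𝓡 2) (𝓡 2) F x (EuclideanSpace.single i (1 : ℝ) : Plane)⟩ :
        TangentBundle (𝓡 2) M)) O := by
    intro i
    have h1 := hF.contMDiffOn_tangentMapWithin (m := ∞) (by simp) hO.uniqueMDiffOn
    have h2 : ContMDiff (𝓡 2) ((𝓡 2).prod 𝓘(ℝ, Plane)) ∞
      (fun x => (⟨x, (EuclideanSpace.single i (1 : ℝ) : Plane)⟩ : TangentBundle (𝓡 2) Plane)) := by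
      intro x
      rw [Bundle.contMDiffAt_totalSpace]
      refine ⟨contMDiffAt_id, ?_⟩
      have h3 : ContMDiffAt (𝓡 2) 𝓘(ℝ, Plane) ∞
          (fun _ : Plane => (EuclideanSpace.single i (1 : ℝ) : Plane)) x := contMDiffAt_const
      refine h3.congr_of_eventuallyEq (Filter.Eventually.of_forall fun y => ?_)
      simp only [trivializationAt_model_space_apply]
    refine (h1.comp h2.contMDiffOn (fun x hx => hx)).congr fun x hx => ?_
    simp only [Function.comp, tangentMapWithin, mfderivWithin_of_isOpen hO hx]
  rw [← contMDiffOn_iff_contDiffOn]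
  intro x hx
  have : ContMDiffWithinAt (𝓡 2) ((𝓡 2).prod 𝓘(ℝ)) ∞
      (fun x ↦ Bundle.TotalSpace.mk' ℝ (E := Bundle.Trivial M ℝ) (F x) (pullMatrix g F x i j))
      O x := by
    apply ContMDiffWithinAt.clm_bundle_apply₂ (F₁ := Plane) (F₂ := Plane)
    · exact ContMDiffAt.comp_contMDiffWithinAt x g.contMDiff.contMDiffAt (hF x hx)
    · exact hsec i x hx
    · exact hsec j x hx
  simp only [Bundle.contMDiffWithinAt_totalSpace] at this
  exact this.2

theorem metricOn_pullMatrix (hO : IsOpen O) (hF : ContMDiffOn (𝓡 2) (𝓡 2) ∞ F O)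
    (hinj : ∀ x ∈ O, Function.Injective (mfderiv (𝓡 2) (𝓡 2) F x)) :
    MetricOn (pullMatrix g F) O where
  isOpen := hO
  smooth := contDiffOn_pullMatrix hO hF
  symm x _ := g.symm _ _ _
  pos x hx u hu := by
    rw [bil_pullMatrix]
    refine g.pos _ _ fun h => hu (hinj x hx (h.trans (map_zero _).symm))

/-- The source of all local isometries used below: translation by the period and the passage from
the strip to a chart both factor one parametrization of `M` through another. -/
theorem isLocalIsometry_pullMatrix {φ : Plane → Plane} (hO : IsOpen O) (hO' : IsOpen O')
    (hF' : ContMDiffOn (𝓡 2) (𝓡 2) ∞ F' O') (hφ : ContDiffOn ℝ ∞ φ O) (hm : MapsTo φ O O')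
    (hinj : ∀ x ∈ O', Function.Injective (mfderiv (𝓡 2) (𝓡 2) F' x))
    (hinj' : ∀ x ∈ O, Function.Injective (mfderiv (𝓡 2) (𝓡 2) F x))
    (hcomp : ∀ x ∈ O, F x = F' (φ x)) :
    IsLocalIsometry (pullMatrix g F) O (pullMatrix g F') O' φ := by
  have hφ' : ContMDiffOn (𝓡 2) (𝓡 2) ∞ φ O := contMDiffOn_iff_contDiffOn.mpr hφ
  have hF : ContMDiffOn (𝓡 2) (𝓡 2) ∞ F O := (hF'.comp hφ' hm).congr hcomp
  refine ⟨metricOn_pullMatrix hO hF hinj', metricOn_pullMatrix hO' hF' hinj, hφ, hm, ?_⟩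
  intro x hx u w
  have hev : F =ᶠ[𝓝 x] F' ∘ φ := by filter_upwards [hO.mem_nhds hx] with y hy using hcomp y hy
  have h1 : HasMFDerivAt (𝓡 2) (𝓡 2) F' (φ x) (mfderiv (𝓡 2) (𝓡 2) F' (φ x)) :=
    ((hF'.contMDiffAt (hO'.mem_nhds (hm hx))).mdifferentiableAt (by simp)).hasMFDerivAt
  have h2 : HasMFDerivAt (𝓡 2) (𝓡 2) φ x (fderiv ℝ φ x) :=
    (((hφ.contDiffAt (hO.mem_nhds hx)).differentiableAt (by simp)).hasFDerivAt).hasMFDerivAt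
  have h3 := (h1.comp x h2).congr_of_eventuallyEq hev
  rw [bil_pullMatrix, bil_pullMatrix, h3.mfderiv, hcomp x hx]
  rfl

end Surface

/-! ### Periodic extensions of a closed curve, and pushing them off in a chart. -/

section Surface
open CoordMetric

/-- The point of the plane with given coordinates. -/
def pt (x y : ℝ) : Plane := x • e_ 0 + y • e_ 1

@[simp] theorem pt_zero (x y : ℝ) : pt x y 0 = x := by simp [pt]
@[simp] theorem pt_one (x y : ℝ) : pt x y 1 = y := by simp [pt]
theorem pt_eta (z : Plane) : pt (z 0) (z 1) = z := (eq_smul_add_smul z).symm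
theorem pt_add (x y x' y' : ℝ) : pt x y + pt x' y' = pt (x + x') (y + y') := by
  simp only [pt]; module

theorem contDiff_pt {E : Type*} [NormedAddCommGroup E] [NormedSpace ℝ E] {n : WithTop ℕ∞}
    {a b : E → ℝ} (ha : ContDiff ℝ n a) (hb : ContDiff ℝ n b) :
    ContDiff ℝ n fun x => pt (a x) (b x) :=
  (ha.smul contDiff_const).add (hb.smul contDiff_const)

theorem continuous_pt : Continuous fun p : ℝ × ℝ => pt p.1 p.2 :=
  (continuous_fst.smul continuous_const).add (continuous_snd.smul continuous_const)

theorem hasDerivAt_pt {a b : ℝ → ℝ} {a' b' t : ℝ} (ha : HasDerivAt a a' t)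
    (hb : HasDerivAt b b' t) : HasDerivAt (fun s => pt (a s) (b s)) (pt a' b') t :=
  (ha.smul_const _).add (hb.smul_const _)

theorem contDiff_coord (i : Fin 2) {n : WithTop ℕ∞} : ContDiff ℝ n fun z : Plane => z i :=
  (EuclideanSpace.proj i : Plane →L[ℝ] ℝ).contDiff

/-- A property which holds near every point of the axis and is invariant under a translation along
the axis holds in a strip around it. -/
theorem exists_strip_of_eventually {L : ℝ} (hL : 0 < L) {P : Plane → Prop}
    (hper : ∀ z, P (z + pt L 0) ↔ P z) (h : ∀ t, ∀ᶠ z in 𝓝 (pt t 0), P z) :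
    ∃ δ > 0, ∀ z : Plane, |z 1| < δ → P z := by
  -- One period of the axis is compact, so a single height works for it; translation invariance then
  -- covers the whole strip.
  have h1 : ∀ᶠ y in 𝓝 (0 : ℝ), ∀ x ∈ Icc 0 L, P (pt x y) := by
    refine isCompact_Icc.eventually_forall_of_forall_eventually fun x _ => ?_
    have hc : Filter.Tendsto (fun p : ℝ × ℝ => pt p.2 p.1) (𝓝 (0, x)) (𝓝 (pt x 0)) :=
      (continuous_pt.comp continuous_swap).tendsto (0, x)
    exact hc.eventually (h x)
  obtain ⟨δ, hδ, hP⟩ := Metric.eventually_nhds_iff.mp h1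
  refine ⟨δ, hδ, fun z hz => ?_⟩
  have hz' : ∀ n : ℤ, P (z + pt (n * L) 0) ↔ P z := by
    intro n
    induction n with
    | zero => simp [pt]
    | succ n ih =>
      rw [← ih, ← hper (z + pt ((n : ℤ) * L) 0), add_assoc, pt_add]
      push_cast; rw [add_one_mul, add_zero]
    | pred n ih =>
      rw [← ih, ← hper (z + pt ((-(n : ℤ) - 1 : ℤ) * L) 0), add_assoc, pt_add]
      push_cast; rw [sub_one_mul, add_zero, sub_add_cancel]
  obtain ⟨n, hn, -⟩ := existsUnique_add_zsmul_mem_Ico hL (z 0) 0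
  rw [← hz' n]
  have := hP (y := z 1) (by simpa [Real.dist_eq] using hz) (z 0 + n * L)
    ⟨by simpa using hn.1, by simpa using hn.2.le⟩
  convert this using 1
  conv_lhs => rw [← pt_eta z, pt_add, add_zero]

variable {M : Type*} [TopologicalSpace M] [ChartedSpace Plane M] [IsManifold (𝓡 2) ∞ M]

/-- `E` is a smooth periodic extension of `γ` to a neighborhood of the axis. -/
structure IsAxisExtension (γ : ℝ → M) (L : ℝ) (E : Plane → M) : Prop where
  smooth : ∀ t, ∀ᶠ z in 𝓝 (pt t 0), ContMDiffAt (𝓡 2) (𝓡 2) ∞ E z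
  periodic : ∀ z, E (z + pt L 0) = E z
  axis : ∀ t, E (pt t 0) = γ t

variable {γ : ℝ → M} {L : ℝ} {E : Plane → M} {e e' : OpenPartialHomeomorph M Plane}

/-- The oriented area spanned by the derivative of `γ` and the normal derivative of `E`. -/
def transversality (γ : ℝ → M) (E : Plane → M) (e : OpenPartialHomeomorph M Plane) (t : ℝ) : ℝ :=
  cross (deriv (e ∘ γ) t) (deriv (fun y => e (E (pt t y))) 0)

theorem contDiffAt_chart_comp {X : Type*} [NormedAddCommGroup X] [NormedSpace ℝ X] {c : X → M}
    {x : X} (he : e ∈ IsManifold.maximalAtlas (𝓡 2) ∞ M)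
    (hc : ContMDiffAt 𝓘(ℝ, X) (𝓡 2) ∞ c x) (hx : c x ∈ e.source) :
    ContDiffAt ℝ ∞ (e ∘ c) x :=
  contMDiffAt_iff_contDiffAt.mp ((contMDiffAt_of_mem_maximalAtlas he hx).comp x hc)

theorem contDiffAt_transition (he : e ∈ IsManifold.maximalAtlas (𝓡 2) ∞ M)
    (he' : e' ∈ IsManifold.maximalAtlas (𝓡 2) ∞ M) {x : Plane} (hx : x ∈ (e.symm.trans e').source) :
    ContDiffAt ℝ ∞ (e' ∘ e.symm) x := by
  rw [OpenPartialHomeomorph.trans_source] at hx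
  exact contDiffAt_chart_comp he' (contMDiffAt_symm_of_mem_maximalAtlas he hx.1) hx.2

theorem cross_fderiv_transition (A : Plane →L[ℝ] Plane) (u w : Plane) :
    cross (A u) (A w) = A.det * cross u w := by
  rw [cross_map]
  congr 1
  have := LinearMap.det_toMatrix (EuclideanSpace.basisFun (Fin 2) ℝ).toBasis
    (A : Plane →ₗ[ℝ] Plane)
  rw [ContinuousLinearMap.det, ← this, Matrix.det_fin_two]
  simp [LinearMap.toMatrix_apply, cross]
  ring

/-- One step in the construction of a transversal extension of `γ`: push the extension `E` in the
chart `e` in the direction obtained by rotating the velocity of `γ`. -/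
def pushExtension (γ : ℝ → M) (e : OpenPartialHomeomorph M Plane) (χ : ℝ → ℝ) (E : Plane → M)
    (z : Plane) : M :=
  open scoped Classical in
  if γ (z 0) ∈ e.source ∧ E z ∈ e.source then
    e.symm (e (E z) + (z 1 * χ (z 0)) •
      pt (-deriv (e ∘ γ) (z 0) 1) (deriv (e ∘ γ) (z 0) 0)) else E z

/-- Where the cut-off vanishes, and on the axis, both branches of the definition agree with `E`, so
the case distinction does no harm. -/
theorem pushExtension_of_eq_zero {χ : ℝ → ℝ} {z : Plane} (h : z 1 * χ (z 0) = 0) :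
    pushExtension γ e χ E z = E z := by
  rw [pushExtension, h, zero_smul, add_zero]
  split_ifs with h1
  · exact e.left_inv h1.2
  · rfl

/-- Near axis points over the support of the cut-off the chart formula is in force; near the other
axis points `E` is unchanged. -/
theorem isAxisExtension_pushExtension (hE : IsAxisExtension γ L E)
    (hγ : ContMDiff 𝓘(ℝ, ℝ) (𝓡 2) ∞ γ) (hper : Function.Periodic γ L)
    (he : e ∈ IsManifold.maximalAtlas (𝓡 2) ∞ M) {χ : ℝ → ℝ} (hχ : ContDiff ℝ ∞ χ)
    (hχL : Function.Periodic χ L) (hsupp : ∀ t ∈ tsupport χ, γ t ∈ e.source) :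
    IsAxisExtension γ L (pushExtension γ e χ E) := by
  refine ⟨fun t => ?_, fun z => ?_, fun t => ?_⟩
  · by_cases ht : t ∈ tsupport χ
    · have hsm := (hE.smooth t)
      have hcE : ContinuousAt E (pt t 0) := hsm.self_of_nhds.continuousAt
      have h1 : ∀ᶠ z in 𝓝 (pt t 0), γ (z 0) ∈ e.source := by
        have : Continuous fun z : Plane => γ (z 0) :=
          hγ.continuous.comp (contDiff_coord 0 (n := 0)).continuous
        exact this.continuousAt.eventually_mem (e.open_source.mem_nhds (by simpa using hsupp t ht))
      have h2 : ∀ᶠ z in 𝓝 (pt t 0), E z ∈ e.source :=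
        hcE.eventually_mem (e.open_source.mem_nhds (by rw [hE.axis]; exact hsupp t ht))
      set W : Plane → Plane := fun z => e (E z) + (z 1 * χ (z 0)) •
          pt (-deriv (e ∘ γ) (z 0) 1) (deriv (e ∘ γ) (z 0) 0) with hW
      have hWsm : ∀ᶠ z in 𝓝 (pt t 0), ContDiffAt ℝ ∞ W z := by
        filter_upwards [h1, h2, hsm] with z hz1 hz2 hz3
        have hd : ContDiffAt ℝ ∞ (deriv (e ∘ γ)) (z 0) := by
          have := (contDiffAt_chart_comp he (hγ (z 0)) hz1).fderiv_right (m := ∞) (by simp)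
          exact this.clm_apply contDiffAt_const
        have hd' := fun i => (contDiff_coord i (n := ∞)).contDiffAt.comp z
          (hd.comp z (contDiff_coord 0).contDiffAt)
        refine (contDiffAt_chart_comp he hz3 hz2).add (ContDiffAt.smul
          ((contDiff_coord 1).contDiffAt.mul (hχ.comp (contDiff_coord 0)).contDiffAt) ?_)
        exact ((hd' 1).neg.smul contDiffAt_const).add ((hd' 0).smul contDiffAt_const)
      have h3 : ∀ᶠ z in 𝓝 (pt t 0), W z ∈ e.target := by
        refine hWsm.self_of_nhds.continuousAt.eventually_mem (e.open_target.mem_nhds ?_)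
        have : W (pt t 0) = e (γ t) := by simp [hW, hE.axis]
        rw [this]
        exact e.map_source (hsupp t ht)
      have hev : ∀ᶠ z in 𝓝 (pt t 0), pushExtension γ e χ E z = e.symm (W z) := by
        filter_upwards [h1, h2] with z hz1 hz2
        rw [pushExtension, if_pos ⟨hz1, hz2⟩]
      filter_upwards [hev.eventually_nhds, hWsm, h3] with z hz1 hz2 hz3
      have : ContMDiffAt (𝓡 2) (𝓡 2) ∞ (e.symm ∘ W) z :=
        (contMDiffAt_symm_of_mem_maximalAtlas he hz3).comp z (contMDiffAt_iff_contDiffAt.mpr hz2)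
      exact this.congr_of_eventuallyEq hz1
    · have h0 : ∀ᶠ z in 𝓝 (pt t 0), pushExtension γ e χ E z = E z := by
        have h1 : ∀ᶠ s in 𝓝 t, χ s = 0 := notMem_tsupport_iff_eventuallyEq.mp ht
        have h2 : Filter.Tendsto (fun z : Plane => z 0) (𝓝 (pt t 0)) (𝓝 t) := by
          have := (contDiff_coord 0 (n := 0)).continuous.tendsto (pt t 0)
          simpa using this
        filter_upwards [h2.eventually h1] with z hz
        exact pushExtension_of_eq_zero (by rw [hz, mul_zero])
      filter_upwards [h0.eventually_nhds, hE.smooth t] with z hz1 hz2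
      exact hz2.congr_of_eventuallyEq hz1
  · have hd : ∀ s, deriv (e ∘ γ) (s + L) = deriv (e ∘ γ) s := by
      intro s
      rw [← deriv_comp_add_const]
      congr 1
      funext r; simp [hper r]
    have h0 : (z + pt L 0) 0 = z 0 + L := by simp
    have h1 : (z + pt L 0) 1 = z 1 := by simp
    by_cases hc : γ (z 0) ∈ e.source ∧ E z ∈ e.source
    · rw [pushExtension, pushExtension, if_pos hc, h0, h1, hper, hχL, hE.periodic, hd, if_pos hc]
    · rw [pushExtension, pushExtension, if_neg hc, h0, hper, hE.periodic, if_neg hc]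
  · rw [pushExtension_of_eq_zero (by simp), hE.axis]

/-- In the chart `e` the push adds `χ J v` to the normal derivative, with `J` the rotation by a
right angle, and `cross v (J v) = |v|²` is positive. Positivity of the Jacobian carries the sign
over to `e'`, so pushes in different charts of the oriented atlas reinforce each other. -/
theorem transversality_pushExtension (hE : IsAxisExtension γ L E)
    (hγ : ContMDiff 𝓘(ℝ, ℝ) (𝓡 2) ∞ γ) (he : e ∈ IsManifold.maximalAtlas (𝓡 2) ∞ M)
    (he' : e' ∈ IsManifold.maximalAtlas (𝓡 2) ∞ M)
    (hdet : ∀ x ∈ (e.symm.trans e').source, 0 < (fderiv ℝ (e' ∘ e.symm) x).det)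
    {χ : ℝ → ℝ} (hχ0 : ∀ t, 0 ≤ χ t) (hsupp : ∀ t ∈ tsupport χ, γ t ∈ e.source) {t : ℝ}
    (hreg : γ t ∈ e.source → deriv (e ∘ γ) t ≠ 0) (ht : γ t ∈ e'.source) :
    transversality γ E e' t ≤ transversality γ (pushExtension γ e χ E) e' t ∧
    (0 < χ t → transversality γ E e' t < transversality γ (pushExtension γ e χ E) e' t) := by
  rcases (hχ0 t).eq_or_lt with h0 | h0
  · have : ∀ y, pushExtension γ e χ E (pt t y) = E (pt t y) := fun y =>
      pushExtension_of_eq_zero (by simp [← h0])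
    simp only [transversality, this, le_refl, true_and]
    intro h; exact absurd h0 h.ne
  suffices h : transversality γ E e' t < transversality γ (pushExtension γ e χ E) e' t from
    ⟨h.le, fun _ => h⟩
  have hts : γ t ∈ e.source := hsupp t (subset_tsupport _ h0.ne')
  have hx : e (γ t) ∈ (e.symm.trans e').source := by
    rw [OpenPartialHomeomorph.trans_source]
    exact ⟨e.map_source hts, by simpa [e.left_inv hts] using ht⟩
  set A := fderiv ℝ (e' ∘ e.symm) (e (γ t)) with hA
  have hAd : HasFDerivAt (e' ∘ e.symm) A (e (γ t)) :=
    ((contDiffAt_transition he he' hx).differentiableAt (by simp)).hasFDerivAt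
  set v := deriv (e ∘ γ) t with hv
  have hline : ContMDiffAt 𝓘(ℝ, ℝ) (𝓡 2) ∞ (fun y => E (pt t y)) 0 := by
    have h1 : ContMDiffAt (𝓡 2) (𝓡 2) ∞ E (pt t 0) := (hE.smooth t).self_of_nhds
    have h2 : ContMDiffAt 𝓘(ℝ, ℝ) (𝓡 2) ∞ (fun y => pt t y) 0 :=
      contMDiffAt_iff_contDiffAt.mpr (contDiff_pt contDiff_const contDiff_id).contDiffAt
    exact ContMDiffAt.comp (0 : ℝ) h1 h2
  have hE0 : E (pt t 0) ∈ e.source := by rw [hE.axis]; exact hts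
  have hd1 : HasDerivAt (fun y => e (E (pt t y))) (deriv (fun y => e (E (pt t y))) 0) 0 :=
    ((contDiffAt_chart_comp he hline hE0).differentiableAt (by simp)).hasDerivAt
  set w := deriv (fun y => e (E (pt t y))) 0 with hw
  have hsrc : ∀ᶠ y in 𝓝 (0 : ℝ), E (pt t y) ∈ e.source :=
    hline.continuousAt.eventually_mem (e.open_source.mem_nhds hE0)
  have hdE : deriv (fun y => e' (E (pt t y))) 0 = A w := by
    have hAd' : HasFDerivAt (e' ∘ e.symm) A (e (E (pt t 0))) := by rwa [hE.axis]
    have h1 := hAd'.comp_hasDerivAt (0 : ℝ) hd1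
    have h2 : (fun y => e' (E (pt t y))) =ᶠ[𝓝 0] (e' ∘ e.symm) ∘ fun y => e (E (pt t y)) := by
      filter_upwards [hsrc] with y hy
      simp [e.left_inv hy]
    rw [h2.deriv_eq, h1.deriv]
  have hdγ : deriv (e' ∘ γ) t = A v := by
    have hγd : HasDerivAt (e ∘ γ) v t :=
      ((contDiffAt_chart_comp he (hγ t) hts).differentiableAt (by simp)).hasDerivAt
    have h1 := HasFDerivAt.comp_hasDerivAt t (f := e ∘ γ) hAd hγd
    have h2 : (e' ∘ γ) =ᶠ[𝓝 t] (e' ∘ e.symm) ∘ (e ∘ γ) := by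
      filter_upwards [hγ.continuous.continuousAt.eventually_mem (e.open_source.mem_nhds hts)]
        with s hs
      simp [e.left_inv hs]
    rw [h2.deriv_eq, h1.deriv]
  have hdP : deriv (fun y => e' (pushExtension γ e χ E (pt t y))) 0
      = A (w + χ t • pt (-v 1) (v 0)) := by
    have hk : HasDerivAt (fun y : ℝ => e (E (pt t y)) + (y * χ t) • pt (-v 1) (v 0))
        (w + χ t • pt (-v 1) (v 0)) 0 := by
      have := ((hasDerivAt_id (0 : ℝ)).mul_const (χ t)).smul_const (pt (-v 1) (v 0))
      exact (hd1.fun_add this).congr_deriv (by simp)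
    have hAd' : HasFDerivAt (e' ∘ e.symm) A
        (e (E (pt t 0)) + ((0 : ℝ) * χ t) • pt (-v 1) (v 0)) := by
      rw [hE.axis]; simpa using hAd
    have h1 := HasFDerivAt.comp_hasDerivAt (0 : ℝ) hAd' hk
    have h2 : (fun y => e' (pushExtension γ e χ E (pt t y))) =ᶠ[𝓝 0] (e' ∘ e.symm) ∘
        fun y : ℝ => e (E (pt t y)) + (y * χ t) • pt (-v 1) (v 0) := by
      filter_upwards [hsrc] with y hy
      simp only [pushExtension, pt_zero, pt_one, Function.comp_apply, hts, hy, and_self, if_true, v]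
    rw [h2.deriv_eq, h1.deriv]
  rw [transversality, transversality, hdE, hdγ, hdP, cross_fderiv_transition,
    cross_fderiv_transition]
  refine mul_lt_mul_of_pos_left ?_ (hdet _ hx)
  have hvne := hreg hts
  have hpos : 0 < v 0 ^ 2 + v 1 ^ 2 := by
    by_contra hc
    push Not at hc
    have h0 : v 0 = 0 := by nlinarith [sq_nonneg (v 0), sq_nonneg (v 1)]
    have h1 : v 1 = 0 := by nlinarith [sq_nonneg (v 0), sq_nonneg (v 1)]
    exact hvne (by rw [← pt_eta v, h0, h1]; simp [pt])
  have : cross v (w + χ t • pt (-v 1) (v 0)) = cross v w + χ t * (v 0 ^ 2 + v 1 ^ 2) := by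
    simp [cross]; ring
  rw [this]
  nlinarith [mul_pos h0 hpos]

end Surface

/-! ### Periodic cut-off functions, and strips on which an extension is an immersion. -/

section Surface
open CoordMetric

theorem exists_periodic_cutoff {L : ℝ} (hL : 0 < L) {W : Set ℝ} (hW : IsOpen W)
    (hper : ∀ t, t + L ∈ W ↔ t ∈ W) {s : ℝ} (hs : s ∈ W) :
    ∃ χ : ℝ → ℝ, ContDiff ℝ ∞ χ ∧ Function.Periodic χ L ∧ (∀ t, 0 ≤ χ t) ∧ tsupport χ ⊆ W ∧
      0 < χ s := by
  obtain ⟨r0, hr0, hball⟩ := Metric.isOpen_iff.mp hW s hs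
  set r := min (r0 / 2) (L / 4) with hr
  have hrpos : 0 < r := lt_min (by linarith) (by linarith)
  have hrr0 : r < r0 := (min_le_left _ _).trans_lt (by linarith)
  have hrL : r ≤ L / 4 := min_le_right _ _
  set l := 2 * Real.pi / L with hl
  have hlpos : 0 < l := by positivity
  have hlL : l * L = 2 * Real.pi := by rw [hl]; field_simp
  have hπ := Real.pi_pos
  have hlr : l * r ≤ Real.pi / 2 := by nlinarith
  -- This cosine has period `L` and exceeds `cos (l r)` exactly at the points closer than `r` to `s`
  -- modulo `L`, because `l r ≤ π / 2` lies in the range where the cosine decreases. The inequality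
  -- `r < r0` leaves room for the closure.
  refine ⟨fun t => Real.smoothTransition (Real.cos (l * (t - s)) - Real.cos (l * r)), ?_, ?_, ?_,
    ?_, ?_⟩
  · refine Real.smoothTransition.contDiff.comp ?_
    exact ((Real.contDiff_cos.comp (contDiff_const.mul (contDiff_id.sub contDiff_const)))).sub
      contDiff_const
  · intro t
    have : l * (t + L - s) = l * (t - s) + 2 * Real.pi := by rw [← hlL]; ring
    simp only [this, Real.cos_add_two_pi]
  · intro t; exact Real.smoothTransition.nonneg _
  · have hclosed : IsClosed {t | Real.cos (l * r) ≤ Real.cos (l * (t - s))} :=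
      isClosed_le continuous_const (by fun_prop)
    refine (closure_minimal (fun t ht => ?_) hclosed).trans fun t ht => ?_
    · by_contra hc
      simp only [mem_ofPred_eq, not_le] at hc
      exact ht (Real.smoothTransition.zero_of_nonpos (by linarith))
    · obtain ⟨n, hn, -⟩ := existsUnique_add_zsmul_mem_Ico hL (t - s) (-(L / 2))
      simp only [zsmul_eq_mul] at hn
      set τ := t - s + n * L with hτ
      have habs : |τ| ≤ L / 2 := abs_le.mpr ⟨hn.1, by linarith [hn.2]⟩
      have hcos : Real.cos (l * r) ≤ Real.cos (l * |τ|) := by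
        have h1 : Real.cos (l * |τ|) = Real.cos (l * (t - s)) := by
          rw [← abs_of_pos hlpos, ← abs_mul, abs_of_pos hlpos, Real.cos_abs]
          have : l * τ = l * (t - s) + n * (2 * Real.pi) := by rw [hτ, ← hlL]; ring
          rw [this, Real.cos_add_int_mul_two_pi]
        rw [h1]; exact ht
      have hle : |τ| ≤ r := by
        by_contra hc
        push Not at hc
        have := Real.strictAntiOn_cos (a := l * r) (b := l * |τ|) ⟨by positivity, by linarith⟩
          ⟨by positivity, by nlinarith⟩ (mul_lt_mul_of_pos_left hc hlpos)
        linarith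
      have h1 : s + τ ∈ W := hball (by
        rw [Metric.mem_ball, Real.dist_eq]; simpa using hle.trans_lt hrr0)
      have hz : ∀ m : ℤ, ∀ x, x + m * L ∈ W ↔ x ∈ W := by
        intro m
        induction m with
        | zero => simp
        | succ n ih =>
          intro x
          rw [← ih x, ← hper (x + ((n : ℤ) : ℝ) * L)]; push_cast; rw [add_one_mul, add_assoc]
        | pred n ih =>
          intro x
          rw [← ih x, ← hper (x + ((-(n : ℤ) - 1 : ℤ) : ℝ) * L)]; push_cast
          rw [sub_one_mul, add_assoc, sub_add_cancel]
      have : s + τ = t + n * L := by rw [hτ]; ring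
      rw [this] at h1
      exact (hz n t).mp h1
  · refine Real.smoothTransition.pos_of_pos ?_
    have := Real.strictAntiOn_cos (a := 0) (b := l * r) ⟨le_rfl, hπ.le⟩
      ⟨by positivity, by linarith⟩ (by positivity)
    simpa using this

variable {M : Type*} [TopologicalSpace M] [ChartedSpace Plane M] [IsManifold (𝓡 2) ∞ M]
variable {γ : ℝ → M} {L : ℝ} {E : Plane → M} {e e' : OpenPartialHomeomorph M Plane}

theorem fderiv_chart_comp {X : Type*} [NormedAddCommGroup X] [NormedSpace ℝ X] {c : X → M}
    {x : X} (he : e ∈ IsManifold.maximalAtlas (𝓡 2) ∞ M)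
    (hc : ContMDiffAt 𝓘(ℝ, X) (𝓡 2) ∞ c x) (hx : c x ∈ e.source) (u : X) :
    fderiv ℝ (e ∘ c) x u = mfderiv (𝓡 2) (𝓡 2) e (c x) (mfderiv 𝓘(ℝ, X) (𝓡 2) c x u) ∧
    (fderiv ℝ (e ∘ c) x u = 0 ↔ mfderiv 𝓘(ℝ, X) (𝓡 2) c x u = 0) := by
  have hmd : e.MDifferentiable (𝓡 2) (𝓡 2) :=
    ⟨(contMDiffOn_of_mem_maximalAtlas he).mdifferentiableOn (by simp),
      (contMDiffOn_symm_of_mem_maximalAtlas he).mdifferentiableOn (by simp)⟩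
  have h1 := (hmd.mdifferentiableAt hx).hasMFDerivAt.comp x
    (hc.mdifferentiableAt (by simp)).hasMFDerivAt
  have h2 : fderiv ℝ (e ∘ c) x u
      = mfderiv (𝓡 2) (𝓡 2) e (c x) (mfderiv 𝓘(ℝ, X) (𝓡 2) c x u) := by
    rw [← mfderiv_eq_fderiv, h1.mfderiv]; rfl
  refine ⟨h2, ?_⟩
  rw [h2]
  constructor
  · intro h; exact hmd.mfderiv_injective hx (h.trans (map_zero _).symm)
  · intro h; rw [h]; exact map_zero _

theorem injective_iff_cross (A : Plane →L[ℝ] Plane) :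
    Function.Injective A ↔ cross (A (e_ 0)) (A (e_ 1)) ≠ 0 := by
  constructor
  · intro h h0
    have hs : Function.Surjective A :=
      LinearMap.surjective_of_injective (f := (A : Plane →ₗ[ℝ] Plane)) h
    obtain ⟨u, hu⟩ := hs (e_ 0)
    obtain ⟨w, hw⟩ := hs (e_ 1)
    have := cross_map A u w
    rw [h0, hu, hw] at this
    simp [cross] at this
  · intro h
    refine (injective_iff_map_eq_zero _).mpr fun u hu => ?_
    have h1 := cross_map A u (e_ 1)
    have h2 := cross_map A u (e_ 0)
    rw [hu] at h1 h2
    have z : ∀ w, cross (0 : Plane) w = 0 := by simp [cross]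
    rw [z] at h1 h2
    have h1' := (mul_eq_zero.mp h1.symm).resolve_left h
    have h2' := (mul_eq_zero.mp h2.symm).resolve_left h
    simp [cross] at h1' h2'
    rw [← pt_eta u, h1', h2']; simp [pt]

theorem mfderiv_injective_iff (he : e ∈ IsManifold.maximalAtlas (𝓡 2) ∞ M) {z : Plane}
    (hE : ContMDiffAt (𝓡 2) (𝓡 2) ∞ E z) (hz : E z ∈ e.source) :
    Function.Injective (mfderiv (𝓡 2) (𝓡 2) E z) ↔
      cross (fderiv ℝ (e ∘ E) z (e_ 0)) (fderiv ℝ (e ∘ E) z (e_ 1)) ≠ 0 := by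
  rw [← injective_iff_cross]
  have h := fun u => (fderiv_chart_comp he hE hz u).2
  constructor
  · intro hi
    refine (injective_iff_map_eq_zero _).mpr fun u hu => ?_
    exact hi (((h u).mp hu).trans (map_zero _).symm)
  · intro hi u w huw
    have h1 : mfderiv (𝓡 2) (𝓡 2) E z (u - w) = 0 := by
      refine (map_sub (mfderiv (𝓡 2) (𝓡 2) E z) u w).trans ?_
      rw [huw]; exact sub_self _
    have h2 := (h (u - w)).mpr h1
    have h3 := (map_sub (fderiv ℝ (e ∘ E) z) (u : Plane) (w : Plane)).symm.trans h2
    exact hi (sub_eq_zero.mp h3)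

theorem eventually_mfderiv_injective {x : Plane}
    (hE : ∀ᶠ z in 𝓝 x, ContMDiffAt (𝓡 2) (𝓡 2) ∞ E z)
    (hx : Function.Injective (mfderiv (𝓡 2) (𝓡 2) E x)) :
    ∀ᶠ z in 𝓝 x, Function.Injective (mfderiv (𝓡 2) (𝓡 2) E z) := by
  have he := IsManifold.chart_mem_maximalAtlas (I := 𝓡 2) (n := ∞) (E x)
  set e := chartAt Plane (E x)
  have hxs : E x ∈ e.source := mem_chart_source _ _
  have h0 := hE.self_of_nhds
  have h1 := (mfderiv_injective_iff he h0 hxs).mp hx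
  have hd : ContinuousAt (fderiv ℝ (e ∘ E)) x :=
    ((contDiffAt_chart_comp he h0 hxs).fderiv_right (m := ∞) (by simp)).continuousAt
  have hd' : ∀ i j, ContinuousAt (fun z => fderiv ℝ (e ∘ E) z (e_ i) j) x := fun i j =>
    (EuclideanSpace.proj j : Plane →L[ℝ] ℝ).continuous.continuousAt.comp
      (hd.clm_apply continuousAt_const)
  have hc : ContinuousAt (fun z => cross (fderiv ℝ (e ∘ E) z (e_ 0))
      (fderiv ℝ (e ∘ E) z (e_ 1))) x :=
    ((hd' 0 0).mul (hd' 1 1)).sub ((hd' 0 1).mul (hd' 1 0))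
  filter_upwards [hE, hc.eventually_ne h1,
    h0.continuousAt.eventually_mem (e.open_source.mem_nhds hxs)] with z hz1 hz2 hz3
  exact (mfderiv_injective_iff he hz1 hz3).mpr hz2

theorem good_of_translate {v : Plane} (hv : ∀ z, E (z + v) = E z) {z : Plane}
    (h : ContMDiffAt (𝓡 2) (𝓡 2) ∞ E (z + v) ∧
      Function.Injective (mfderiv (𝓡 2) (𝓡 2) E (z + v))) :
    ContMDiffAt (𝓡 2) (𝓡 2) ∞ E z ∧ Function.Injective (mfderiv (𝓡 2) (𝓡 2) E z) := by
  have hE : E = E ∘ fun z => z + v := funext fun z => (hv z).symm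
  have ht : ContMDiffAt (𝓡 2) (𝓡 2) ∞ (fun z : Plane => z + v) z :=
    contMDiffAt_iff_contDiffAt.mpr (contDiffAt_id.add contDiffAt_const)
  have h1 : ContMDiffAt (𝓡 2) (𝓡 2) ∞ (E ∘ fun z => z + v) z := ContMDiffAt.comp z h.1 ht
  have hT : HasMFDerivAt (𝓡 2) (𝓡 2) (fun z : Plane => z + v) z
      (ContinuousLinearMap.id ℝ Plane) :=
    ((hasFDerivAt_id z).add_const v).hasMFDerivAt
  have h2 : HasMFDerivAt (𝓡 2) (𝓡 2) (E ∘ fun z => z + v) z _ :=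
    HasMFDerivAt.comp z (h.1.mdifferentiableAt (by simp)).hasMFDerivAt hT
  rw [← hE] at h1 h2
  refine ⟨h1, ?_⟩
  rw [h2.mfderiv]
  exact h.2

theorem IsAxisExtension.exists_strip (hE : IsAxisExtension γ L E) (hL : 0 < L)
    (hinj : ∀ t, Function.Injective (mfderiv (𝓡 2) (𝓡 2) E (pt t 0))) :
    ∃ δ > 0, ∀ z : Plane, |z 1| < δ → ContMDiffAt (𝓡 2) (𝓡 2) ∞ E z ∧
      Function.Injective (mfderiv (𝓡 2) (𝓡 2) E z) := by
  refine exists_strip_of_eventually hL (fun z => ⟨good_of_translate hE.periodic, fun h => ?_⟩)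
    fun t => (hE.smooth t).and (eventually_mfderiv_injective (hE.smooth t) (hinj t))
  have hv : ∀ z, E (z + -pt L 0) = E z := fun z => by
    rw [← hE.periodic, neg_add_cancel_right]
  refine good_of_translate hv ?_
  rwa [add_neg_cancel_right]

end Surface

/-! ### Immersed strips around a closed curve, orthonormal along the axis. -/

section Surface
open CoordMetric

variable {M : Type*} [TopologicalSpace M] [ChartedSpace Plane M] [IsManifold (𝓡 2) ∞ M]
variable {γ : ℝ → M} {L : ℝ} {E : Plane → M} {e e' : OpenPartialHomeomorph M Plane}

theorem deriv_chart_comp_ne_zero {c : ℝ → M} {t : ℝ} (he : e ∈ IsManifold.maximalAtlas (𝓡 2) ∞ M)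
    (hc : ContMDiffAt 𝓘(ℝ, ℝ) (𝓡 2) ∞ c t) (hx : c t ∈ e.source) :
    deriv (e ∘ c) t = 0 ↔ mfderiv 𝓘(ℝ, ℝ) (𝓡 2) c t (1 : ℝ) = 0 :=
  (fderiv_chart_comp he hc hx (1 : ℝ)).2

/-- A curve in an orientable open set extends to an immersion of a neighborhood of the axis. -/
theorem exists_axisExtension (hL : 0 < L) (hγ : ContMDiff 𝓘(ℝ, ℝ) (𝓡 2) ∞ γ)
    (hper : Function.Periodic γ L) (hreg : ∀ t, mfderiv 𝓘(ℝ, ℝ) (𝓡 2) γ t (1 : ℝ) ≠ 0)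
    {V : Set M} (hγV : range γ ⊆ V) (hor : IsOrientableOn V) :
    ∃ E : Plane → M, IsAxisExtension γ L E ∧
      ∀ t, Function.Injective (mfderiv (𝓡 2) (𝓡 2) E (pt t 0)) := by
  obtain ⟨A, hA, -, hcov, hdet⟩ := hor
  have hex : ∀ s : ℝ, ∃ e ∈ A, ∃ χ : ℝ → ℝ, ContDiff ℝ ∞ χ ∧ Function.Periodic χ L ∧
      (∀ t, 0 ≤ χ t) ∧ (∀ t ∈ tsupport χ, γ t ∈ e.source) ∧ 0 < χ s := by
    intro s
    obtain ⟨e, he, hs⟩ := hcov (γ s) (hγV ⟨s, rfl⟩)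
    obtain ⟨χ, h1, h2, h3, h4, h5⟩ := exists_periodic_cutoff hL
      (e.open_source.preimage hγ.continuous) (fun t => by simp [hper t]) (s := s) hs
    exact ⟨e, he, χ, h1, h2, h3, h4, h5⟩
  choose e he χ hχ hχL hχ0 hsupp hpos using hex
  -- The induction starts from the degenerate extension `z ↦ γ (z 0)`, whose transversality is zero
  -- in every chart. Each push keeps it nonnegative in all charts of the oriented atlas at once and
  -- makes it positive where its cut-off is positive.
  have key : ∀ T : Finset ℝ, ∃ E : Plane → M, IsAxisExtension γ L E ∧
      ∀ t, ∀ e' ∈ A, γ t ∈ e'.source → 0 ≤ transversality γ E e' t ∧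
        ((∃ s ∈ T, 0 < χ s t) → 0 < transversality γ E e' t) := by
    intro T
    induction T using Finset.induction_on with
    | empty =>
      refine ⟨fun z => γ (z 0), ⟨fun t => ?_, fun z => ?_, fun t => ?_⟩, fun t e' _ _ => ?_⟩
      · refine Filter.Eventually.of_forall fun z => ?_
        exact ContMDiffAt.comp z (hγ _) (contMDiffAt_iff_contDiffAt.mpr
          (contDiff_coord 0).contDiffAt)
      · simp [hper (z 0)]
      · simp
      · simp [transversality, cross]
    | insert s T hs ih =>
      obtain ⟨E, hE, hEt⟩ := ih
      refine ⟨pushExtension γ (e s) (χ s) E, isAxisExtension_pushExtension hE hγ hper (hA (he s))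
        (hχ s) (hχL s) (hsupp s), fun t e' he' ht => ?_⟩
      have h1 := transversality_pushExtension hE hγ (hA (he s)) (hA he')
        (hdet _ (he s) _ he') (hχ0 s) (hsupp s) (t := t)
        (fun hts => fun h => hreg t ((deriv_chart_comp_ne_zero (hA (he s)) (hγ t) hts).mp h)) ht
      have h2 := hEt t e' he' ht
      refine ⟨h2.1.trans h1.1, ?_⟩
      rintro ⟨s', hs', hs't⟩
      rcases Finset.mem_insert.mp hs' with rfl | hs'
      · exact h2.1.trans_lt (h1.2 hs't)
      · exact (h2.2 ⟨s', hs', hs't⟩).trans_le h1.1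
  -- Finitely many cut-offs suffice to be positive somewhere over each point of a period, hence of
  -- the whole axis.
  obtain ⟨T, -, hT⟩ := isCompact_Icc.elim_nhds_subcover (s := Icc 0 L) (fun s => {t | 0 < χ s t})
    (fun s _ => (isOpen_lt continuous_const (hχ s).continuous).mem_nhds (hpos s))
  obtain ⟨E, hE, hEt⟩ := key T
  refine ⟨E, hE, fun t => ?_⟩
  obtain ⟨e', he', ht⟩ := hcov (γ t) (hγV ⟨t, rfl⟩)
  have hcover : ∃ s ∈ T, 0 < χ s t := by
    obtain ⟨n, hn, -⟩ := existsUnique_add_zsmul_mem_Ico hL t 0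
    simp only [zsmul_eq_mul, zero_add] at hn
    have := hT ⟨hn.1, hn.2.le⟩
    simp only [mem_iUnion, mem_ofPred_eq, exists_prop] at this
    obtain ⟨s, hs, h⟩ := this
    exact ⟨s, hs, by rwa [(hχL s).int_mul n t] at h⟩
  have hpos := (hEt t e' he' ht).2 hcover
  have hsm := (hE.smooth t).self_of_nhds
  have hEs : E (pt t 0) ∈ e'.source := by rwa [hE.axis]
  rw [mfderiv_injective_iff (hA he') hsm hEs]
  have hd := ((contDiffAt_chart_comp (hA he') hsm hEs).differentiableAt (by simp)).hasFDerivAt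
  have h0 : deriv (e' ∘ γ) t = fderiv ℝ (e' ∘ E) (pt t 0) (e_ 0) := by
    have h1 := hd.comp_hasDerivAt t (hasDerivAt_pt (hasDerivAt_id t) (hasDerivAt_const t 0))
    have h2 : (e' ∘ γ) = (e' ∘ E) ∘ fun s => pt s 0 := by
      funext s; simp [hE.axis]
    rw [h2]
    refine h1.deriv.trans ?_
    simp [pt]
  have h1 : deriv (fun y => e' (E (pt t y))) 0 = fderiv ℝ (e' ∘ E) (pt t 0) (e_ 1) := by
    have h1 := hd.comp_hasDerivAt (0 : ℝ) (hasDerivAt_pt (hasDerivAt_const 0 t) (hasDerivAt_id 0))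
    refine h1.deriv.trans ?_
    simp [pt]
  rw [transversality, h0, h1] at hpos
  exact hpos.ne'

theorem mfderiv_injective_of_pullMatrix {g : Bundle.ContMDiffRiemannianMetric (𝓡 2) ∞ Plane
      (fun p : M => TangentSpace (𝓡 2) p)} {x : Plane} (h : pullMatrix g E x = 1) :
    Function.Injective (mfderiv (𝓡 2) (𝓡 2) E x) := by
  have key : ∀ u : Plane, mfderiv (𝓡 2) (𝓡 2) E x u = 0 → u = 0 := by
    intro u hu
    have h1 : bil (pullMatrix g E x) u u = 0 := by
      rw [bil_pullMatrix, hu]; exact map_zero _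
    rw [h, bil_apply] at h1
    have h2 : u 0 ^ 2 + u 1 ^ 2 = 0 := by
      simp only [Matrix.one_apply] at h1
      simp at h1
      linarith
    have h3 : u 0 = 0 := by nlinarith [sq_nonneg (u 0), sq_nonneg (u 1)]
    have h4 : u 1 = 0 := by nlinarith [sq_nonneg (u 0), sq_nonneg (u 1)]
    rw [← pt_eta u, h3, h4]; simp [pt]
  intro u w huw
  have h1 : mfderiv (𝓡 2) (𝓡 2) E x (u - w) = 0 := by
    refine (map_sub (mfderiv (𝓡 2) (𝓡 2) E x) u w).trans ?_
    rw [huw]; exact sub_self _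
  exact sub_eq_zero.mp (key _ h1)

theorem pullMatrix_translate {g : Bundle.ContMDiffRiemannianMetric (𝓡 2) ∞ Plane
      (fun p : M => TangentSpace (𝓡 2) p)} {δ : ℝ}
    (hgood : ∀ z : Plane, |z 1| < δ → ContMDiffAt (𝓡 2) (𝓡 2) ∞ E z ∧
      Function.Injective (mfderiv (𝓡 2) (𝓡 2) E z)) (hper : ∀ z, E (z + pt L 0) = E z)
    {z : Plane} (hz : |z 1| < δ) : pullMatrix g E (z + pt L 0) = pullMatrix g E z := by
  have hSo : IsOpen {z : Plane | |z 1| < δ} :=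
    isOpen_lt (contDiff_coord 1 (n := 0)).continuous.abs continuous_const
  have h := isLocalIsometry_pullMatrix (g := g) (φ := fun z => z + pt L 0) hSo hSo
    (fun z hz => (hgood z hz).1.contMDiffWithinAt) (contDiff_id.add contDiff_const).contDiffOn
    (fun z hz => by simpa using hz) (fun z hz => (hgood z hz).2)
    (fun z hz => (hgood z hz).2) (fun z _ => (hper z).symm)
  ext i j
  have h1 := h.isometry z hz (e_ i) (e_ j)
  have h2 : fderiv ℝ (fun z => z + pt L 0) z = ContinuousLinearMap.id ℝ Plane :=
    ((hasFDerivAt_id z).add_const _).fderiv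
  rw [h2] at h1
  exact ((bil_single (pullMatrix g E (z + pt L 0)) i j).symm.trans h1.symm).trans
    (bil_single (pullMatrix g E z) i j)

theorem inner_congr_point (g : Bundle.ContMDiffRiemannianMetric (𝓡 2) ∞ Plane
      (fun p : M => TangentSpace (𝓡 2) p)) {p q : M} (h : p = q) (X : Plane) :
    g.inner p (X : TangentSpace (𝓡 2) p) (X : TangentSpace (𝓡 2) p) =
      g.inner q (X : TangentSpace (𝓡 2) q) (X : TangentSpace (𝓡 2) q) := by
  subst h; rfl

/-- Fermi-type coordinates: a curve of unit speed in an orientable open set extends to an immersion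
of a strip for which the pullback metric is standard on the axis. -/
theorem exists_strip (g : Bundle.ContMDiffRiemannianMetric (𝓡 2) ∞ Plane
      (fun p : M => TangentSpace (𝓡 2) p))
    (hL : 0 < L) (hγ : ContMDiff 𝓘(ℝ, ℝ) (𝓡 2) ∞ γ)
    (hper : Function.Periodic γ L) (hspeed : ∀ t, g.inner (γ t)
      (mfderiv 𝓘(ℝ, ℝ) (𝓡 2) γ t (1 : ℝ)) (mfderiv 𝓘(ℝ, ℝ) (𝓡 2) γ t (1 : ℝ)) = 1)
    {V : Set M} (hγV : range γ ⊆ V) (hor : IsOrientableOn V) :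
    ∃ E : Plane → M, IsAxisExtension γ L E ∧ (∀ t, pullMatrix g E (pt t 0) = 1) ∧
      ∃ δ > 0, ∀ z : Plane, |z 1| < δ → ContMDiffAt (𝓡 2) (𝓡 2) ∞ E z ∧
      Function.Injective (mfderiv (𝓡 2) (𝓡 2) E z) := by
  obtain ⟨E, hE, hinj⟩ := exists_axisExtension hL hγ hper (fun t h => by
    have := hspeed t
    rw [h] at this
    simp at this) hγV hor
  obtain ⟨δ, hδ, hgood⟩ := hE.exists_strip hL hinj
  set S : Set Plane := {z | |z 1| < δ} with hS
  have hSo : IsOpen S := isOpen_lt (contDiff_coord 1 (n := 0)).continuous.abs continuous_const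
  have hax : ∀ t, pt t 0 ∈ S := fun t => by simpa [hS] using hδ
  have hG : MetricOn (pullMatrix g E) S := metricOn_pullMatrix hSo
    (fun z hz => (hgood z hz).1.contMDiffWithinAt) (fun z hz => (hgood z hz).2)
  have hdt : ∀ t, HasMFDerivAt 𝓘(ℝ, ℝ) (𝓡 2) γ t
      ((mfderiv (𝓡 2) (𝓡 2) E (pt t 0)).comp
        (ContinuousLinearMap.toSpanSingleton ℝ (e_ 0) : ℝ →L[ℝ] Plane)) := by
    intro t
    have h1 : HasMFDerivAt 𝓘(ℝ, ℝ) (𝓡 2) (fun s => pt s 0) t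
        (ContinuousLinearMap.toSpanSingleton ℝ (e_ 0) : ℝ →L[ℝ] Plane) := by
      have := (hasDerivAt_pt (hasDerivAt_id t) (hasDerivAt_const t 0)).hasFDerivAt.hasMFDerivAt
      simpa [pt] using this
    have h2 := HasMFDerivAt.comp t (((hgood _ (hax t)).1.mdifferentiableAt (by simp)).hasMFDerivAt)
      h1
    have h3 : γ = E ∘ fun s => pt s 0 := by funext s; simp [hE.axis]
    rw [h3]
    exact h2
  set G := fun i j (t : ℝ) => pullMatrix g E (pt t 0) i j with hGdef
  have hGs : ∀ i j, ContDiff ℝ ∞ (G i j) := fun i j => by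
    rw [contDiff_iff_contDiffAt]
    intro t
    exact (hG.smoothAt (hax t) i j).comp t (contDiff_pt contDiff_id contDiff_const).contDiffAt
  have hGper : ∀ i j t, G i j (t + L) = G i j t := by
    intro i j t
    have := pullMatrix_translate (g := g) hgood hE.periodic (hax t)
    rw [pt_add, add_zero] at this
    exact congrFun (congrFun this i) j
  have hG00 : ∀ t, G 0 0 t = 1 := by
    intro t
    have := hspeed t
    rw [(hdt t).mfderiv] at this
    have h1 : (mfderiv (𝓡 2) (𝓡 2) E (pt t 0)).comp
        (ContinuousLinearMap.toSpanSingleton ℝ (e_ 0) : ℝ →L[ℝ] Plane) (1 : ℝ)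
        = mfderiv (𝓡 2) (𝓡 2) E (pt t 0) (e_ 0) := by
      exact congrArg (mfderiv (𝓡 2) (𝓡 2) E (pt t 0)) (one_smul ℝ (e_ 0))
    exact ((inner_congr_point g (hE.axis t) (mfderiv (𝓡 2) (𝓡 2) E (pt t 0) (e_ 0)))).trans
      (by rw [← this, ← h1]; rfl)
  have hG10 : ∀ t, G 1 0 t = G 0 1 t := fun t => hG.symm _ (hax t)
  have hdet : ∀ t, 0 < G 1 1 t - G 0 1 t ^ 2 := by
    intro t
    have := hG.det_pos (hax t)
    rw [Matrix.det_fin_two] at this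
    have h1 : pullMatrix g E (pt t 0) 0 0 = 1 := hG00 t
    rw [h1, hG.symm _ (hax t)] at this
    simp only [hGdef]; linarith
  -- Gram–Schmidt along the axis: `a e₀ + b e₁` is the unit vector orthogonal to `e₀`. The map `T`
  -- fixes the axis, commutes with the period translation and has this vector as its normal
  -- derivative. Only the metric on the axis is normalized; the lines transversal to it need not be
  -- geodesics.
  set b : ℝ → ℝ := fun t => (Real.sqrt (G 1 1 t - G 0 1 t ^ 2))⁻¹ with hb
  set a : ℝ → ℝ := fun t => - G 0 1 t * b t with ha
  have hbs : ContDiff ℝ ∞ b :=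
    (((hGs 1 1).sub ((hGs 0 1).pow 2)).sqrt fun t => (hdet t).ne').inv
      fun t => (Real.sqrt_pos.mpr (hdet t)).ne'
  have has : ContDiff ℝ ∞ a := (hGs 0 1).neg.mul hbs
  set T : Plane → Plane := fun z => pt (z 0 + a (z 0) * z 1) (b (z 0) * z 1) with hT
  have hTs : ContDiff ℝ ∞ T := contDiff_pt
    ((contDiff_coord 0).add ((has.comp (contDiff_coord 0)).mul (contDiff_coord 1)))
    ((hbs.comp (contDiff_coord 0)).mul (contDiff_coord 1))
  have hTax : ∀ t, T (pt t 0) = pt t 0 := fun t => by simp [hT]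
  have hE' : IsAxisExtension γ L (E ∘ T) := by
    refine ⟨fun t => ?_, fun z => ?_, fun t => ?_⟩
    · have h1 : Filter.Tendsto T (𝓝 (pt t 0)) (𝓝 (pt t 0)) := by
        have := hTs.continuous.tendsto (pt t 0)
        rwa [hTax] at this
      filter_upwards [h1.eventually (hE.smooth t)] with z hz
      exact ContMDiffAt.comp z hz (contMDiffAt_iff_contDiffAt.mpr hTs.contDiffAt)
    · have h0 : (z + pt L 0) 0 = z 0 + L := by simp
      have h1 : (z + pt L 0) 1 = z 1 := by simp
      have h2 : T (z + pt L 0) = T z + pt L 0 := by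
        simp only [hT, h0, h1, ha, hb, hGper, pt_add, add_zero]
        congr 1; ring
      rw [Function.comp_apply, h2, hE.periodic, Function.comp_apply]
    · rw [Function.comp_apply, hTax, hE.axis]
  have hone : ∀ t, pullMatrix g (E ∘ T) (pt t 0) = 1 := by
    intro t
    have hd := (hTs.differentiable (by simp) (pt t 0)).hasFDerivAt
    have h0 : fderiv ℝ T (pt t 0) (e_ 0) = e_ 0 := by
      have h1 := hd.comp_hasDerivAt t (hasDerivAt_pt (hasDerivAt_id t) (hasDerivAt_const t 0))
      have h2 : (T ∘ fun s => pt (id s) 0) = fun s => pt s 0 := funext fun s => hTax s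
      rw [h2] at h1
      have := h1.unique (hasDerivAt_pt (hasDerivAt_id t) (hasDerivAt_const t 0))
      simpa [pt] using this
    have h1 : fderiv ℝ T (pt t 0) (e_ 1) = pt (a t) (b t) := by
      have h1 := hd.comp_hasDerivAt (0 : ℝ)
        (hasDerivAt_pt (hasDerivAt_const 0 t) (hasDerivAt_id 0))
      have h2 : T ∘ pt t = fun s => pt (t + a t * s) (b t * s) := by
        funext s; simp [hT]
      rw [h2] at h1
      have h3 := hasDerivAt_pt (((hasDerivAt_id (0 : ℝ)).const_mul (a t)).const_add t)
        ((hasDerivAt_id (0 : ℝ)).const_mul (b t))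
      have := h1.unique h3
      simpa [pt] using this
    have hE1 : HasMFDerivAt (𝓡 2) (𝓡 2) E (T (pt t 0)) (mfderiv (𝓡 2) (𝓡 2) E (T (pt t 0))) := by
      rw [hTax]; exact ((hgood _ (hax t)).1.mdifferentiableAt (by simp)).hasMFDerivAt
    have hmf := HasMFDerivAt.comp (pt t 0) hE1 hd.hasMFDerivAt
    have hbil : ∀ u w, bil (pullMatrix g (E ∘ T) (pt t 0)) u w =
        bil (pullMatrix g E (T (pt t 0))) (fderiv ℝ T (pt t 0) u) (fderiv ℝ T (pt t 0) w) := by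
      intro u w
      rw [bil_pullMatrix, bil_pullMatrix, hmf.mfderiv]; rfl
    have hent : ∀ i j, pullMatrix g (E ∘ T) (pt t 0) i j =
        bil (pullMatrix g E (pt t 0)) (fderiv ℝ T (pt t 0) (e_ i)) (fderiv ℝ T (pt t 0) (e_ j)) := by
      intro i j
      exact (bil_single (pullMatrix g (E ∘ T) (pt t 0)) i j).symm.trans (by rw [hbil, hTax])
    have g00 : pullMatrix g E (pt t 0) 0 0 = 1 := hG00 t
    have g10 : pullMatrix g E (pt t 0) 1 0 = G 0 1 t := hG10 t
    have g01 : pullMatrix g E (pt t 0) 0 1 = G 0 1 t := rfl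
    have g11 : pullMatrix g E (pt t 0) 1 1 = G 1 1 t := rfl
    have hb2 : b t ^ 2 * (G 1 1 t - G 0 1 t ^ 2) = 1 := by
      have := Real.sq_sqrt (hdet t).le
      have h' := Real.sqrt_pos.mpr (hdet t)
      simp only [hb]
      nth_rw 2 [← this]
      field_simp
    have haa : a t = - G 0 1 t * b t := rfl
    ext i j
    rw [hent]
    fin_cases i <;> fin_cases j <;>
      simp only [Fin.zero_eta, Fin.mk_one, Fin.isValue, h0, h1, bil_apply, g00, g10, g01, g11,
        pt_zero, pt_one, haa]
    · simp
    · simp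
    · simp
    · simp
      linarith
  exact ⟨E ∘ T, hE', hone, hE'.exists_strip hL fun t => mfderiv_injective_of_pullMatrix (hone t)⟩

end Surface

/-! ### Strip metrics of constant curvature, and the dictionary between strip and surface. -/

section Surface
open CoordMetric

/-- The strip of half-width `δ` around the axis. -/
def strip (δ : ℝ) : Set Plane := {z | |z 1| < δ}

theorem isOpen_strip (δ : ℝ) : IsOpen (strip δ) :=
  isOpen_lt (contDiff_coord 1 (n := 0)).continuous.abs continuous_const

theorem pt_mem_strip {x y δ : ℝ} : pt x y ∈ strip δ ↔ |y| < δ := by simp [strip]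

theorem axis_mem_strip {δ : ℝ} (hδ : 0 < δ) (x : ℝ) : pt x 0 ∈ strip δ := by
  simpa [pt_mem_strip] using hδ

/-- A periodic metric of constant curvature on a strip which is standard on the axis, and whose
axis is a geodesic. -/
structure IsStripMetric (G : Plane → Matrix (Fin 2) (Fin 2) ℝ) (L δ K : ℝ) : Prop where
  delta_pos : 0 < δ
  length_pos : 0 < L
  metric : MetricOn G (strip δ)
  periodic : ∀ z ∈ strip δ, G (z + pt L 0) = G z
  axis : ∀ x, G (pt x 0) = 1
  curvature : ∀ z ∈ strip δ, gaussCurvature G z = K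
  geodesic : ∀ x, gam G (pt x 0) (e_ 0) (e_ 0) = 0

variable {M : Type*} [TopologicalSpace M] [ChartedSpace Plane M] [IsManifold (𝓡 2) ∞ M]
variable {g : Bundle.ContMDiffRiemannianMetric (𝓡 2) ∞ Plane (fun p : M => TangentSpace (𝓡 2) p)}
variable {L δ K : ℝ} {E : Plane → M} {e : OpenPartialHomeomorph M Plane}

/-- `E` is a smooth immersion of the strip of half-width `δ`. -/
def IsStripImmersion (E : Plane → M) (δ : ℝ) : Prop :=
  ∀ z ∈ strip δ, ContMDiffAt (𝓡 2) (𝓡 2) ∞ E z ∧ Function.Injective (mfderiv (𝓡 2) (𝓡 2) E z)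

theorem mfderiv_symm_injective (he : e ∈ IsManifold.maximalAtlas (𝓡 2) ∞ M) {x : Plane}
    (hx : x ∈ e.target) : Function.Injective (mfderiv (𝓡 2) (𝓡 2) e.symm x) := by
  have h : e.MDifferentiable (𝓡 2) (𝓡 2) :=
    ⟨(contMDiffOn_of_mem_maximalAtlas he).mdifferentiableOn (by simp),
      (contMDiffOn_symm_of_mem_maximalAtlas he).mdifferentiableOn (by simp)⟩
  exact h.symm.mfderiv_injective hx

/-- Curvature, geodesics and vertices are defined on `M` through charts; since `e ∘ E` is an
isometry near `z`, they may all be read off in the strip. -/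
theorem IsStripImmersion.exists_isLocalIsometry (hE : IsStripImmersion E δ)
    (he : e ∈ IsManifold.maximalAtlas (𝓡 2) ∞ M) {z : Plane} (hz : z ∈ strip δ)
    (hzs : E z ∈ e.source) : ∃ O ⊆ strip δ, z ∈ O ∧
      IsLocalIsometry (pullMatrix g E) O (metricMatrix g e) e.target (e ∘ E) := by
  have hcont : ContinuousOn E (strip δ) := fun z hz => (hE z hz).1.continuousAt.continuousWithinAt
  have hO : IsOpen (strip δ ∩ E ⁻¹' e.source) :=
    hcont.isOpen_inter_preimage (isOpen_strip δ) e.open_source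
  refine ⟨strip δ ∩ E ⁻¹' e.source, inter_subset_left, ⟨hz, hzs⟩, ?_⟩
  rw [metricMatrix_eq]
  refine isLocalIsometry_pullMatrix hO e.open_target (contMDiffOn_symm_of_mem_maximalAtlas he)
    (fun x hx => (contDiffAt_chart_comp he (hE x hx.1).1 hx.2).contDiffWithinAt)
    (fun x hx => e.map_source hx.2) (fun x hx => mfderiv_symm_injective he hx)
    (fun x hx => (hE x hx.1).2) (fun x hx => (e.left_inv hx.2).symm)

theorem chart_mem_maximalAtlas' (p : M) :
    chartAt Plane p ∈ IsManifold.maximalAtlas (𝓡 2) ∞ M :=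
  IsManifold.chart_mem_maximalAtlas p

theorem IsStripImmersion.gaussCurvature_eq (hE : IsStripImmersion E δ)
    (hK : HasConstantCurvature g K) {z : Plane} (hz : z ∈ strip δ) :
    gaussCurvature (pullMatrix g E) z = K := by
  obtain ⟨O, -, hzO, h⟩ := hE.exists_isLocalIsometry (g := g) (chart_mem_maximalAtlas' (E z)) hz
    (mem_chart_source Plane (E z))
  rw [← h.gaussCurvature_eq hzO]
  exact hK (E z)

theorem IsStripImmersion.isVertex_iff (hE : IsStripImmersion E δ) {c : SmoothCurve M}
    {b : ℝ → Plane} (hc : ∀ s, c s = E (b s)) {t : ℝ} (hb : ContDiffAt ℝ 2 b t)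
    (hz : b t ∈ strip δ) :
    IsVertex g c t ↔ deriv (geodesicCurvature (pullMatrix g E) b) t = 0 := by
  obtain ⟨O, -, hzO, h⟩ := hE.exists_isLocalIsometry (g := g) (chart_mem_maximalAtlas' (E (b t))) hz
    (mem_chart_source Plane (E (b t)))
  have h1 : ⇑c = E ∘ b := funext hc
  rw [IsVertex, ← h.deriv_geodesicCurvature_comp hzO hb, hc t, h1]
  rfl

theorem IsStripImmersion.mfderiv_ne_zero_iff (hE : IsStripImmersion E δ) {c : ℝ → M}
    {b : ℝ → Plane} (hc : ∀ s, c s = E (b s)) {t : ℝ} (hb : DifferentiableAt ℝ b t)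
    (hz : b t ∈ strip δ) : mfderiv 𝓘(ℝ, ℝ) (𝓡 2) c t (1 : ℝ) ≠ 0 ↔ deriv b t ≠ 0 := by
  have h1 : c = E ∘ b := funext hc
  have h2 := HasMFDerivAt.comp t (((hE _ hz).1.mdifferentiableAt (by simp)).hasMFDerivAt)
    hb.hasDerivAt.hasFDerivAt.hasMFDerivAt
  rw [h1, h2.mfderiv, not_iff_not]
  have h3 : ∀ u : Plane, mfderiv (𝓡 2) (𝓡 2) E (b t) u = 0 ↔ u = 0 := fun u =>
    ⟨fun h => (hE _ hz).2 (h.trans (map_zero _).symm), fun h => by rw [h]; exact map_zero _⟩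
  refine Iff.trans ?_ (h3 (deriv b t))
  have h4 : ((mfderiv (𝓡 2) (𝓡 2) E (b t)).comp
      (ContinuousLinearMap.toSpanSingleton ℝ (deriv b t) : ℝ →L[ℝ] Plane)) (1 : ℝ) =
      mfderiv (𝓡 2) (𝓡 2) E (b t) (deriv b t) :=
    congrArg (mfderiv (𝓡 2) (𝓡 2) E (b t)) (one_smul ℝ (deriv b t))
  exact ⟨fun h => h4.symm.trans h, fun h => h4.trans h⟩

/-- Fermi-type coordinates along a closed geodesic in a surface of constant curvature. -/
theorem exists_isStripMetric {γ : SmoothCurve M} (hK : HasConstantCurvature g K)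
    (hγ : IsClosedGeodesic g γ L)
    (hor : ∃ V : Set M, IsOpen V ∧ range γ ⊆ V ∧ IsOrientableOn V) :
    ∃ (E : Plane → M) (δ : ℝ), IsAxisExtension γ L E ∧ IsStripImmersion E δ ∧
      IsStripMetric (pullMatrix g E) L δ K := by
  obtain ⟨V, -, hγV, hV⟩ := hor
  obtain ⟨E, hE, hone, δ, hδ, hgood⟩ := exists_strip g hγ.length_pos γ.contMDiff hγ.periodic
    hγ.unit_speed hγV hV
  have hE' : IsStripImmersion E δ := hgood
  refine ⟨E, δ, hE, hE', hδ, hγ.length_pos, metricOn_pullMatrix (isOpen_strip δ)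
    (fun z hz => (hgood z hz).1.contMDiffWithinAt) (fun z hz => (hgood z hz).2),
    fun z hz => pullMatrix_translate hgood hE.periodic hz, hone,
    fun z hz => hE'.gaussCurvature_eq hK hz, fun t => ?_⟩
  obtain ⟨O, -, hzO, h⟩ := hE'.exists_isLocalIsometry (g := g) (chart_mem_maximalAtlas' (γ t))
    (axis_mem_strip hδ t) (by rw [hE.axis]; exact mem_chart_source Plane (γ t))
  have hpt : ContDiff ℝ 2 fun s : ℝ => pt s 0 := contDiff_pt contDiff_id contDiff_const
  have h1 : ((chartAt Plane (γ t)) ∘ E) ∘ (fun s => pt s 0) = chartAt Plane (γ t) ∘ γ := by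
    funext s; simp [hE.axis]
  have hdpt : ∀ s : ℝ, HasDerivAt (fun s => pt s 0) (e_ 0) s := fun s => by
    simpa [pt] using hasDerivAt_pt (hasDerivAt_id s) (hasDerivAt_const s 0)
  -- The axis is a straight line, so its acceleration reduces to the Christoffel term on `e₀, e₀`.
  -- It is mapped to the acceleration of `γ`, which is zero, by an injective differential.
  have h2 := h.acc_comp (c := fun s => pt s 0) hzO hpt.contDiffAt
  rw [h1] at h2
  have hcs : ContDiffAt ℝ 2 (chartAt Plane (γ t) ∘ γ) t :=
    (contDiffAt_chart_comp (chart_mem_maximalAtlas' (γ t)) γ.contMDiff.contMDiffAt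
      (mem_chart_source Plane (γ t))).of_le two_le_infty
  have h3 : acc (metricMatrix g (chartAt Plane (γ t))) (chartAt Plane (γ t) ∘ γ) t = 0 := by
    ext k
    rw [← acceleration_eq hcs, hγ.geodesic t k]; rfl
  rw [h3] at h2
  have h4 := h.injective hzO (h2.symm.trans (map_zero _).symm)
  have h5 : deriv (fun s : ℝ => pt s 0) = fun _ => e_ 0 := funext fun s => (hdpt s).deriv
  rw [acc, h5] at h4
  simpa using h4

end Surface

/-! ### The connection of a strip metric to first order along the axis. -/

namespace IsStripMetric
open CoordMetric

variable {G : Plane → Matrix (Fin 2) (Fin 2) ℝ} {L δ K : ℝ}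

theorem bil_axis (h : IsStripMetric G L δ K) (x : ℝ) (u w : Plane) :
    bil (G (pt x 0)) u w = u 0 * w 0 + u 1 * w 1 := by
  rw [h.axis, bil_apply]
  simp

theorem hasDerivAt_axis {F : Type*} [NormedAddCommGroup F] [NormedSpace ℝ F] {T : Plane → F}
    {x : ℝ} (hT : DifferentiableAt ℝ T (pt x 0)) :
    HasDerivAt (fun s => T (pt s 0)) (fderiv ℝ T (pt x 0) (e_ 0)) x := by
  have := hasDerivAt_pt (hasDerivAt_id x) (hasDerivAt_const x 0)
  have h1 := hasDerivAt_comp_plane (T := T) (c := fun s => pt s 0) (t := x) hT this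
  simpa [pt] using h1

/-- The metric is constant along the axis, so compatibility expresses that the frame `e₀, e₁` stays
orthonormal. Since `e₀` is parallel (the axis is a geodesic), so is `e₁`. -/
theorem gam_axis (h : IsStripMetric G L δ K) (x : ℝ) : gam G (pt x 0) (e_ 0) (e_ 1) = 0 := by
  have hm := axis_mem_strip h.delta_pos x
  have h0 : fderiv ℝ (fun x => bil (G x)) (pt x 0) (e_ 0) = 0 := by
    have h1 := hasDerivAt_axis (F := Plane →L[ℝ] Plane →L[ℝ] ℝ) (T := fun x => bil (G x)) (x := x)
      (h.metric.differentiableAt_bil hm)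
    have h2 : (fun s => bil (G (pt s 0))) = fun _ => bil 1 := by
      funext s; rw [h.axis]
    rw [h2] at h1
    exact h1.unique (hasDerivAt_const (F := Plane →L[ℝ] Plane →L[ℝ] ℝ) x (bil 1))
  have h1 := h.metric.compat hm (e_ 0) (e_ 0) (e_ 1)
  have h2 := h.metric.compat hm (e_ 0) (e_ 1) (e_ 1)
  rw [h0, h.geodesic, h.bil_axis, h.bil_axis] at h1
  rw [h0, h.bil_axis, h.bil_axis] at h2
  simp at h1 h2
  rw [← pt_eta (gam G (pt x 0) (e_ 0) (e_ 1))]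
  have h3 : gam G (pt x 0) (e_ 0) (e_ 1) 1 = 0 := by linarith
  rw [← h1, h3]; simp [pt]

theorem gam_axis' (h : IsStripMetric G L δ K) (x : ℝ) : gam G (pt x 0) (e_ 1) (e_ 0) = 0 := by
  rw [h.metric.gam_symm (axis_mem_strip h.delta_pos x), h.gam_axis]

/-- On the axis every other term of `R(e₁, e₀)e₀` vanishes, because the Christoffel form vanishes
there whenever one argument is `e₀`. This is where `K` enters the linearized geodesic curvature. -/
theorem fderiv_gam_axis (h : IsStripMetric G L δ K) (x : ℝ) :
    fderiv ℝ (gam G) (pt x 0) (e_ 1) (e_ 0) (e_ 0) = K • e_ 1 := by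
  have hm := axis_mem_strip h.delta_pos x
  have h1 := h.metric.curv_eq hm (e_ 1) (e_ 0) (e_ 0)
  have h0 : fderiv ℝ (gam G) (pt x 0) (e_ 0) (e_ 1) (e_ 0) = 0 := by
    have h2 := hasDerivAt_axis (F := Plane →L[ℝ] Plane →L[ℝ] Plane) (T := gam G) (x := x)
      (h.metric.differentiableAt_gam hm)
    have h3 := (h2.clm_apply (hasDerivAt_const x (e_ 1))).clm_apply (hasDerivAt_const x (e_ 0))
    have h4 : (fun s : ℝ => gam G (pt s 0) (e_ 1) (e_ 0)) = fun _ => 0 :=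
      funext fun s => h.gam_axis' s
    rw [h4] at h3
    have := h3.unique (hasDerivAt_const x _)
    simpa using this
  rw [curv, h0, h.geodesic, h.gam_axis', h.curvature _ hm, h.bil_axis, h.bil_axis] at h1
  simpa using h1

end IsStripMetric

/-! ### Functions of two real variables -/

section TwoVariables

variable {F : Type*} [NormedAddCommGroup F] [NormedSpace ℝ F] {O : Set (ℝ × ℝ)}

theorem hasDerivAt_snd {Φ : ℝ × ℝ → F} {p : ℝ × ℝ} (h : DifferentiableAt ℝ Φ p) :
    HasDerivAt (fun t => Φ (p.1, t)) (fderiv ℝ Φ p (0, 1)) p.2 :=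
  h.hasFDerivAt.comp_hasDerivAt p.2 ((hasDerivAt_const p.2 p.1).prodMk (hasDerivAt_id p.2))

theorem hasDerivAt_fst {Φ : ℝ × ℝ → F} {p : ℝ × ℝ} (h : DifferentiableAt ℝ Φ p) :
    HasDerivAt (fun t => Φ (t, p.2)) (fderiv ℝ Φ p (1, 0)) p.1 :=
  h.hasFDerivAt.comp_hasDerivAt p.1 ((hasDerivAt_id p.1).prodMk (hasDerivAt_const p.1 p.2))

theorem contDiffOn_fderiv_apply {Φ : ℝ × ℝ → F} (hO : IsOpen O) (h : ContDiffOn ℝ ∞ Φ O)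
    (v : ℝ × ℝ) : ContDiffOn ℝ ∞ (fun p => fderiv ℝ Φ p v) O :=
  (h.fderiv_of_isOpen hO (by simp)).clm_apply contDiffOn_const

theorem contDiffOn_iteratedDeriv_snd {Φ : ℝ × ℝ → F} (hO : IsOpen O) (h : ContDiffOn ℝ ∞ Φ O)
    (j : ℕ) : ContDiffOn ℝ ∞ (fun p => iteratedDeriv j (fun t => Φ (p.1, t)) p.2) O := by
  induction j with
  | zero => simpa using h
  | succ j ih =>
    refine (contDiffOn_fderiv_apply hO ih (0, 1)).congr fun p hp => ?_
    rw [iteratedDeriv_succ]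
    exact (hasDerivAt_snd ((ih.contDiffAt (hO.mem_nhds hp)).differentiableAt (by simp))).deriv

/-- Symmetry of mixed partial derivatives: the first variation in `x` may be differentiated in `t`.
-/
theorem deriv_fst_deriv_snd {Φ : ℝ × ℝ → ℝ} (hO : IsOpen O) (h : ContDiffOn ℝ ∞ Φ O) {A : ℝ → ℝ}
    (hA : ∀ t, HasDerivAt (fun x => Φ (x, t)) (A t) 0) {A' t : ℝ} (hA' : HasDerivAt A A' t)
    (hO0 : ∀ t, (0, t) ∈ O) :
    HasDerivAt (fun x => deriv (fun s => Φ (x, s)) t) A' 0 := by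
  have hd : ∀ p ∈ O, DifferentiableAt ℝ Φ p := fun p hp =>
    (h.contDiffAt (hO.mem_nhds hp)).differentiableAt (by simp)
  have hd2 : DifferentiableAt ℝ (fderiv ℝ Φ) (0, t) :=
    ((h.contDiffAt (hO.mem_nhds (hO0 t))).fderiv_right (m := 1)
      CoordMetric.two_le_infty).differentiableAt (by simp)
  have h1 : HasDerivAt (fun x => fderiv ℝ Φ (x, t) (0, 1))
      (fderiv ℝ (fderiv ℝ Φ) (0, t) (1, 0) (0, 1)) 0 := by
    simpa using (hasDerivAt_fst hd2).clm_apply (hasDerivAt_const (0 : ℝ) ((0, 1) : ℝ × ℝ))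
  have h2 : HasDerivAt (fun s => fderiv ℝ Φ (0, s) (1, 0))
      (fderiv ℝ (fderiv ℝ Φ) (0, t) (0, 1) (1, 0)) t := by
    simpa using (hasDerivAt_snd hd2).clm_apply (hasDerivAt_const t ((1, 0) : ℝ × ℝ))
  have h3 : (fun s => fderiv ℝ Φ (0, s) (1, 0)) = A := by
    funext s
    exact (hasDerivAt_fst (hd _ (hO0 s))).unique (hA s)
  have hsymm : IsSymmSndFDerivAt ℝ Φ (0, t) :=
    (h.contDiffAt (hO.mem_nhds (hO0 t))).isSymmSndFDerivAt
      (by simpa using CoordMetric.two_le_infty)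
  rw [h3] at h2
  have h4 := hA'.unique h2
  rw [h4, ← hsymm (1, 0) (0, 1)]
  refine h1.congr_of_eventuallyEq ?_
  have hc : Filter.Tendsto (fun x : ℝ => (x, t)) (𝓝 0) (𝓝 (0, t)) :=
    (continuous_id.prodMk continuous_const).tendsto 0
  filter_upwards [hc.eventually (hO.mem_nhds (hO0 t))] with x hx
  exact (hasDerivAt_snd (hd _ hx)).deriv

/-- A periodic family of functions which vanishes for the parameter `0` is uniformly approximated
by its linearization. -/
theorem exists_abs_sub_le {Φ : ℝ × ℝ → ℝ} {L : ℝ} (hL : 0 < L) (hO : IsOpen O)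
    (h : ContDiffOn ℝ ∞ Φ O) (hO0 : ∀ t, (0, t) ∈ O)
    (hper : ∀ᶠ x in 𝓝 0, ∀ t, Φ (x, t + L) = Φ (x, t))
    (h0 : ∀ t, Φ (0, t) = 0) {A : ℝ → ℝ} (hA : ∀ t, HasDerivAt (fun x => Φ (x, t)) (A t) 0)
    {r : ℝ} (hr : 0 < r) :
    ∀ᶠ x in 𝓝 (0 : ℝ), ∀ t, |Φ (x, t) - x * A t| ≤ r * |x| := by
  have hd : ∀ p ∈ O, DifferentiableAt ℝ Φ p := fun p hp =>
    (h.contDiffAt (hO.mem_nhds hp)).differentiableAt (by simp)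
  have hAeq : ∀ t, A t = fderiv ℝ Φ (0, t) (1, 0) := fun t =>
    (hA t).unique (hasDerivAt_fst (hd _ (hO0 t)))
  -- On one period the `x`-derivative of `Φ` stays within `r` of its value at `x = 0`; the mean
  -- value inequality in `x` then bounds the remainder. The linear term `A` inherits the period from
  -- `Φ`.
  have hev : ∀ᶠ x in 𝓝 (0 : ℝ), ∀ t ∈ Icc 0 L, (x, t) ∈ O ∧
      |fderiv ℝ Φ (x, t) (1, 0) - A t| < r := by
    refine isCompact_Icc.eventually_forall_of_forall_eventually fun t _ => ?_
    have hOn : ∀ᶠ p in 𝓝 ((0, t) : ℝ × ℝ), p ∈ O := hO.mem_nhds (hO0 t)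
    have hc : ContinuousAt (fun p => fderiv ℝ Φ p (1, 0)) (0, t) :=
      (contDiffOn_fderiv_apply hO h (1, 0)).continuousOn.continuousAt hOn
    have hm : Filter.Tendsto (fun p : ℝ × ℝ => ((0 : ℝ), p.2)) (𝓝 (0, t)) (𝓝 (0, t)) :=
      (continuous_const.prodMk continuous_snd).tendsto (0, t)
    have hc2 : Filter.Tendsto (fun p : ℝ × ℝ => |fderiv ℝ Φ p (1, 0) - A p.2|) (𝓝 (0, t)) (𝓝 0) := by
      have h1 := (hc.tendsto.sub (hc.tendsto.comp hm)).abs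
      rw [sub_self, abs_zero] at h1
      refine h1.congr fun p => ?_
      simp [hAeq]
    filter_upwards [hOn, hc2.eventually (gt_mem_nhds hr)] with p h1 h2 using ⟨h1, h2⟩
  obtain ⟨ρ, hρ, hball⟩ := Metric.eventually_nhds_iff_ball.mp hev
  filter_upwards [Metric.ball_mem_nhds 0 hρ, hper] with x hx hperx
  have hI : ∀ t ∈ Icc 0 L, |Φ (x, t) - x * A t| ≤ r * |x| := by
    intro t ht
    have h1 : ∀ y ∈ Metric.ball (0 : ℝ) ρ, HasDerivWithinAt (fun y => Φ (y, t) - y * A t)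
        (fderiv ℝ Φ (y, t) (1, 0) - A t) (Metric.ball 0 ρ) y := by
      intro y hy
      have := (hasDerivAt_fst (hd _ (hball y hy t ht).1)).sub ((hasDerivAt_id y).mul_const (A t))
      exact (this.congr_deriv (by simp)).hasDerivWithinAt
    have h2 := (convex_ball (0 : ℝ) ρ).norm_image_sub_le_of_norm_hasDerivWithin_le (C := r) h1
      (fun y hy => (hball y hy t ht).2.le) (Metric.mem_ball_self hρ) hx
    simpa [h0, Real.norm_eq_abs] using h2
  intro t
  have hAper : Function.Periodic A L := fun s => by
    have h1 := hA (s + L)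
    refine (h1.congr_of_eventuallyEq ?_).unique (hA s)
    filter_upwards [hper] with x hx using (hx s).symm
  obtain ⟨n, hn, -⟩ := existsUnique_add_zsmul_mem_Ico hL t 0
  simp only [zsmul_eq_mul, zero_add] at hn
  have h1 := hI _ ⟨hn.1, hn.2.le⟩
  have h2 : Function.Periodic (fun t => Φ (x, t)) L := hperx
  have h3 : Φ (x, t + n * L) = Φ (x, t) := h2.int_mul n t
  rwa [h3, hAper.int_mul n t] at h1

end TwoVariables

/-! ### Zeros of periodic functions close to a sine -/

section ZeroCounting

open Real in
-- Outside the windows of radius `π / 6` around the multiples of `π` the sine is at least `1/2` in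
-- absolute value, which excludes zeros. Inside, the cosine is at least `√3 / 2 > 1/2` in absolute
-- value, so `v` is strictly monotone and, changing sign across the window, has one zero there.
theorem zeros_near_sin {v v' : ℝ → ℝ} (hv : ∀ s, HasDerivAt v (v' s) s)
    (hper : Function.Periodic v (2 * π)) (h0 : ∀ s, |v s - sin s| < 1 / 2)
    (h1 : ∀ s, |v' s - cos s| ≤ 1 / 2) :
    ∃ z₁ z₂ : ℝ, z₁ < z₂ ∧ z₂ < z₁ + 2 * π ∧
      ∀ s, v s = 0 ↔ (∃ n : ℤ, s = z₁ + n * (2 * π)) ∨ ∃ n : ℤ, s = z₂ + n * (2 * π) := by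
  have hπ := pi_pos
  have hsqrt : (1 : ℝ) / 2 < √3 / 2 := by
    have : (1 : ℝ) < √3 := by rw [lt_sqrt] <;> norm_num
    linarith
  have hs6 : sin (π / 6) = 1 / 2 := sin_pi_div_six
  have hc : Continuous v := continuous_iff_continuousAt.mpr fun s => (hv s).continuousAt
  -- the increasing window
  have hcos : ∀ s ∈ Icc (-(π / 6)) (π / 6), √3 / 2 ≤ cos s := by
    intro s hs
    rw [← cos_pi_div_six, ← cos_abs s]
    exact cos_le_cos_of_nonneg_of_le_pi (abs_nonneg _) (by linarith) (abs_le.mpr ⟨by linarith [hs.1], hs.2⟩)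
  have hmono : StrictMonoOn v (Icc (-(π / 6)) (π / 6)) := by
    refine strictMonoOn_of_deriv_pos (convex_Icc _ _) hc.continuousOn fun s hs => ?_
    rw [interior_Icc] at hs
    rw [(hv s).deriv]
    have := hcos s ⟨hs.1.le, hs.2.le⟩
    linarith [(abs_le.mp (h1 s)).1]
  have hanti : StrictAntiOn v (Icc (π - π / 6) (π + π / 6)) := by
    refine strictAntiOn_of_deriv_neg (convex_Icc _ _) hc.continuousOn fun s hs => ?_
    rw [interior_Icc] at hs
    rw [(hv s).deriv]
    have := hcos (s - π) ⟨by linarith [hs.1], by linarith [hs.2]⟩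
    rw [cos_sub_pi] at this
    linarith [(abs_le.mp (h1 s)).2]
  obtain ⟨z₁, hz₁, hz₁0⟩ : (0 : ℝ) ∈ v '' Icc (-(π / 6)) (π / 6) := by
    refine intermediate_value_Icc (by linarith) hc.continuousOn ⟨?_, ?_⟩
    · have := (abs_lt.mp (h0 (-(π / 6)))).2
      rw [sin_neg, hs6] at this; linarith
    · have := (abs_lt.mp (h0 (π / 6))).1
      rw [hs6] at this; linarith
  obtain ⟨z₂, hz₂, hz₂0⟩ : (0 : ℝ) ∈ v '' Icc (π - π / 6) (π + π / 6) := by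
    refine intermediate_value_Icc' (by linarith) hc.continuousOn ⟨?_, ?_⟩
    · have := (abs_lt.mp (h0 (π / 6 + π))).2
      rw [sin_add_pi, hs6] at this
      rw [add_comm π]; linarith
    · have := (abs_lt.mp (h0 (π - π / 6))).1
      rw [sin_pi_sub, hs6] at this; linarith
  refine ⟨z₁, z₂, by linarith [hz₁.2, hz₂.1], by linarith [hz₁.1, hz₂.2], fun s => ⟨fun hs => ?_, ?_⟩⟩
  · obtain ⟨n, hn, -⟩ := existsUnique_add_zsmul_mem_Ico two_pi_pos s (-(π / 6))
    simp only [zsmul_eq_mul] at hn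
    set r := s + n * (2 * π) with hr
    have hvr : v r = 0 := (hper.int_mul n s).trans hs
    have hsin : |sin r| < 1 / 2 := by
      have := h0 r
      rwa [hvr, zero_sub, abs_neg] at this
    rcases le_or_gt r (π / 6) with ha | ha
    · left
      have : r = z₁ := hmono.injOn ⟨hn.1, ha⟩ hz₁ (hvr.trans hz₁0.symm)
      exact ⟨-n, by push_cast; linarith⟩
    rcases lt_or_ge r (π - π / 6) with hb | hb
    · exfalso
      have h2 : 1 / 2 ≤ sin r := by
        rcases le_or_gt r (π / 2) with hc | hc
        · rw [← hs6]
          exact sin_le_sin_of_le_of_le_pi_div_two (by linarith) hc ha.le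
        · rw [← hs6, ← sin_pi_sub r]
          exact sin_le_sin_of_le_of_le_pi_div_two (by linarith) (by linarith) (by linarith)
      linarith [le_abs_self (sin r)]
    rcases le_or_gt r (π + π / 6) with hd | hd
    · right
      have : r = z₂ := hanti.injOn ⟨hb, hd⟩ hz₂ (hvr.trans hz₂0.symm)
      exact ⟨-n, by push_cast; linarith⟩
    · exfalso
      have h2 : 1 / 2 ≤ sin (r - π) := by
        rcases le_or_gt (r - π) (π / 2) with hc | hc
        · rw [← hs6]
          exact sin_le_sin_of_le_of_le_pi_div_two (by linarith) hc (by linarith)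
        · rw [← hs6, ← sin_pi_sub (r - π)]
          exact sin_le_sin_of_le_of_le_pi_div_two (by linarith) (by linarith) (by linarith [hn.2])
      rw [sin_sub_pi] at h2
      linarith [neg_abs_le (sin r)]
  · rintro (⟨n, rfl⟩ | ⟨n, rfl⟩)
    · exact (hper.int_mul n z₁).trans hz₁0
    · exact (hper.int_mul n z₂).trans hz₂0

open Real in
/-- A function of period `L` which is `C¹` close to a nonzero translate of a multiple of
`sin (2 π t / L)` has exactly two zeros modulo `L`. -/
theorem exists_zeros_of_near_sin {L A θ : ℝ} (hL : 0 < L) (hA : A ≠ 0) {u u' : ℝ → ℝ}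
    (hu : ∀ t, HasDerivAt u (u' t) t) (hper : Function.Periodic u L)
    (h0 : ∀ t, |u t - A * sin (2 * π / L * (t - θ))| < |A| / 2)
    (h1 : ∀ t, |u' t - A * (2 * π / L) * cos (2 * π / L * (t - θ))| ≤ |A| * (2 * π / L) / 2) :
    ∃ z₁ z₂ : ℝ, z₁ < z₂ ∧ z₂ < z₁ + L ∧
      ∀ t, u t = 0 ↔ (∃ n : ℤ, t = z₁ + n * L) ∨ ∃ n : ℤ, t = z₂ + n * L := by
  set l := 2 * π / L with hl
  have hlpos : 0 < l := by positivity
  have hlL : 2 * π = l * L := by rw [hl]; field_simp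
  have hs : ∀ s, l * (θ + s / l - θ) = s := fun s => by field_simp; ring
  obtain ⟨z₁, z₂, h12, h21, hz⟩ := zeros_near_sin (v := fun s => u (θ + s / l) / A)
    (v' := fun s => u' (θ + s / l) / (A * l)) (fun s => by
      have h2 : HasDerivAt (fun s => θ + s / l) (1 / l) s :=
        ((hasDerivAt_id s).div_const l).const_add θ
      refine (((hu (θ + s / l)).comp s h2).div_const A).congr_deriv ?_
      field_simp)
    (fun s => by
      have : θ + (s + 2 * π) / l = θ + s / l + L := by rw [hlL]; field_simp; ring
      simp only [this, hper _])
    (fun s => by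
      have h2 := h0 (θ + s / l)
      rw [hs] at h2
      have h3 : u (θ + s / l) / A - sin s = (u (θ + s / l) - A * sin s) / A := by field_simp
      rw [h3, abs_div, div_lt_iff₀ (abs_pos.mpr hA)]
      linarith)
    (fun s => by
      have h2 := h1 (θ + s / l)
      rw [hs] at h2
      have h3 : u' (θ + s / l) / (A * l) - cos s = (u' (θ + s / l) - A * l * cos s) / (A * l) := by
        field_simp
      rw [h3, abs_div, div_le_iff₀ (abs_pos.mpr (mul_ne_zero hA hlpos.ne')), abs_mul,
        abs_of_pos hlpos]
      linarith)
  refine ⟨θ + z₁ / l, θ + z₂ / l, by gcongr, ?_, fun t => ?_⟩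
  · have : z₂ / l < (z₁ + 2 * π) / l := by gcongr
    rw [add_div] at this
    have h3 : 2 * π / l = L := by rw [hlL]; field_simp
    linarith
  · have h2 := hz (l * (t - θ))
    have h3 : θ + l * (t - θ) / l = t := by field_simp; ring
    rw [h3, div_eq_zero_iff, or_iff_left hA] at h2
    have h4 : ∀ z (n : ℤ), l * (t - θ) = z + n * (2 * π) ↔ t = θ + z / l + n * L := by
      intro z n
      rw [hlL]
      constructor
      · intro h
        have : t - θ = (z + n * (l * L)) / l := by rw [← h]; field_simp
        have h5 : (z + n * (l * L)) / l = z / l + n * L := by field_simp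
        linarith
      · rintro rfl; field_simp; ring
    simpa only [h4] using h2

theorem encard_zeros_Ico {L z₁ z₂ : ℝ} (hL : 0 < L) (h12 : z₁ < z₂) (h21 : z₂ < z₁ + L)
    {P : ℝ → Prop}
    (hP : ∀ t, P t ↔ (∃ n : ℤ, t = z₁ + n * L) ∨ ∃ n : ℤ, t = z₂ + n * L) :
    {t ∈ Ico 0 L | P t}.encard = 2 := by
  have hmod : ∀ z, ∃ n : ℤ, toIcoMod hL 0 z = z + n * L := fun z =>
    ⟨-toIcoDiv hL 0 z, by simp [toIcoMod, sub_eq_add_neg]⟩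
  have hne : toIcoMod hL 0 z₁ ≠ toIcoMod hL 0 z₂ := by
    intro h
    obtain ⟨n, hn⟩ := hmod z₁
    obtain ⟨m, hm⟩ := hmod z₂
    have h3 : z₂ - z₁ = ((n - m : ℤ) : ℝ) * L := by push_cast; linarith
    have h4 : (0 : ℝ) < ((n - m : ℤ) : ℝ) := by
      by_contra hc; push Not at hc
      nlinarith
    have h5 : ((n - m : ℤ) : ℝ) < 1 := by
      by_contra hc; push Not at hc
      nlinarith
    have h6 : (0 : ℤ) < n - m := by exact_mod_cast h4
    have h7 : n - m < (1 : ℤ) := by exact_mod_cast h5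
    omega
  have : {t ∈ Ico 0 L | P t} = {toIcoMod hL 0 z₁, toIcoMod hL 0 z₂} := by
    ext t
    simp only [mem_ofPred_eq, mem_insert_iff, mem_singleton_iff, hP]
    constructor
    · rintro ⟨ht, ⟨n, hn⟩ | ⟨n, hn⟩⟩
      · left
        rw [← (toIcoMod_eq_self (a := 0) (b := t) hL).mpr (by simpa using ht), hn, ← zsmul_eq_mul, toIcoMod_add_zsmul]
      · right
        rw [← (toIcoMod_eq_self (a := 0) (b := t) hL).mpr (by simpa using ht), hn, ← zsmul_eq_mul, toIcoMod_add_zsmul]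
    · rintro (rfl | rfl)
      · exact ⟨by simpa using toIcoMod_mem_Ico hL 0 z₁, Or.inl (hmod z₁)⟩
      · exact ⟨by simpa using toIcoMod_mem_Ico hL 0 z₂, Or.inr (hmod z₂)⟩
  rw [this, encard_pair hne]

end ZeroCounting

/-! ### Graphs over the axis and the linearization of their geodesic curvature. -/

namespace IsStripMetric
open CoordMetric

variable {G : Plane → Matrix (Fin 2) (Fin 2) ℝ} {L δ K : ℝ}

theorem gam_periodic (h : IsStripMetric G L δ K) {z : Plane} (hz : z ∈ strip δ) :
    gam G (z + pt L 0) = gam G z := by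
  have hp : ∀ m i j, partialDeriv m (fun y => G y i j) (z + pt L 0) =
      partialDeriv m (fun y => G y i j) z := by
    intro m i j
    rw [partialDeriv, partialDeriv, ← fderiv_comp_add_right]
    congr 1
    refine Filter.EventuallyEq.fderiv_eq ?_
    filter_upwards [(isOpen_strip δ).mem_nhds hz] with y hy
    rw [h.periodic y hy]
  ext u w k
  simp only [gam_apply, christoffel, hp, h.periodic z hz]

theorem geodesicCurvature_periodic (h : IsStripMetric G L δ K) {c : ℝ → Plane}
    (hc : ContDiff ℝ 2 c) (hcL : ∀ s, c (s + L) = c s + pt L 0) {t : ℝ} (ht : c t ∈ strip δ) :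
    geodesicCurvature G c (t + L) = geodesicCurvature G c t := by
  have h1 : ∀ s, deriv c (s + L) = deriv c s := by
    intro s
    rw [← deriv_comp_add_const]
    simp only [hcL, deriv_add_const]
  have h2 : deriv (deriv c) (t + L) = deriv (deriv c) t := by
    rw [← deriv_comp_add_const]
    simp only [h1]
  rw [geodesicCurvature_eq hc.contDiffAt, geodesicCurvature_eq hc.contDiffAt, acc, acc, h1, h2,
    hcL, h.gam_periodic ht, h.periodic _ ht]

/-- The geodesic curvature of the graph of `x * f`. -/
def graphCurvature (G : Plane → Matrix (Fin 2) (Fin 2) ℝ) (f : ℝ → ℝ) (p : ℝ × ℝ) : ℝ :=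
  geodesicCurvature G (fun t => pt t (p.1 * f t)) p.2

variable {f : ℝ → ℝ}

theorem contDiff_graph (hf : ContDiff ℝ ∞ f) (x : ℝ) : ContDiff ℝ ∞ fun t => pt t (x * f t) :=
  contDiff_pt contDiff_id (contDiff_const.mul hf)

theorem deriv_graph (hf : ContDiff ℝ ∞ f) (x : ℝ) :
    deriv (fun t => pt t (x * f t)) = fun t => pt 1 (x * deriv f t) := by
  funext t
  exact (hasDerivAt_pt (hasDerivAt_id t)
    ((hf.differentiable (by simp) t).hasDerivAt.const_mul x)).deriv

theorem deriv_deriv_graph (hf : ContDiff ℝ ∞ f) (x : ℝ) :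
    deriv (deriv fun t => pt t (x * f t)) = fun t => pt 0 (x * deriv (deriv f) t) := by
  rw [deriv_graph hf]
  funext t
  have h1 : ContDiff ℝ ∞ (deriv f) := (contDiff_infty_iff_deriv.mp hf).2
  exact (hasDerivAt_pt (hasDerivAt_const t 1)
    ((h1.differentiable (by simp) t).hasDerivAt.const_mul x)).deriv

/-- The acceleration of the graph of `x * f`. -/
def graphAcc (G : Plane → Matrix (Fin 2) (Fin 2) ℝ) (f : ℝ → ℝ) (p : ℝ × ℝ) : Plane :=
  pt 0 (p.1 * deriv (deriv f) p.2) + gam G (pt p.2 (p.1 * f p.2)) (pt 1 (p.1 * deriv f p.2))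
    (pt 1 (p.1 * deriv f p.2))

/-- The numerator vanishes at `x = 0`, where the remaining factor is `1`; in this form the
`x`-derivative at `0` is that of the numerator alone. -/
theorem graphCurvature_eq (hf : ContDiff ℝ ∞ f) (p : ℝ × ℝ) : graphCurvature G f p =
    cross (pt 1 (p.1 * deriv f p.2)) (graphAcc G f p) * (Real.sqrt (G (pt p.2 (p.1 * f p.2))).det /
      Real.sqrt (bil (G (pt p.2 (p.1 * f p.2))) (pt 1 (p.1 * deriv f p.2))
        (pt 1 (p.1 * deriv f p.2))) ^ 3) := by
  rw [graphCurvature, geodesicCurvature_eq ((contDiff_graph hf p.1).of_le two_le_infty).contDiffAt,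
    acc, deriv_deriv_graph hf, deriv_graph hf, graphAcc]
  ring

/-- The parameters for which the graph of `x * f` stays in the strip. -/
def graphDomain (f : ℝ → ℝ) (δ : ℝ) : Set (ℝ × ℝ) := {p | pt p.2 (p.1 * f p.2) ∈ strip δ}

theorem contDiff_graph₂ (hf : ContDiff ℝ ∞ f) :
    ContDiff ℝ ∞ fun p : ℝ × ℝ => pt p.2 (p.1 * f p.2) :=
  contDiff_pt contDiff_snd (contDiff_fst.mul (hf.comp contDiff_snd))

theorem isOpen_graphDomain (hf : ContDiff ℝ ∞ f) : IsOpen (graphDomain f δ) :=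
  (isOpen_strip δ).preimage (contDiff_graph₂ hf).continuous

theorem zero_mem_graphDomain (hδ : 0 < δ) (t : ℝ) : ((0 : ℝ), t) ∈ graphDomain f δ := by
  simpa [graphDomain] using axis_mem_strip hδ t

theorem contDiffOn_gam_apply (h : IsStripMetric G L δ K) {X : Type*} [NormedAddCommGroup X]
    [NormedSpace ℝ X] {a b c : X → Plane} {O : Set X} (ha : ContDiffOn ℝ ∞ a O)
    (hb : ContDiffOn ℝ ∞ b O) (hc : ContDiffOn ℝ ∞ c O) (hm : MapsTo c O (strip δ)) :
    ContDiffOn ℝ ∞ (fun p => gam G (c p) (a p) (b p)) O :=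
  ((h.metric.contDiffOn_gam.comp hc hm).clm_apply ha).clm_apply hb

theorem contDiffOn_bil_apply (h : IsStripMetric G L δ K) {X : Type*} [NormedAddCommGroup X]
    [NormedSpace ℝ X] {a b c : X → Plane} {O : Set X} (ha : ContDiffOn ℝ ∞ a O)
    (hb : ContDiffOn ℝ ∞ b O) (hc : ContDiffOn ℝ ∞ c O) (hm : MapsTo c O (strip δ)) :
    ContDiffOn ℝ ∞ (fun p => bil (G (c p)) (a p) (b p)) O :=
  ((h.metric.contDiffOn_bil.comp hc hm).clm_apply ha).clm_apply hb

theorem contDiffOn_cross {X : Type*} [NormedAddCommGroup X] [NormedSpace ℝ X] {a b : X → Plane}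
    {O : Set X} (ha : ContDiffOn ℝ ∞ a O) (hb : ContDiffOn ℝ ∞ b O) :
    ContDiffOn ℝ ∞ (fun p => cross (a p) (b p)) O := by
  have hco : ∀ {a : X → Plane} (i : Fin 2), ContDiffOn ℝ ∞ a O → ContDiffOn ℝ ∞ (fun p => a p i) O :=
    fun i ha => (contDiff_coord i).comp_contDiffOn ha
  exact ((hco 0 ha).mul (hco 1 hb)).sub ((hco 1 ha).mul (hco 0 hb))

theorem pt_one_ne_zero (y : ℝ) : pt 1 y ≠ 0 := fun h => by
  have := congrArg (fun z : Plane => z 0) h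
  simp at this

theorem contDiffOn_graphFactor (h : IsStripMetric G L δ K) (hf : ContDiff ℝ ∞ f) :
    ContDiffOn ℝ ∞ (fun p : ℝ × ℝ => Real.sqrt (G (pt p.2 (p.1 * f p.2))).det /
      Real.sqrt (bil (G (pt p.2 (p.1 * f p.2))) (pt 1 (p.1 * deriv f p.2))
        (pt 1 (p.1 * deriv f p.2))) ^ 3) (graphDomain f δ) := by
  have h1 : ContDiff ℝ ∞ (deriv f) := (contDiff_infty_iff_deriv.mp hf).2
  have hv : ContDiff ℝ ∞ fun p : ℝ × ℝ => pt 1 (p.1 * deriv f p.2) :=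
    contDiff_pt contDiff_const (contDiff_fst.mul (h1.comp contDiff_snd))
  have hm : MapsTo (fun p : ℝ × ℝ => pt p.2 (p.1 * f p.2)) (graphDomain f δ) (strip δ) :=
    fun p hp => hp
  have hdet : ContDiffOn ℝ ∞ (fun z => (G z).det) (strip δ) := by
    simp only [Matrix.det_fin_two]
    exact ((h.metric.smooth 0 0).mul (h.metric.smooth 1 1)).sub
      ((h.metric.smooth 0 1).mul (h.metric.smooth 1 0))
  have hb := contDiffOn_bil_apply h hv.contDiffOn hv.contDiffOn (contDiff_graph₂ hf).contDiffOn hm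
  have hpos : ∀ p ∈ graphDomain f δ, 0 < bil (G (pt p.2 (p.1 * f p.2))) (pt 1 (p.1 * deriv f p.2))
        (pt 1 (p.1 * deriv f p.2)) := fun p hp => h.metric.pos _ hp _ (pt_one_ne_zero _)
  refine ((hdet.comp (contDiff_graph₂ hf).contDiffOn hm).sqrt fun p hp =>
    (h.metric.det_pos hp).ne').div ((hb.sqrt fun p hp => (hpos p hp).ne').pow 3) fun p hp =>
    pow_ne_zero 3 (Real.sqrt_pos.mpr (hpos p hp)).ne'

theorem contDiffOn_graphAcc (h : IsStripMetric G L δ K) (hf : ContDiff ℝ ∞ f) :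
    ContDiffOn ℝ ∞ (graphAcc G f) (graphDomain f δ) := by
  have h1 : ContDiff ℝ ∞ (deriv f) := (contDiff_infty_iff_deriv.mp hf).2
  have h2 : ContDiff ℝ ∞ (deriv (deriv f)) := (contDiff_infty_iff_deriv.mp h1).2
  have hv : ContDiff ℝ ∞ fun p : ℝ × ℝ => pt 1 (p.1 * deriv f p.2) :=
    contDiff_pt contDiff_const (contDiff_fst.mul (h1.comp contDiff_snd))
  have ha : ContDiff ℝ ∞ fun p : ℝ × ℝ => pt 0 (p.1 * deriv (deriv f) p.2) :=
    contDiff_pt contDiff_const (contDiff_fst.mul (h2.comp contDiff_snd))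
  exact ha.contDiffOn.add (contDiffOn_gam_apply h hv.contDiffOn hv.contDiffOn
    (contDiff_graph₂ hf).contDiffOn fun p hp => hp)

theorem contDiffOn_graphCurvature (h : IsStripMetric G L δ K) (hf : ContDiff ℝ ∞ f) :
    ContDiffOn ℝ ∞ (graphCurvature G f) (graphDomain f δ) := by
  have h1 : ContDiff ℝ ∞ (deriv f) := (contDiff_infty_iff_deriv.mp hf).2
  have hv : ContDiff ℝ ∞ fun p : ℝ × ℝ => pt 1 (p.1 * deriv f p.2) :=
    contDiff_pt contDiff_const (contDiff_fst.mul (h1.comp contDiff_snd))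
  refine ((contDiffOn_cross hv.contDiffOn (contDiffOn_graphAcc h hf)).mul
    (contDiffOn_graphFactor h hf)).congr fun p _ => graphCurvature_eq hf p

theorem graphAcc_zero (h : IsStripMetric G L δ K) (t : ℝ) : graphAcc G f (0, t) = 0 := by
  have : pt 1 0 = e_ 0 := by simp [pt]
  simp only [graphAcc, zero_mul, this, h.geodesic]
  simp [pt]

theorem graphCurvature_zero (h : IsStripMetric G L δ K) (hf : ContDiff ℝ ∞ f) (t : ℝ) :
    graphCurvature G f (0, t) = 0 := by
  rw [graphCurvature_eq hf, graphAcc_zero h]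
  simp [cross]

/-- The variation of the velocity does not contribute, since the Christoffel form vanishes on `e₀,
e₁`. The variation of the base point contributes `K f` through `fderiv_gam_axis`, which gives the
Jacobi operator of the axis. -/
theorem hasDerivAt_graphAcc (h : IsStripMetric G L δ K) (t : ℝ) :
    HasDerivAt (fun x => graphAcc G f (x, t)) (pt 0 (deriv (deriv f) t + K * f t)) 0 := by
  have hp1 : HasDerivAt (fun x => pt 0 (x * deriv (deriv f) t)) (pt 0 (deriv (deriv f) t)) 0 := by
    simpa using hasDerivAt_pt (hasDerivAt_const 0 0) ((hasDerivAt_id (0 : ℝ)).mul_const _)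
  have hp2 : HasDerivAt (fun x => pt 1 (x * deriv f t)) (pt 0 (deriv f t)) 0 := by
    simpa using hasDerivAt_pt (hasDerivAt_const 0 1) ((hasDerivAt_id (0 : ℝ)).mul_const _)
  have hp3 : HasDerivAt (fun x => pt t (x * f t)) (pt 0 (f t)) 0 := by
    simpa using hasDerivAt_pt (hasDerivAt_const 0 t) ((hasDerivAt_id (0 : ℝ)).mul_const _)
  have hg := hasDerivAt_comp_plane (F := Plane →L[ℝ] Plane →L[ℝ] Plane) (T := gam G)
    (c := fun x => pt t (x * f t)) (t := 0)
    (h.metric.differentiableAt_gam (by simpa using axis_mem_strip h.delta_pos t)) hp3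
  have hv := hp1.add ((hg.clm_apply hp2).clm_apply hp2)
  have e0 : pt 1 0 = e_ 0 := by simp [pt]
  have e1 : ∀ y, pt 0 y = y • e_ 1 := fun y => by simp [pt]
  refine hv.congr_deriv ?_
  simp only [zero_mul, e0, e1, map_smul, add_apply, smul_apply, h.fderiv_gam_axis, h.gam_axis,
    h.gam_axis', smul_zero, add_zero, smul_smul, ← add_smul]
  congr 1; ring

theorem hasDerivAt_graphCurvature (h : IsStripMetric G L δ K) (hf : ContDiff ℝ ∞ f) (t : ℝ) :
    HasDerivAt (fun x => graphCurvature G f (x, t)) (deriv (deriv f) t + K * f t) 0 := by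
  have hO : IsOpen (graphDomain f δ) := isOpen_graphDomain hf
  have hm : ((0 : ℝ), t) ∈ graphDomain f δ := zero_mem_graphDomain h.delta_pos t
  have hR := hasDerivAt_fst (((contDiffOn_graphFactor h hf).contDiffAt
    (hO.mem_nhds hm)).differentiableAt (by simp))
  have hw := hasDerivAt_graphAcc h (f := f) t
  have hco : ∀ i : Fin 2, HasDerivAt (fun x => graphAcc G f (x, t) i)
      (pt 0 (deriv (deriv f) t + K * f t) i) 0 := fun i =>
    (EuclideanSpace.proj i : Plane →L[ℝ] ℝ).hasFDerivAt.comp_hasDerivAt 0 hw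
  have hN : HasDerivAt (fun x => cross (pt 1 (x * deriv f t)) (graphAcc G f (x, t)))
      (deriv (deriv f) t + K * f t) 0 := by
    have h1 := (hco 1).sub (((hasDerivAt_id (0 : ℝ)).mul_const (deriv f t)).mul (hco 0))
    have h2 : (fun x => cross (pt 1 (x * deriv f t)) (graphAcc G f (x, t))) = fun x =>
        graphAcc G f (x, t) 1 - x * deriv f t * graphAcc G f (x, t) 0 := by
      funext x; simp [cross]
    rw [h2]
    refine h1.congr_deriv ?_
    simp [graphAcc_zero h]
  have := hN.mul hR
  have h2 : (fun x => graphCurvature G f (x, t)) = _ := funext fun x => graphCurvature_eq hf (x, t)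
  rw [h2]
  refine this.congr_deriv ?_
  have e0 : pt 1 0 = e_ 0 := by simp [pt]
  have e1 : bil 1 (e_ 0) (e_ 0) = 1 := (bil_single 1 0 0).trans (by simp)
  simp only [graphAcc_zero h, zero_mul, e0, h.axis, e1]
  simp [cross]

/-- If `K ≠ (2 π / L) ^ 2`, then there are graphs with exactly two vertices close to the axis. -/
theorem eventually_encard_eq_two (h : IsStripMetric G L δ K) (hK : K ≠ (2 * Real.pi / L) ^ 2) :
    ∃ f : ℝ → ℝ, ContDiff ℝ ∞ f ∧ Function.Periodic f L ∧ ∀ᶠ x in 𝓝[≠] (0 : ℝ),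
      {t ∈ Ico 0 L | deriv (geodesicCurvature G fun t => pt t (x * f t)) t = 0}.encard = 2 := by
  have hL := h.length_pos
  set l := 2 * Real.pi / L with hl
  have hlpos : 0 < l := by have := Real.pi_pos; positivity
  have hlL : l * L = 2 * Real.pi := by rw [hl]; field_simp
  have hK' : K - l ^ 2 ≠ 0 := sub_ne_zero.mpr hK
  -- The solution of `f'' + K f = cos (l t)` of period `L`; at `K = l²` there is resonance and no
  -- such solution.
  set f : ℝ → ℝ := fun t => Real.cos (l * t) / (K - l ^ 2) with hfdef
  have hlin : ∀ t : ℝ, HasDerivAt (fun t => l * t) l t := fun t => by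
    simpa using (hasDerivAt_id t).const_mul l
  have hcosd : ∀ t, HasDerivAt (fun t => Real.cos (l * t)) (-(l * Real.sin (l * t))) t := fun t =>
    (hlin t).cos.congr_deriv (by ring)
  have hsind : ∀ t, HasDerivAt (fun t => Real.sin (l * t)) (l * Real.cos (l * t)) t := fun t =>
    (hlin t).sin.congr_deriv (by ring)
  have hf : ContDiff ℝ ∞ f := (Real.contDiff_cos.comp (contDiff_const.mul contDiff_id)).div_const _
  have hfL : Function.Periodic f L := fun t => by
    simp only [hfdef, mul_add, hlL, Real.cos_add_two_pi]
  have hf1 : deriv f = fun t => -(l * Real.sin (l * t)) / (K - l ^ 2) :=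
    funext fun t => ((hcosd t).div_const _).deriv
  have hf2 : ∀ t, deriv (deriv f) t + K * f t = Real.cos (l * t) := by
    intro t
    have hd : HasDerivAt (deriv f) (-(l * (l * Real.cos (l * t))) / (K - l ^ 2)) t := by
      rw [hf1]; exact (((hsind t).const_mul l).neg).div_const _
    rw [hd.deriv]
    simp only [hfdef]
    field_simp; ring
  refine ⟨f, hf, hfL, ?_⟩
  set O := graphDomain f δ
  have hO : IsOpen O := isOpen_graphDomain hf
  have hO0 : ∀ t, ((0 : ℝ), t) ∈ O := zero_mem_graphDomain h.delta_pos
  have hOev : ∀ᶠ x in 𝓝 (0 : ℝ), ∀ t, (x, t) ∈ O := by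
    have h1 : Filter.Tendsto (fun x : ℝ => |x| * (1 / |K - l ^ 2|)) (𝓝 0) (𝓝 0) := by
      have : Continuous fun x : ℝ => |x| * (1 / |K - l ^ 2|) := continuous_abs.mul continuous_const
      simpa using this.tendsto 0
    filter_upwards [h1.eventually (gt_mem_nhds h.delta_pos)] with x hx t
    refine pt_mem_strip.mpr (lt_of_le_of_lt ?_ hx)
    rw [abs_mul, hfdef, abs_div]
    gcongr
    exact Real.abs_cos_le_one _
  have hΦ := contDiffOn_graphCurvature h hf
  have hper0 : ∀ᶠ x in 𝓝 (0 : ℝ), ∀ t, graphCurvature G f (x, t + L) = graphCurvature G f (x, t) := by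
    filter_upwards [hOev] with x hx t
    refine h.geodesicCurvature_periodic ((contDiff_graph hf x).of_le two_le_infty) (fun s => ?_) (hx t)
    rw [pt_add, hfL, add_zero]
  have h0 := hasDerivAt_graphCurvature h hf
  simp only [hf2] at h0
  set Φ₁ : ℝ × ℝ → ℝ := fun p => deriv (fun s => graphCurvature G f (p.1, s)) p.2 with hΦ₁
  have hΦ₁s : ContDiffOn ℝ ∞ Φ₁ O := by
    simpa using contDiffOn_iteratedDeriv_snd hO hΦ 1
  have h1 : ∀ t, HasDerivAt (fun x => Φ₁ (x, t)) (-(l * Real.sin (l * t))) 0 := fun t =>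
    deriv_fst_deriv_snd hO hΦ h0 (hcosd t) hO0
  have hper1 : ∀ᶠ x in 𝓝 (0 : ℝ), ∀ t, Φ₁ (x, t + L) = Φ₁ (x, t) := by
    filter_upwards [hper0] with x hx t
    simp only [hΦ₁]
    rw [← deriv_comp_add_const]
    simp only [hx]
  set Φ₂ : ℝ × ℝ → ℝ := fun p => deriv (fun s => Φ₁ (p.1, s)) p.2 with hΦ₂
  have hΦ₂s : ContDiffOn ℝ ∞ Φ₂ O := by
    simpa using contDiffOn_iteratedDeriv_snd hO hΦ₁s 1
  have h2 : ∀ t, HasDerivAt (fun x => Φ₂ (x, t)) (-(l * (l * Real.cos (l * t)))) 0 := fun t =>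
    deriv_fst_deriv_snd hO hΦ₁s h1 ((hsind t).const_mul l).neg hO0
  have hper2 : ∀ᶠ x in 𝓝 (0 : ℝ), ∀ t, Φ₂ (x, t + L) = Φ₂ (x, t) := by
    filter_upwards [hper1] with x hx t
    simp only [hΦ₂]
    rw [← deriv_comp_add_const]
    simp only [hx]
  have z0 : ∀ t, graphCurvature G f (0, t) = 0 := graphCurvature_zero h hf
  have z1 : ∀ t, Φ₁ (0, t) = 0 := fun t => by simp [hΦ₁, z0]
  have z2 : ∀ t, Φ₂ (0, t) = 0 := fun t => by simp [hΦ₂, z1]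
  -- The linear terms of `Φ₁` and `Φ₂` are `-x l sin (l t)` and `-x l² cos (l t)`. Counting zeros
  -- requires errors strictly below `|x| l / 2` for the first and at most `|x| l² / 2` for the
  -- second.
  have a1 := exists_abs_sub_le hL hO hΦ₁s hO0 hper1 z1 h1 (r := l / 4) (by positivity)
  have a2 := exists_abs_sub_le hL hO hΦ₂s hO0 hper2 z2 h2 (r := l * l / 2) (by positivity)
  have hne : ∀ᶠ x in 𝓝[≠] (0 : ℝ), x ≠ 0 := eventually_mem_nhdsWithin
  filter_upwards [hne, a1.filter_mono nhdsWithin_le_nhds, a2.filter_mono nhdsWithin_le_nhds,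
    hper1.filter_mono nhdsWithin_le_nhds, hOev.filter_mono nhdsWithin_le_nhds] with x hx b1 b2 p1 o1
  have hxpos := abs_pos.mpr hx
  have habs : |-(x * l)| = |x| * l := by rw [abs_neg, abs_mul, abs_of_pos hlpos]
  have d1 : ∀ t, HasDerivAt (fun t => Φ₁ (x, t)) (Φ₂ (x, t)) t := fun t =>
    (hasDerivAt_snd ((hΦ₁s.contDiffAt (hO.mem_nhds (o1 t))).differentiableAt
      (by simp))).differentiableAt.hasDerivAt
  have e1 : ∀ t, |Φ₁ (x, t) - -(x * l) * Real.sin (l * (t - 0))| < |-(x * l)| / 2 := by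
    intro t
    rw [habs, sub_zero]
    have := b1 t
    have e : Φ₁ (x, t) - -(x * l) * Real.sin (l * t) = Φ₁ (x, t) - x * -(l * Real.sin (l * t)) := by
      ring
    rw [e]
    nlinarith [mul_pos hxpos hlpos]
  have e2 : ∀ t, |Φ₂ (x, t) - -(x * l) * l * Real.cos (l * (t - 0))| ≤ |-(x * l)| * l / 2 := by
    intro t
    rw [habs, sub_zero]
    have := b2 t
    have e : Φ₂ (x, t) - -(x * l) * l * Real.cos (l * t) =
      Φ₂ (x, t) - x * -(l * (l * Real.cos (l * t))) := by ring
    rw [e]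
    linarith
  obtain ⟨z₁, z₂, c1, c2, c3⟩ := exists_zeros_of_near_sin hL
    (neg_ne_zero.mpr (mul_ne_zero hx hlpos.ne')) d1 p1 e1 e2
  exact encard_zeros_Ico hL c1 c2 c3

end IsStripMetric

/-! ### Transfer of the graphs to the surface. -/

section Surface
open CoordMetric IsStripMetric

theorem Function.Periodic.exists_abs_le {f : ℝ → ℝ} {L : ℝ} (hf : Function.Periodic f L)
    (hL : 0 < L) (hc : Continuous f) : ∃ C, ∀ t, |f t| ≤ C := by
  obtain ⟨C, hC⟩ := isCompact_Icc.exists_bound_of_continuousOn (s := Icc 0 L) hc.continuousOn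
  refine ⟨C, fun t => ?_⟩
  obtain ⟨s, hs, h⟩ := hf.exists_mem_Ico₀ hL t
  rw [h]
  exact hC s ⟨hs.1, hs.2.le⟩

theorem eventually_graph_mem_strip {f : ℝ → ℝ} {L r : ℝ} (hf : Function.Periodic f L)
    (hL : 0 < L) (hc : Continuous f) (hr : 0 < r) :
    ∀ᶠ x in 𝓝 (0 : ℝ), ∀ t, pt t (x * f t) ∈ strip r := by
  obtain ⟨C, hC⟩ := hf.exists_abs_le hL hc
  have h1 : Filter.Tendsto (fun x : ℝ => |x| * C) (𝓝 0) (𝓝 0) := by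
    have : Continuous fun x : ℝ => |x| * C := continuous_abs.mul continuous_const
    simpa using this.tendsto 0
  filter_upwards [h1.eventually (gt_mem_nhds hr)] with x hx t
  refine pt_mem_strip.mpr (lt_of_le_of_lt ?_ hx)
  rw [abs_mul]
  gcongr
  exact hC t

variable {M : Type*} [TopologicalSpace M] [ChartedSpace Plane M] [IsManifold (𝓡 2) ∞ M]
variable {g : Bundle.ContMDiffRiemannianMetric (𝓡 2) ∞ Plane (fun p : M => TangentSpace (𝓡 2) p)}
variable {L δ K : ℝ} {E : Plane → M} {f : ℝ → ℝ} {γ : SmoothCurve M}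

/-- The image under `E` of the graph of `x * f`. -/
def graphCurve (hE : IsStripImmersion E δ) (hf : ContDiff ℝ ∞ f) (x : ℝ)
    (hx : ∀ t, pt t (x * f t) ∈ strip δ) : SmoothCurve M :=
  ⟨fun t => E (pt t (x * f t)), fun t => (hE _ (hx t)).1.comp t
    (contMDiffAt_iff_contDiffAt.mpr (contDiff_graph hf x).contDiffAt)⟩

/-- In the chart, all `t`-derivatives of the family of curves are jointly continuous in `(x, t)`,
and at `x = 0` they are those of `γ`. The strict inequalities that hold for `γ` persist by
compactness of `S`; the centre `b` of the neighborhood may differ from `γ`. -/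
theorem eventually_mem_basicNeighborhood (hγ : IsAxisExtension γ L E) (hE : IsStripImmersion E δ)
    (hδ : 0 < δ) (hf : ContDiff ℝ ∞ f) {b : SmoothCurve M} {e : OpenPartialHomeomorph M Plane}
    {S : Set ℝ} {r : ℕ} {ρ : ℝ} (he : e ∈ IsManifold.maximalAtlas (𝓡 2) ∞ M) (hS : IsCompact S)
    (hb : MapsTo b S e.source) (hγb : γ ∈ basicNeighborhood b e S r ρ) :
    ∀ᶠ x in 𝓝 (0 : ℝ), ∀ hx : ∀ t, pt t (x * f t) ∈ strip δ,
      graphCurve hE hf x hx ∈ basicNeighborhood b e S r ρ := by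
  set O : Set (ℝ × ℝ) := graphDomain f δ ∩ (fun p => E (pt p.2 (p.1 * f p.2))) ⁻¹' e.source
  have hcont : ContinuousOn (fun p : ℝ × ℝ => E (pt p.2 (p.1 * f p.2))) (graphDomain f δ) :=
    fun p hp => (ContinuousAt.comp (f := fun p : ℝ × ℝ => pt p.2 (p.1 * f p.2))
      (hE _ hp).1.continuousAt (contDiff_graph₂ hf).continuous.continuousAt).continuousWithinAt
  have hO : IsOpen O := hcont.isOpen_inter_preimage (isOpen_graphDomain hf) e.open_source
  have hΦ : ContDiffOn ℝ ∞ (fun p : ℝ × ℝ => e (E (pt p.2 (p.1 * f p.2)))) O := fun p hp =>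
    (ContDiffAt.comp (g := e ∘ E) p (contDiffAt_chart_comp (c := E)
      (x := pt p.2 (p.1 * f p.2)) he (hE _ hp.1).1 hp.2)
      (contDiff_graph₂ hf).contDiffAt).contDiffWithinAt
  have hev : ∀ j ≤ r, ∀ᶠ x in 𝓝 (0 : ℝ), ∀ t ∈ S, (x, t) ∈ O ∧
      ‖iteratedDeriv j (fun s => e (E (pt s (x * f s)))) t - iteratedDeriv j (e ∘ b) t‖ < ρ := by
    intro j hj
    refine hS.eventually_forall_of_forall_eventually fun t ht => ?_
    have h0 : ((0 : ℝ), t) ∈ O :=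
      ⟨zero_mem_graphDomain hδ t, by simpa [hγ.axis] using (hγb t ht).1⟩
    have h1 : ContinuousAt (fun p : ℝ × ℝ =>
        iteratedDeriv j (fun s => e (E (pt s (p.1 * f s)))) p.2) (0, t) :=
      (contDiffOn_iteratedDeriv_snd hO hΦ j).continuousOn.continuousAt (hO.mem_nhds h0)
    have h2 : ContinuousAt (iteratedDeriv j (e ∘ b)) t := by
      have hbs : ContDiffAt ℝ ∞ (e ∘ b) t := contDiffAt_chart_comp he b.contMDiff.contMDiffAt (hb ht)
      have h3 := (hbs.iteratedFDeriv_right (i := j) (m := 0)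
        (by rw [zero_add]; exact_mod_cast le_top)).continuousAt
      have h4 : iteratedDeriv j (e ∘ b) = fun s => iteratedFDeriv ℝ j (e ∘ b) s fun _ => 1 := by
        funext s; rw [iteratedDeriv_eq_iteratedFDeriv]
      rw [h4]
      exact (ContinuousMultilinearMap.apply ℝ (fun _ : Fin j => ℝ) Plane
        (fun _ => (1 : ℝ))).continuous.continuousAt.comp h3
    have h5 : ContinuousAt (fun p : ℝ × ℝ => ‖iteratedDeriv j (fun s => e (E (pt s (p.1 * f s)))) p.2
        - iteratedDeriv j (e ∘ b) p.2‖) (0, t) :=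
      (h1.sub (ContinuousAt.comp (x := ((0 : ℝ), t)) (f := Prod.snd) h2 continuousAt_snd)).norm
    have h6 : ‖iteratedDeriv j (fun s => e (E (pt s ((0 : ℝ) * f s)))) t
        - iteratedDeriv j (e ∘ b) t‖ < ρ := by
      have : (fun s => e (E (pt s ((0 : ℝ) * f s)))) = e ∘ γ := by
        funext s; simp [hγ.axis]
      rw [this]
      exact (hγb t ht).2 j hj
    filter_upwards [hO.mem_nhds h0, h5.eventually (gt_mem_nhds h6)] with p a b using ⟨a, b⟩
  have hev' : ∀ᶠ x in 𝓝 (0 : ℝ), ∀ j ∈ Iic r, ∀ t ∈ S, (x, t) ∈ O ∧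
      ‖iteratedDeriv j (fun s => e (E (pt s (x * f s)))) t - iteratedDeriv j (e ∘ b) t‖ < ρ :=
    (finite_Iic r).eventually_all.mpr hev
  filter_upwards [hev'] with x hx hx' t ht
  exact ⟨(hx 0 (Nat.zero_le r) t ht).1.2, fun j hj => (hx j hj t ht).2⟩

theorem eventually_graphCurve_mem (hγ : IsAxisExtension γ L E) (hE : IsStripImmersion E δ)
    (hδ : 0 < δ) (hf : ContDiff ℝ ∞ f) {N : Set (SmoothCurve M)} (hN : IsOpen[smoothTopology M] N)
    (hγN : γ ∈ N) : ∀ᶠ x in 𝓝 (0 : ℝ), ∀ hx : ∀ t, pt t (x * f t) ∈ strip δ,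
      graphCurve hE hf x hx ∈ N := by
  induction hN with
  | basic s hs =>
    obtain ⟨b, e, S, r, ρ, he, hS, hb, -, rfl⟩ := hs
    exact eventually_mem_basicNeighborhood hγ hE hδ hf he hS hb hγN
  | univ => exact Filter.Eventually.of_forall fun x hx => mem_univ _
  | inter s t _ _ hs ht =>
    filter_upwards [hs hγN.1, ht hγN.2] with x h1 h2 hx using ⟨h1 hx, h2 hx⟩
  | sUnion 𝒮 _ ih =>
    obtain ⟨s, hs, hγs⟩ := hγN
    filter_upwards [ih s hs hγs] with x h1 hx using ⟨s, hs, h1 hx⟩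

/-- Near a closed geodesic of length `L` on a surface of constant curvature different from
`(2 π / L) ^ 2` there are closed curves with exactly two vertices. -/
theorem exists_hasOnlyTwoVertices (hγ : IsAxisExtension γ L E) (hE : IsStripImmersion E δ)
    (h : IsStripMetric (pullMatrix g E) L δ K) (hK : K ≠ (2 * Real.pi / L) ^ 2) {U : Set M}
    (hU : IsOpen U) (hγU : range γ ⊆ U) {N : Set (SmoothCurve M)} (hN : IsOpen[smoothTopology M] N)
    (hγN : γ ∈ N) : ∃ c ∈ N, range c ⊆ U ∧ IsClosedCurve c L ∧ HasOnlyTwoVertices g c L := by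
  obtain ⟨f, hf, hfL, hcard⟩ := h.eventually_encard_eq_two hK
  obtain ⟨ρ, hρ, hρU⟩ := exists_strip_of_eventually h.length_pos (P := fun z => E z ∈ U)
    (fun z => by rw [hγ.periodic]) (fun t => (hE _ (axis_mem_strip h.delta_pos t)).1.continuousAt
      |>.eventually_mem (hU.mem_nhds (by rw [hγ.axis]; exact hγU ⟨t, rfl⟩)))
  have h1 := eventually_graphCurve_mem hγ hE h.delta_pos hf hN hγN
  have h2 := eventually_graph_mem_strip hfL h.length_pos hf.continuous h.delta_pos
  have h3 := eventually_graph_mem_strip hfL h.length_pos hf.continuous hρ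
  obtain ⟨x, c0, c1, c2, c3⟩ := (hcard.and ((h1.and (h2.and h3)).filter_mono
    nhdsWithin_le_nhds)).exists
  have hgr := contDiff_graph hf x
  refine ⟨graphCurve hE hf x c2, c1 c2, ?_, ⟨fun t => ?_, fun t => ?_⟩, ?_⟩
  · rintro _ ⟨t, rfl⟩
    exact hρU _ (c3 t)
  · change E (pt (t + L) (x * f (t + L))) = E (pt t (x * f t))
    rw [hfL, ← hγ.periodic (pt t _), pt_add, add_zero]
  · refine (hE.mfderiv_ne_zero_iff (fun s => rfl) (hgr.differentiable (by simp) t) (c2 t)).mpr ?_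
    rw [deriv_graph hf]
    exact pt_one_ne_zero _
  · rw [HasOnlyTwoVertices, ← c0]
    congr 1
    ext t
    rw [mem_ofPred_eq, mem_ofPred_eq, hE.isVertex_iff (c := graphCurve hE hf x c2) (fun s => rfl)
      (hgr.of_le two_le_infty).contDiffAt (c2 t)]

end Surface

/-! ### Flat linear systems in two variables -/

section Frobenius

variable {V : Type*} [NormedAddCommGroup V] [NormedSpace ℝ V]

/-- A Gronwall estimate on a short interval: apply the mean value inequality at a point where the
norm is maximal and absorb half of that maximum by `C * d ≤ 1 / 2`. -/
theorem norm_le_of_norm_deriv_le {w w' : ℝ → V} {C d ε : ℝ} (hC : 0 ≤ C) (hε : 0 ≤ ε)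
    (hCd : C * d ≤ 1 / 2) (hw : ∀ y, |y| < d → HasDerivAt w (w' y) y)
    (hb : ∀ y, |y| < d → ‖w' y‖ ≤ C * ‖w y‖ + ε) {y : ℝ} (hy : |y| < d) :
    ‖w y‖ ≤ 2 * (‖w 0‖ + ε * d) := by
  set S := Icc (-|y|) |y|
  have hS : ∀ z ∈ S, |z| < d := fun z hz => (abs_le.mpr hz).trans_lt hy
  have h0S : (0 : ℝ) ∈ S := ⟨by simp, abs_nonneg y⟩
  have hyS : y ∈ S := ⟨neg_abs_le y, le_abs_self y⟩
  have hcont : ContinuousOn w S := fun z hz => (hw z (hS z hz)).continuousAt.continuousWithinAt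
  obtain ⟨z, hz, hmax⟩ := isCompact_Icc.exists_isMaxOn ⟨0, h0S⟩ hcont.norm
  have h1 : ∀ x ∈ S, ‖w' x‖ ≤ C * ‖w z‖ + ε := fun x hx =>
    (hb x (hS x hx)).trans (by gcongr; exact hmax hx)
  have h2 := (convex_Icc (-|y|) |y|).norm_image_sub_le_of_norm_hasDerivWithin_le
    (fun x hx => (hw x (hS x hx)).hasDerivWithinAt) h1 h0S hz
  rw [sub_zero, Real.norm_eq_abs] at h2
  have hzd : |z| ≤ d := (hS z hz).le
  have h3 : (C * ‖w z‖ + ε) * |z| ≤ ‖w z‖ / 2 + ε * d := by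
    have h4 : C * |z| ≤ 1 / 2 := (mul_le_mul_of_nonneg_left hzd hC).trans hCd
    nlinarith [norm_nonneg (w z), mul_le_mul_of_nonneg_left hzd hε]
  have h4 : ‖w z‖ ≤ ‖w 0‖ + ‖w z - w 0‖ := by
    have := norm_add_le (w 0) (w z - w 0)
    rwa [add_sub_cancel] at this
  have h5 : ‖w y‖ ≤ ‖w z‖ := hmax hyS
  linarith

/-- The length of the interval depends only on the bound `C`, not on `v`. Picard–Lindelöf is applied
on the ball of radius `‖v‖` around `v`: there the right side is at most `2 C ‖v‖`, so within time
`d` the solution cannot leave the ball. -/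
theorem exists_linear_ode [CompleteSpace V] {B : ℝ → V →L[ℝ] V} {C d : ℝ} (hd : 0 < d)
    (hB : ContinuousOn B (Icc (-d) d)) (hC : ∀ y ∈ Icc (-d) d, ‖B y‖ ≤ C) (hCd : C * d ≤ 1 / 2)
    (v : V) : ∃ α : ℝ → V, α 0 = v ∧ ∀ y, |y| < d → HasDerivAt α (B y (α y)) y := by
  have hC0 : 0 ≤ C := (norm_nonneg _).trans (hC 0 ⟨by linarith, hd.le⟩)
  have hpl : IsPicardLindelof (fun y u => B y u) (tmin := -d) (tmax := d)
      ⟨0, by linarith, hd.le⟩ v ⟨‖v‖, norm_nonneg v⟩ 0 ⟨C * (2 * ‖v‖), by positivity⟩ ⟨C, hC0⟩ := by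
    refine ⟨fun t ht => ?_, fun x _ => hB.clm_apply continuousOn_const, fun t ht x hx => ?_, ?_⟩
    · exact (((B t).lipschitz.weaken (by exact hC t ht)).lipschitzOnWith)
    · refine ((B t).le_opNorm x).trans (mul_le_mul (hC t ht) ?_ (norm_nonneg _) hC0)
      have h1 : ‖x - v‖ ≤ ‖v‖ := mem_closedBall_iff_norm.mp hx
      have h2 : ‖x‖ ≤ ‖v‖ + ‖x - v‖ := by
        have := norm_add_le v (x - v)
        rwa [add_sub_cancel] at this
      linarith
    · change C * (2 * ‖v‖) * max (d - 0) (0 - -d) ≤ ‖v‖ - 0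
      rw [sub_zero, zero_sub, neg_neg, max_self, sub_zero]
      nlinarith [norm_nonneg v]
  obtain ⟨α, h0, hα⟩ := hpl.exists_eq_forall_mem_Icc_hasDerivWithinAt₀
  refine ⟨α, h0, fun y hy => ?_⟩
  have hy' := abs_lt.mp hy
  exact (hα y ⟨hy'.1.le, hy'.2.le⟩).hasDerivAt (Icc_mem_nhds hy'.1 hy'.2)

theorem eventually_norm_sub_le {Φ : ℝ × ℝ → V} {O : Set (ℝ × ℝ)} (hO : IsOpen O)
    (h : ContDiffOn ℝ ∞ Φ O) {S : Set ℝ} (hS : IsCompact S) {x : ℝ} (hxS : ∀ y ∈ S, (x, y) ∈ O)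
    {r : ℝ} (hr : 0 < r) : ∀ᶠ s in 𝓝 (0 : ℝ), ∀ y ∈ S,
      ‖Φ (x + s, y) - Φ (x, y) - s • fderiv ℝ Φ (x, y) (1, 0)‖ ≤ r * |s| ∧
      ‖Φ (x + s, y) - Φ (x, y)‖ ≤ r := by
  have hd : ∀ p ∈ O, DifferentiableAt ℝ Φ p := fun p hp =>
    (h.contDiffAt (hO.mem_nhds hp)).differentiableAt (by simp)
  have hev : ∀ᶠ s in 𝓝 (0 : ℝ), ∀ y ∈ S, (x + s, y) ∈ O ∧
      ‖fderiv ℝ Φ (x + s, y) (1, 0) - fderiv ℝ Φ (x, y) (1, 0)‖ < r ∧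
      ‖Φ (x + s, y) - Φ (x, y)‖ < r := by
    refine hS.eventually_forall_of_forall_eventually fun y hy => ?_
    have hc : ContinuousAt (fun p => fderiv ℝ Φ p (1, 0)) (x, y) :=
      (contDiffOn_fderiv_apply hO h (1, 0)).continuousOn.continuousAt (hO.mem_nhds (hxS y hy))
    have hc' : ContinuousAt Φ (x, y) := h.continuousOn.continuousAt (hO.mem_nhds (hxS y hy))
    have hm : Filter.Tendsto (fun p : ℝ × ℝ => (x + p.1, p.2)) (𝓝 (0, y)) (𝓝 (x, y)) := by
      have : Continuous fun p : ℝ × ℝ => (x + p.1, p.2) := by fun_prop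
      simpa using this.tendsto (0, y)
    have hm' : Filter.Tendsto (fun p : ℝ × ℝ => (x, p.2)) (𝓝 (0, y)) (𝓝 (x, y)) := by
      have : Continuous fun p : ℝ × ℝ => (x, p.2) := by fun_prop
      exact this.tendsto (0, y)
    have h1 := ((hc.tendsto.comp hm).sub (hc.tendsto.comp hm')).norm
    have h2 := ((hc'.tendsto.comp hm).sub (hc'.tendsto.comp hm')).norm
    rw [sub_self, norm_zero] at h1 h2
    filter_upwards [hm.eventually (hO.mem_nhds (hxS y hy)), h1.eventually (gt_mem_nhds hr),
      h2.eventually (gt_mem_nhds hr)] with p a b c using ⟨a, b, c⟩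
  obtain ⟨ρ, hρ, hball⟩ := Metric.eventually_nhds_iff_ball.mp hev
  filter_upwards [Metric.ball_mem_nhds 0 hρ] with s hs y hy
  refine ⟨?_, (hball s hs y hy).2.2.le⟩
  have h1 : ∀ a ∈ Metric.ball (0 : ℝ) ρ, HasDerivWithinAt
      (fun a => Φ (x + a, y) - a • fderiv ℝ Φ (x, y) (1, 0))
      (fderiv ℝ Φ (x + a, y) (1, 0) - fderiv ℝ Φ (x, y) (1, 0)) (Metric.ball 0 ρ) a := by
    intro a ha
    have h2 := (hasDerivAt_fst (hd _ (hball a ha y hy).1)).comp_const_add x a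
    exact ((h2.sub ((hasDerivAt_id a).smul_const _)).congr_deriv (by simp)).hasDerivWithinAt
  have h2 := (convex_ball (0 : ℝ) ρ).norm_image_sub_le_of_norm_hasDerivWithin_le (C := r) h1
    (fun a ha => (hball a ha y hy).2.1.le) (Metric.mem_ball_self hρ) hs
  simp only [add_zero, zero_smul, sub_zero, Real.norm_eq_abs] at h2
  rwa [sub_right_comm]

/-- A periodic flat linear system `∂ₓ Φ = A Φ`, `∂ᵧ Φ = B Φ` on a strip has a solution with any
initial values on the axis which satisfy the first equation there. -/
theorem exists_solution_of_flat [CompleteSpace V] {A B : ℝ × ℝ → V →L[ℝ] V} {L δ : ℝ} (hL : 0 < L) (hδ : 0 < δ)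
    (hA : ContDiffOn ℝ ∞ A {p | |p.2| < δ}) (hB : ContDiffOn ℝ ∞ B {p | |p.2| < δ})
    (hBper : ∀ x y, |y| < δ → B (x + L, y) = B (x, y))
    (hflat : ∀ p : ℝ × ℝ, |p.2| < δ → ∀ v, ∃ b a, HasDerivAt (fun s => B (s, p.2) v) b p.1 ∧
      HasDerivAt (fun s => A (p.1, s) v) a p.2 ∧ b + B p (A p v) = a + A p (B p v))
    {Φ₀ : ℝ → V} (hΦ₀ : ∀ x, HasDerivAt Φ₀ (A (x, 0) (Φ₀ x)) x) (hper : Function.Periodic Φ₀ L) :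
    ∃ d > 0, d ≤ δ ∧ ∃ Φ : ℝ × ℝ → V, (∀ x, Φ (x, 0) = Φ₀ x) ∧
      (∀ x y, Φ (x + L, y) = Φ (x, y)) ∧ ∀ p : ℝ × ℝ, |p.2| < d →
      HasFDerivAt Φ ((ContinuousLinearMap.toSpanSingleton ℝ (A p (Φ p))).coprod
        (ContinuousLinearMap.toSpanSingleton ℝ (B p (Φ p)))) p := by
  set O : Set (ℝ × ℝ) := {p | |p.2| < δ} with hOdef
  have hO : IsOpen O := isOpen_lt continuous_snd.abs continuous_const
  set S := Icc (-(δ / 2)) (δ / 2) with hSdef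
  have hS : IsCompact S := isCompact_Icc
  have hSO : ∀ x, ∀ y ∈ S, (x, y) ∈ O := fun x y hy => by
    have : |y| ≤ δ / 2 := abs_le.mpr hy
    change |y| < δ
    linarith
  have hAd : ∀ p ∈ O, DifferentiableAt ℝ A p := fun p hp =>
    (hA.contDiffAt (hO.mem_nhds hp)).differentiableAt (by simp)
  have hBd : ∀ p ∈ O, DifferentiableAt ℝ B p := fun p hp =>
    (hB.contDiffAt (hO.mem_nhds hp)).differentiableAt (by simp)
  -- a uniform bound
  obtain ⟨C₀, hC₀⟩ := (isCompact_Icc (a := (0 : ℝ)) (b := L)).prod hS |>.exists_bound_of_continuousOn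
    (f := B) (hB.continuousOn.mono fun p hp => hSO p.1 p.2 hp.2)
  set C := max C₀ 1 with hCdef
  have hC1 : 1 ≤ C := le_max_right _ _
  have hBC' : ∀ x ∈ Icc 0 L, ∀ y ∈ S, ‖B (x, y)‖ ≤ C := fun x hx y hy =>
    (hC₀ (x, y) ⟨hx, hy⟩).trans (le_max_left _ _)
  have hBn : ∀ x y, |y| < δ → B (toIcoMod hL 0 x, y) = B (x, y) := by
    intro x y hy
    have h1 : Function.Periodic (fun x => B (x, y)) L := fun x => hBper x y hy
    have h2 := h1.sub_zsmul_eq (toIcoDiv hL 0 x) (x := x)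
    exact h2
  have hmodI : ∀ x, toIcoMod hL 0 x ∈ Icc 0 L := fun x => by
    have := toIcoMod_mem_Ico hL 0 x
    rw [zero_add] at this
    exact ⟨this.1, this.2.le⟩
  have hBC : ∀ x, ∀ y ∈ S, ‖B (x, y)‖ ≤ C := fun x y hy => by
    rw [← hBn x y (hSO x y hy)]
    exact hBC' _ (hmodI x) y hy
  -- This height serves all `x` at once, because `B` is periodic in `x` and the equation is linear.
  set d := min (δ / 2) (1 / (2 * C)) with hddef
  have hd : 0 < d := lt_min (by positivity) (by positivity)
  have hdδ : d ≤ δ / 2 := min_le_left _ _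
  have hCd : C * d ≤ 1 / 2 := by
    calc C * d ≤ C * (1 / (2 * C)) := by gcongr; exact min_le_right _ _
      _ = 1 / 2 := by field_simp
  have hdS : ∀ y, |y| < d → y ∈ S := fun y hy => abs_le.mp (hy.le.trans hdδ)
  have hyB : ∀ x, ContinuousOn (fun y => B (x, y)) S := fun x =>
    hB.continuousOn.comp (Continuous.prodMk_right x).continuousOn fun y hy => hSO x y hy
  have hdsub : Icc (-d) d ⊆ S := Icc_subset_Icc (by linarith) hdδ
  choose α hα0 hα using fun x => exists_linear_ode hd ((hyB x).mono hdsub)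
    (fun y hy => hBC x y (hdsub hy)) hCd (Φ₀ x)
  -- Each vertical line is solved from its value on the axis. Reducing `x` modulo `L` makes `Φ`
  -- periodic by construction; periodicity of `B` keeps the vertical equation intact.
  set Φ : ℝ × ℝ → V := fun p => α (toIcoMod hL 0 p.1) p.2 with hΦdef
  have hΦ0 : ∀ x, Φ (x, 0) = Φ₀ x := fun x => by
    simp only [hΦdef, hα0]
    exact hper.sub_zsmul_eq (toIcoDiv hL 0 x)
  have hΦy : ∀ x y, |y| < d → HasDerivAt (fun y => Φ (x, y)) (B (x, y) (Φ (x, y))) y := by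
    intro x y hy
    have h1 := hα (toIcoMod hL 0 x) y hy
    rw [hBn x y (hSO x y (hdS y hy))] at h1
    exact h1
  have hC0 : 0 ≤ C := by linarith
  have hbound : ∀ x y, |y| < d → ‖Φ (x, y)‖ ≤ 2 * ‖Φ₀ x‖ := by
    intro x y hy
    have := norm_le_of_norm_deriv_le (ε := 0) hC0 le_rfl hCd (hΦy x) (fun y hy => by
      rw [add_zero]
      exact ((B (x, y)).le_opNorm _).trans (by gcongr; exact hBC x y (hdS y hy))) hy
    rwa [hΦ0, zero_mul, add_zero] at this
  -- the equation in the direction of the axis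
  have hΦx : ∀ x y, |y| < d → HasDerivAt (fun x => Φ (x, y)) (A (x, y) (Φ (x, y))) x := by
    intro x y hy
    obtain ⟨a, ha⟩ := hS.exists_bound_of_continuousOn (f := fun y => A (x, y))
      (hA.continuousOn.comp (Continuous.prodMk_right x).continuousOn fun y hy => hSO x y hy)
    have ha0 : 0 ≤ a := (norm_nonneg _).trans (ha 0 ⟨by linarith, by linarith⟩)
    set m := 2 * ‖Φ₀ x‖ with hm
    have hm0 : 0 ≤ m := by positivity
    rw [hasDerivAt_iff_isLittleO_nhds_zero, Asymptotics.isLittleO_iff]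
    intro ε hε
    -- Makes the final bound `2 (r |s| + (m + a m) r |s| d)` equal to `ε |s|`.
    set r := ε / (2 * (1 + (m + a * m) * d)) with hr
    have hr0 : 0 < r := by positivity
    have e1 := eventually_norm_sub_le hO hB hS (hSO x) hr0
    have e2 := (hasDerivAt_iff_isLittleO_nhds_zero.mp (hΦ₀ x)).def hr0
    filter_upwards [e1, e2] with s hs1 hs2
    -- The remainder in the desired horizontal equation. By flatness it satisfies the vertical
    -- equation up to an error of order `r |s|`, and on the axis it is small because `Φ₀` solves the
    -- horizontal equation; the Gronwall estimate propagates this. Differentiability of solutions in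
    -- the initial data is not presupposed.
    set w : ℝ → V := fun y => Φ (x + s, y) - Φ (x, y) - s • A (x, y) (Φ (x, y)) with hw
    have hwd : ∀ y, |y| < d → HasDerivAt w (B (x + s, y) (Φ (x + s, y)) - B (x, y) (Φ (x, y)) -
        s • (fderiv ℝ A (x, y) (0, 1) (Φ (x, y)) + A (x, y) (B (x, y) (Φ (x, y))))) y := by
      intro y hy
      have h1 := (hasDerivAt_snd (hAd (x, y) (hSO x y (hdS y hy)))).clm_apply (hΦy x y hy)
      exact ((hΦy (x + s) y hy).sub (hΦy x y hy)).sub (h1.const_smul s)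
    have hwb : ∀ y, |y| < d → ‖B (x + s, y) (Φ (x + s, y)) - B (x, y) (Φ (x, y)) -
        s • (fderiv ℝ A (x, y) (0, 1) (Φ (x, y)) + A (x, y) (B (x, y) (Φ (x, y))))‖ ≤
        C * ‖w y‖ + (m + a * m) * (r * |s|) := by
      intro y hy
      have hyS := hdS y hy
      obtain ⟨b', a', hb', ha', hfl⟩ := hflat (x, y) (hSO x y hyS) (Φ (x, y))
      have hb₂ : HasDerivAt (fun s => B (s, y) (Φ (x, y))) (fderiv ℝ B (x, y) (1, 0) (Φ (x, y))) x := by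
        simpa using (hasDerivAt_fst (hBd (x, y) (hSO x y hyS))).clm_apply
          (hasDerivAt_const x (Φ (x, y)))
      have ha₂ : HasDerivAt (fun s => A (x, s) (Φ (x, y))) (fderiv ℝ A (x, y) (0, 1) (Φ (x, y))) y := by
        simpa using (hasDerivAt_snd (hAd (x, y) (hSO x y hyS))).clm_apply
          (hasDerivAt_const y (Φ (x, y)))
      rw [hb'.unique hb₂, ha'.unique ha₂] at hfl
      rw [← hfl]
      have e : B (x + s, y) (Φ (x + s, y)) - B (x, y) (Φ (x, y)) -
          s • (fderiv ℝ B (x, y) (1, 0) (Φ (x, y)) + B (x, y) (A (x, y) (Φ (x, y)))) =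
          B (x + s, y) (w y) + ((B (x + s, y) - B (x, y) - s • fderiv ℝ B (x, y) (1, 0)) (Φ (x, y))
          + s • (B (x + s, y) - B (x, y)) (A (x, y) (Φ (x, y)))) := by
        simp only [hw, map_sub, map_smul, sub_apply, smul_apply, smul_add, smul_sub]
        abel
      rw [e]
      have n1 : ‖B (x + s, y) (w y)‖ ≤ C * ‖w y‖ :=
        ((B (x + s, y)).le_opNorm _).trans (by gcongr; exact hBC _ y hyS)
      have n2 : ‖(B (x + s, y) - B (x, y) - s • fderiv ℝ B (x, y) (1, 0)) (Φ (x, y))‖ ≤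
          r * |s| * m := (ContinuousLinearMap.le_opNorm _ _).trans
        (mul_le_mul (hs1 y hyS).1 (hbound x y hy) (norm_nonneg _) (by positivity))
      have n3 : ‖A (x, y) (Φ (x, y))‖ ≤ a * m := (ContinuousLinearMap.le_opNorm _ _).trans
        (mul_le_mul (ha y hyS) (hbound x y hy) (norm_nonneg _) ha0)
      have n4 : ‖s • (B (x + s, y) - B (x, y)) (A (x, y) (Φ (x, y)))‖ ≤ |s| * (r * (a * m)) := by
        rw [norm_smul, Real.norm_eq_abs]
        gcongr
        exact (ContinuousLinearMap.le_opNorm _ _).trans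
          (mul_le_mul (hs1 y hyS).2 n3 (norm_nonneg _) hr0.le)
      refine (norm_add_le _ _).trans (add_le_add n1 ((norm_add_le _ _).trans ?_))
      linarith
    have hmain := norm_le_of_norm_deriv_le hC0 (by positivity) hCd hwd hwb hy
    have hw0 : ‖w 0‖ ≤ r * |s| := by
      simp only [hw, hΦ0]
      simpa using hs2
    refine hmain.trans ?_
    rw [Real.norm_eq_abs]
    have : ε = r * (2 * (1 + (m + a * m) * d)) := by rw [hr]; field_simp
    rw [this]
    nlinarith
  refine ⟨d, hd, by linarith, Φ, hΦ0, fun x y => by simp [hΦdef], fun p hp => ?_⟩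
  have hΩ : IsOpen {p : ℝ × ℝ | |p.2| < d} := isOpen_lt continuous_snd.abs continuous_const
  have hcontAt : ∀ q : ℝ × ℝ, |q.2| < d → ContinuousAt Φ q := by
    rintro ⟨x, y⟩ hq
    rw [Metric.continuousAt_iff']
    intro ε hε
    have hev1 : ∀ᶠ q : ℝ × ℝ in 𝓝 (x, y), ‖Φ (q.1, y) - Φ (x, y)‖ < ε / 2 := by
      have h1 : ContinuousAt (fun q : ℝ × ℝ => Φ (q.1, y)) (x, y) :=
        ContinuousAt.comp (x := (x, y)) (f := Prod.fst) (g := fun x => Φ (x, y))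
          (hΦx x y hq).continuousAt continuousAt_fst
      have := Metric.continuousAt_iff'.mp h1 (ε / 2) (half_pos hε)
      simpa [dist_eq_norm] using this
    have hev2 : ∀ᶠ q : ℝ × ℝ in 𝓝 (x, y), C * (2 * ‖Φ₀ q.1‖) * |q.2 - y| < ε / 2 := by
      have h0 : Continuous Φ₀ := continuous_iff_continuousAt.mpr fun x => (hΦ₀ x).continuousAt
      have h1 : Continuous fun q : ℝ × ℝ => C * (2 * ‖Φ₀ q.1‖) * |q.2 - y| := by fun_prop
      refine h1.continuousAt.eventually (gt_mem_nhds ?_)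
      simpa using hε
    filter_upwards [hev1, hev2, hΩ.mem_nhds hq] with q h1 h2 h3
    have h4 : ‖Φ q - Φ (q.1, y)‖ ≤ C * (2 * ‖Φ₀ q.1‖) * |q.2 - y| := by
      have hconv : Convex ℝ (Ioo (-d) d) := convex_Ioo _ _
      have := hconv.norm_image_sub_le_of_norm_hasDerivWithin_le (f := fun y => Φ (q.1, y))
        (C := C * (2 * ‖Φ₀ q.1‖)) (fun z hz => (hΦy q.1 z (abs_lt.mpr hz)).hasDerivWithinAt)
        (fun z hz => (ContinuousLinearMap.le_opNorm _ _).trans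
          (mul_le_mul (hBC _ z (hdS z (abs_lt.mpr hz))) (hbound _ z (abs_lt.mpr hz))
            (norm_nonneg _) hC0)) (abs_lt.mp hq) (abs_lt.mp h3)
      simpa [Real.norm_eq_abs] using this
    rw [dist_eq_norm]
    calc ‖Φ q - Φ (x, y)‖ ≤ ‖Φ q - Φ (q.1, y)‖ + ‖Φ (q.1, y) - Φ (x, y)‖ := norm_sub_le_norm_sub_add_norm_sub _ _ _
      _ < ε := by linarith
  have hdO : ∀ q : ℝ × ℝ, |q.2| < d → q ∈ O := fun q hq => hSO q.1 q.2 (hdS _ hq)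
  have hcA : ContinuousAt (fun q => ContinuousLinearMap.toSpanSingleton ℝ (A q (Φ q))) p := by
    have h1 := ((hA.continuousOn.continuousAt (hO.mem_nhds (hdO p hp))).clm_apply (hcontAt p hp))
    exact (ContinuousLinearMap.toSpanSingletonCLE (𝕜 := ℝ) (E := V)).continuous.continuousAt.comp h1
  have hcB : ContinuousAt (fun q => ContinuousLinearMap.toSpanSingleton ℝ (B q (Φ q))) p := by
    have h1 := ((hB.continuousOn.continuousAt (hO.mem_nhds (hdO p hp))).clm_apply (hcontAt p hp))
    exact (ContinuousLinearMap.toSpanSingletonCLE (𝕜 := ℝ) (E := V)).continuous.continuousAt.comp h1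
  -- Both partial derivatives exist and are continuous, hence `Φ` is differentiable.
  have := hasStrictFDerivAt_uncurry_coprod (u := p) (f := fun x y => Φ (x, y))
    (f₁ := fun x y => ContinuousLinearMap.toSpanSingleton ℝ (A (x, y) (Φ (x, y))))
    (f₂ := fun x y => ContinuousLinearMap.toSpanSingleton ℝ (B (x, y) (Φ (x, y))))
    (by filter_upwards [hΩ.mem_nhds hp] with q hq using (hΦx q.1 q.2 hq).hasFDerivAt)
    (by filter_upwards [hΩ.mem_nhds hp] with q hq using (hΦy q.1 q.2 hq).hasFDerivAt)
    hcA hcB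
  exact this.hasFDerivAt

end Frobenius

/-! ### The equation `∇ df = -K f g` as a flat connection. -/

namespace CoordMetric

variable {G : Plane → Matrix (Fin 2) (Fin 2) ℝ} {O : Set Plane} {K : ℝ}

/-- The connection on pairs `(f, η)` of a number and a covector whose parallel sections are the
solutions of `∇ df = - K f g`. -/
def conn (G : Plane → Matrix (Fin 2) (Fin 2) ℝ) (K : ℝ) (z u : Plane) :
    (ℝ × (Plane →L[ℝ] ℝ)) →L[ℝ] (ℝ × (Plane →L[ℝ] ℝ)) :=
  (ContinuousLinearMap.inl ℝ ℝ (Plane →L[ℝ] ℝ)).comp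
    ((ContinuousLinearMap.apply ℝ ℝ u).comp (ContinuousLinearMap.snd ℝ ℝ (Plane →L[ℝ] ℝ))) +
  (ContinuousLinearMap.inr ℝ ℝ (Plane →L[ℝ] ℝ)).comp
    (((ContinuousLinearMap.compL ℝ Plane Plane ℝ).flip (gam G z u)).comp
      (ContinuousLinearMap.snd ℝ ℝ (Plane →L[ℝ] ℝ)) -
    K • (ContinuousLinearMap.toSpanSingleton ℝ (bil (G z) u)).comp
      (ContinuousLinearMap.fst ℝ ℝ (Plane →L[ℝ] ℝ)))

theorem conn_apply (z u : Plane) (v : ℝ × (Plane →L[ℝ] ℝ)) :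
    conn G K z u v = (v.2 u, v.2.comp (gam G z u) - (K * v.1) • bil (G z) u) := by
  simp [conn, mul_smul]

theorem MetricOn.contDiffOn_conn (hG : MetricOn G O) (u : Plane) :
    ContDiffOn ℝ ∞ (fun z => conn G K z u) O := by
  have hg : ContDiffOn ℝ ∞ (fun z => gam G z u) O := hG.contDiffOn_gam.clm_apply contDiffOn_const
  have hb : ContDiffOn ℝ ∞ (fun z => bil (G z) u) O := hG.contDiffOn_bil.clm_apply contDiffOn_const
  have h1 := ((ContinuousLinearMap.compL ℝ Plane Plane ℝ).flip.contDiff.comp_contDiffOn hg).clm_comp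
    (contDiffOn_const (c := ContinuousLinearMap.snd ℝ ℝ (Plane →L[ℝ] ℝ)))
  have h2 := ((ContinuousLinearMap.toSpanSingletonCLE (𝕜 := ℝ)
    (E := Plane →L[ℝ] ℝ)).contDiff.comp_contDiffOn hb).clm_comp
    (contDiffOn_const (c := ContinuousLinearMap.fst ℝ ℝ (Plane →L[ℝ] ℝ)))
  exact contDiffOn_const.add ((contDiffOn_const
    (c := ContinuousLinearMap.inr ℝ ℝ (Plane →L[ℝ] ℝ))).clm_comp (h1.sub (h2.const_smul K)))

theorem MetricOn.hasDerivAt_conn (hG : MetricOn G O) {c : ℝ → Plane} {t : ℝ} {u : Plane}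
    (hx : c t ∈ O) (hc : HasDerivAt c u t) (w : Plane) (v : ℝ × (Plane →L[ℝ] ℝ)) :
    HasDerivAt (fun s => (conn G K (c s) w v).1) 0 t ∧
    HasDerivAt (fun s => (conn G K (c s) w v).2) (v.2.comp (fderiv ℝ (gam G) (c t) u w) -
      (K * v.1) • fderiv ℝ (fun x => bil (G x)) (c t) u w) t := by
  simp only [conn_apply]
  have hg := (hasDerivAt_comp_plane (F := Plane →L[ℝ] Plane →L[ℝ] Plane) (T := gam G)
    (hG.differentiableAt_gam hx) hc).clm_apply (hasDerivAt_const t w)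
  have hb := (hasDerivAt_comp_plane (F := Plane →L[ℝ] Plane →L[ℝ] ℝ) (T := fun x => bil (G x))
    (hG.differentiableAt_bil hx) hc).clm_apply (hasDerivAt_const t w)
  rw [map_zero, add_zero] at hg hb
  exact ⟨hasDerivAt_const t _,
    (((ContinuousLinearMap.compL ℝ Plane Plane ℝ v.2).hasFDerivAt.comp_hasDerivAt t hg).sub
      (hb.const_smul (K * v.1)))⟩

/-- In the function component only the symmetry of the Christoffel form and of the metric is used.
In the covector component the curvature term `η(R(u, w)z)` equals `K (g(w, z) η(u) - g(u, z) η(w))`,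
which is cancelled by the terms coming from `-K f g` since the metric is parallel. -/
theorem MetricOn.conn_flat (hG : MetricOn G O) {x : Plane} (hx : x ∈ O)
    (hK : gaussCurvature G x = K) (u w : Plane) (v : ℝ × (Plane →L[ℝ] ℝ)) :
    (0, v.2.comp (fderiv ℝ (gam G) x u w) -
      (K * v.1) • fderiv ℝ (fun x => bil (G x)) x u w) + conn G K x w (conn G K x u v) =
    (0, v.2.comp (fderiv ℝ (gam G) x w u) -
      (K * v.1) • fderiv ℝ (fun x => bil (G x)) x w u) + conn G K x u (conn G K x w v) := by
  refine Prod.ext ?_ (ContinuousLinearMap.ext fun z => ?_)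
  · simp only [conn_apply, Prod.fst_add, sub_apply, ContinuousLinearMap.comp_apply, smul_apply,
      smul_eq_mul]
    rw [hG.gam_symm hx u w, hG.bil_symm hx u w]
  · simp only [conn_apply, Prod.snd_add, sub_apply, add_apply, ContinuousLinearMap.comp_apply,
      smul_apply, smul_eq_mul]
    have h1 := congrArg v.2 (hG.curv_eq hx u w z)
    rw [curv, hK] at h1
    simp only [map_add, map_sub, map_smul, smul_eq_mul] at h1
    have h2 := hG.compat hx u w z
    have h3 := hG.compat hx w u z
    have h4 := hG.gam_symm hx u w
    rw [h4] at h2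
    have h5 := hG.bil_symm hx w (gam G x u z)
    have h6 := hG.bil_symm hx u (gam G x w z)
    linear_combination h1 - K * v.1 * (h2 - h3)

end CoordMetric

/-! ### Solutions of the Hessian equation with prescribed values on the axis. -/

namespace IsStripMetric
open CoordMetric

variable {G : Plane → Matrix (Fin 2) (Fin 2) ℝ} {L δ K : ℝ}

theorem pt_add_period (x y L : ℝ) : pt (x + L) y = pt x y + pt L 0 := by rw [pt_add, add_zero]

/-- The connection in the coordinates `(x, y)`. -/
def connField (G : Plane → Matrix (Fin 2) (Fin 2) ℝ) (K : ℝ) (u : Plane) (p : ℝ × ℝ) :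
    (ℝ × (Plane →L[ℝ] ℝ)) →L[ℝ] (ℝ × (Plane →L[ℝ] ℝ)) :=
  conn G K (pt p.1 p.2) u

theorem contDiffOn_connField (h : IsStripMetric G L δ K) (u : Plane) :
    ContDiffOn ℝ ∞ (connField G K u) {p | |p.2| < δ} :=
  (h.metric.contDiffOn_conn u).comp (contDiff_pt contDiff_fst contDiff_snd).contDiffOn
    fun _ hp => pt_mem_strip.mpr hp

theorem connField_periodic (h : IsStripMetric G L δ K) (u : Plane) {x y : ℝ} (hy : |y| < δ) :
    connField G K u (x + L, y) = connField G K u (x, y) := by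
  have h1 : pt x y ∈ strip δ := pt_mem_strip.mpr hy
  refine ContinuousLinearMap.ext fun v => ?_
  rw [connField, connField, conn_apply, conn_apply, pt_add_period, h.gam_periodic h1,
    h.periodic _ h1]

theorem connField_flat (h : IsStripMetric G L δ K) {p : ℝ × ℝ} (hp : |p.2| < δ)
    (v : ℝ × (Plane →L[ℝ] ℝ)) : ∃ b a,
      HasDerivAt (fun s => connField G K (e_ 1) (s, p.2) v) b p.1 ∧
      HasDerivAt (fun s => connField G K (e_ 0) (p.1, s) v) a p.2 ∧
      b + connField G K (e_ 1) p (connField G K (e_ 0) p v) =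
      a + connField G K (e_ 0) p (connField G K (e_ 1) p v) := by
  have hm : pt p.1 p.2 ∈ strip δ := pt_mem_strip.mpr hp
  have hx : HasDerivAt (fun s => pt s p.2) (e_ 0) p.1 := by
    simpa [pt] using hasDerivAt_pt (hasDerivAt_id p.1) (hasDerivAt_const p.1 p.2)
  have hy : HasDerivAt (fun s => pt p.1 s) (e_ 1) p.2 := by
    simpa [pt] using hasDerivAt_pt (hasDerivAt_const p.2 p.1) (hasDerivAt_id p.2)
  have h1 := h.metric.hasDerivAt_conn (K := K) (t := p.1) (c := fun s => pt s p.2) hm hx (e_ 1) v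
  have h2 := h.metric.hasDerivAt_conn (K := K) (t := p.2) (c := fun s => pt p.1 s) hm hy (e_ 0) v
  exact ⟨_, _, h1.1.prodMk h1.2, h2.1.prodMk h2.2,
    h.metric.conn_flat hm (h.curvature _ hm) (e_ 0) (e_ 1) v⟩

/-- The initial covector is chosen without normal component. As the Christoffel form vanishes on
`e₀, e₀` and `e₀, e₁`, parallelism along the axis is just `F'' = -K F`. -/
theorem hasDerivAt_axis_data (h : IsStripMetric G L δ K) {F F' : ℝ → ℝ}
    (hF : ∀ x, HasDerivAt F (F' x) x) (hF' : ∀ x, HasDerivAt F' (-(K * F x)) x) (x : ℝ) :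
    HasDerivAt (fun x => (F x, F' x • (EuclideanSpace.proj 0 : Plane →L[ℝ] ℝ)))
      (connField G K (e_ 0) (x, 0) (F x, F' x • (EuclideanSpace.proj 0 : Plane →L[ℝ] ℝ))) x := by
  have h1 : HasDerivAt (fun x => (F x, F' x • (EuclideanSpace.proj 0 : Plane →L[ℝ] ℝ)))
      (F' x, -(K * F x) • (EuclideanSpace.proj 0 : Plane →L[ℝ] ℝ)) x :=
    (hF x).prodMk ((hF' x).smul_const (EuclideanSpace.proj 0 : Plane →L[ℝ] ℝ))
  refine h1.congr_deriv ?_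
  rw [connField, conn_apply]
  refine Prod.ext ?_ (ContinuousLinearMap.ext fun w => ?_)
  · simp
  · have h2 : gam G (pt x 0) (e_ 0) w = 0 := by
      rw [eq_smul_add_smul w, map_add, map_smul, map_smul, h.geodesic, h.gam_axis]
      simp
    simp only [sub_apply, smul_apply, ContinuousLinearMap.comp_apply, h2, h.bil_axis]
    simp

/-- On a strip of constant curvature `K` the equation `∇ df = - K f g` has a solution with given
values on the axis, as soon as these solve `F'' = - K F`. -/
theorem exists_isHessianSolution (h : IsStripMetric G L δ K) {F F' : ℝ → ℝ}
    (hF : ∀ x, HasDerivAt F (F' x) x) (hF' : ∀ x, HasDerivAt F' (-(K * F x)) x)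
    (hFL : Function.Periodic F L) (hFL' : Function.Periodic F' L) :
    ∃ d > 0, d ≤ δ ∧ ∃ (f : Plane → ℝ) (η : Plane → Plane →L[ℝ] ℝ),
      IsHessianSolution G (strip d) K f η ∧
      (∀ z, f (z + pt L 0) = f z) ∧ (∀ z, η (z + pt L 0) = η z) ∧
      (∀ x, f (pt x 0) = F x) ∧ ∀ x, η (pt x 0) (e_ 0) = F' x := by
  set p₀ : Plane →L[ℝ] ℝ := EuclideanSpace.proj 0 with hp₀
  have hinitL : Function.Periodic (fun x => (F x, F' x • p₀)) L := fun x => by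
    simp only [hFL x, hFL' x]
  obtain ⟨d, hd, hdδ, Φ, hΦ0, hΦL, hΦ⟩ := exists_solution_of_flat h.length_pos h.delta_pos 
    (contDiffOn_connField h (e_ 0)) (contDiffOn_connField h (e_ 1))
    (fun x y => connField_periodic h (e_ 1)) (fun p => connField_flat h)
    (hasDerivAt_axis_data h hF hF') hinitL
  set P : Plane →L[ℝ] ℝ × ℝ := (EuclideanSpace.proj 0 : Plane →L[ℝ] ℝ).prod
    (EuclideanSpace.proj 1 : Plane →L[ℝ] ℝ) with hP
  have hPz : ∀ z, P z = (z 0, z 1) := fun z => rfl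
  have hD : ∀ z ∈ strip d, ∃ T : Plane →L[ℝ] ℝ × (Plane →L[ℝ] ℝ),
      HasFDerivAt (fun z => Φ (P z)) T z ∧ ∀ u, T u = conn G K z u (Φ (P z)) := by
    intro z hz
    refine ⟨_, (hΦ (P z) hz).comp z P.hasFDerivAt, fun u => ?_⟩
    have hz' : pt (P z).1 (P z).2 = z := pt_eta z
    have hPu0 : (P u).1 = u 0 := rfl
    have hPu1 : (P u).2 = u 1 := rfl
    rw [ContinuousLinearMap.comp_apply, ContinuousLinearMap.coprod_apply]
    simp only [ContinuousLinearMap.toSpanSingleton_apply, connField, hz', conn_apply]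
    conv_rhs => rw [eq_smul_add_smul u]
    refine Prod.ext ?_ (ContinuousLinearMap.ext fun w => ?_)
    · simp [hPu0, hPu1]
    · simp only [Prod.snd_add, Prod.smul_snd, add_apply, sub_apply, smul_apply, map_add, map_smul,
        ContinuousLinearMap.comp_apply, smul_eq_mul, hPu0, hPu1]
      ring
  choose! T hT hTu using hD
  have hη : ∀ z ∈ strip d, HasFDerivAt (fun z => (Φ (P z)).2)
      ((ContinuousLinearMap.snd ℝ ℝ (Plane →L[ℝ] ℝ)).comp (T z)) z := fun z hz => (hT z hz).snd
  refine ⟨d, hd, hdδ, fun z => (Φ (P z)).1, fun z => (Φ (P z)).2, ⟨fun z hz => ?_,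
    fun z hz => (hη z hz).differentiableAt, fun z hz u w => ?_⟩, fun z => ?_, fun z => ?_,
    fun x => ?_, fun x => ?_⟩
  · refine (hT z hz).fst.congr_fderiv ?_
    ext1 u
    simp [hTu z hz, conn_apply]
  · rw [(hη z hz).fderiv]
    simp [hTu z hz, conn_apply]
  · have : P (z + pt L 0) = ((P z).1 + L, (P z).2) := by simp [hPz]
    simp only [this, hΦL]
  · have : P (z + pt L 0) = ((P z).1 + L, (P z).2) := by simp [hPz]
    simp only [this, hΦL]
  · simp [hPz, hΦ0]
  · simp [hPz, hΦ0]

end IsStripMetric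

/-! ### Sign changes of periodic functions with two critical points. -/

section RealAnalysis

theorem pos_or_neg_of_ne_zero {f : ℝ → ℝ} {a b : ℝ} (hf : Continuous f)
    (h : ∀ t ∈ Ioo a b, f t ≠ 0) : (∀ t ∈ Ioo a b, 0 < f t) ∨ ∀ t ∈ Ioo a b, f t < 0 := by
  by_contra hc
  push Not at hc
  obtain ⟨⟨x, hx, hx0⟩, y, hy, hy0⟩ := hc
  obtain ⟨z, hz, hz0⟩ := isPreconnected_Ioo.intermediate_value hx hy hf.continuousOn ⟨hx0, hy0⟩
  exact h z hz hz0

theorem lt_of_hasDerivAt_pos {f f' : ℝ → ℝ} {a b : ℝ} (hab : a < b)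
    (hf : ∀ t, HasDerivAt f (f' t) t) (h : ∀ t ∈ Ioo a b, 0 < f' t) : f a < f b := by
  have hc : Continuous f := continuous_iff_continuousAt.mpr fun t => (hf t).continuousAt
  refine strictMonoOn_of_deriv_pos (convex_Icc a b) hc.continuousOn (fun t ht => ?_)
    (left_mem_Icc.mpr hab.le) (right_mem_Icc.mpr hab.le) hab
  rw [interior_Icc] at ht
  rw [(hf t).deriv]
  exact h t ht

theorem exists_zero_Ioo {f f' : ℝ → ℝ} {a b : ℝ} (hab : a < b)
    (hf : ∀ t, HasDerivAt f (f' t) t) (h : f a = f b) : ∃ t ∈ Ioo a b, f' t = 0 := by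
  have hc : Continuous f := continuous_iff_continuousAt.mpr fun t => (hf t).continuousAt
  exact exists_hasDerivAt_eq_zero hab hc.continuousOn h fun t _ => hf t

/-- Pigeonhole: two of the three points would be congruent modulo `L`, yet they are less than `L`
apart. -/
theorem false_of_three_zeros {L z₁ z₂ a b c : ℝ} (hL : 0 < L) {P : ℝ → Prop}
    (hP : ∀ t, P t → (∃ n : ℤ, t = z₁ + n * L) ∨ ∃ n : ℤ, t = z₂ + n * L)
    (hab : a < b) (hbc : b < c) (hca : c < a + L) (ha : P a) (hb : P b) (hc : P c) : False := by
  have key : ∀ {z x y : ℝ}, x < y → y < x + L → (∃ n : ℤ, x = z + n * L) →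
      (∃ n : ℤ, y = z + n * L) → False := by
    rintro z x y hxy hyx ⟨n, rfl⟩ ⟨m, rfl⟩
    have h1 : (n : ℝ) < m := by
      by_contra h; push Not at h
      nlinarith
    have h2 : (m : ℝ) < n + 1 := by
      by_contra h; push Not at h
      nlinarith
    have h3 : n < m := by exact_mod_cast h1
    have h4 : m < n + 1 := by exact_mod_cast h2
    omega
  rcases hP a ha with h1 | h1 <;> rcases hP b hb with h2 | h2 <;> rcases hP c hc with h3 | h3
  · exact key hab (by linarith) h1 h2
  · exact key hab (by linarith) h1 h2
  · exact key (hab.trans hbc) hca h1 h3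
  · exact key hbc (by linarith) h2 h3
  · exact key hbc (by linarith) h2 h3
  · exact key (hab.trans hbc) hca h1 h3
  · exact key hab (by linarith) h1 h2
  · exact key hab (by linarith) h1 h2

/-- A periodic function which vanishes at two points and whose derivative has only two zeros in a
period changes sign exactly at these two points. -/
theorem sign_of_two_critical {L z₁ z₂ t₁ t₂ : ℝ} (hL : 0 < L) {h h' : ℝ → ℝ}
    (hd : ∀ t, HasDerivAt h (h' t) t) (hper : Function.Periodic h L)
    (hz : ∀ t, h' t = 0 → (∃ n : ℤ, t = z₁ + n * L) ∨ ∃ n : ℤ, t = z₂ + n * L)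
    (h12 : t₁ < t₂) (h21 : t₂ < t₁ + L) (h1 : h t₁ = 0) (h2 : h t₂ = 0) :
    ((∀ t ∈ Ioo t₁ t₂, 0 < h t) ∧ ∀ t ∈ Ioo t₂ (t₁ + L), h t < 0) ∨
    ((∀ t ∈ Ioo t₁ t₂, h t < 0) ∧ ∀ t ∈ Ioo t₂ (t₁ + L), 0 < h t) := by
  have hc : Continuous h := continuous_iff_continuousAt.mpr fun t => (hd t).continuousAt
  have h3 : h (t₁ + L) = 0 := (hper t₁).trans h1
  obtain ⟨a, ha, ha0⟩ := exists_zero_Ioo h12 hd (h1.trans h2.symm)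
  obtain ⟨b, hb, hb0⟩ := exists_zero_Ioo h21 hd (h2.trans h3.symm)
  -- By Rolle a further zero within a period would produce three zeros of `h'`.
  have hne1 : ∀ t ∈ Ioo t₁ t₂, h t ≠ 0 := by
    intro s hs hs0
    obtain ⟨x, hx, hx0⟩ := exists_zero_Ioo hs.1 hd (h1.trans hs0.symm)
    obtain ⟨y, hy, hy0⟩ := exists_zero_Ioo hs.2 hd (hs0.trans h2.symm)
    exact false_of_three_zeros hL hz (hx.2.trans hy.1) (hy.2.trans hb.1)
      (by linarith [hb.2, hx.1]) hx0 hy0 hb0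
  have hne2 : ∀ t ∈ Ioo t₂ (t₁ + L), h t ≠ 0 := by
    intro s hs hs0
    obtain ⟨x, hx, hx0⟩ := exists_zero_Ioo hs.1 hd (h2.trans hs0.symm)
    obtain ⟨y, hy, hy0⟩ := exists_zero_Ioo hs.2 hd (hs0.trans h3.symm)
    exact false_of_three_zeros hL hz (ha.2.trans hx.1) (hx.2.trans hy.1)
      (by linarith [hy.2, ha.1]) ha0 hx0 hy0
  have hcover : ∀ t, ∃ s ∈ Icc t₁ (t₁ + L), h t = h s := fun t => by
    obtain ⟨s, hs, e⟩ := hper.exists_mem_Ico hL t t₁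
    exact ⟨s, ⟨hs.1, hs.2.le⟩, e⟩
  -- Without a sign change the zeros `t₁` and `t₂` would be extrema, hence critical, and with the
  -- Rolle point `a` between them there would be three critical points.
  have hcrit : (∀ t, 0 ≤ h t) ∨ (∀ t, h t ≤ 0) → False := by
    intro hs
    have hext : ∀ t, h t = 0 → h' t = 0 := by
      intro t ht
      rcases hs with hs | hs
      · exact IsLocalMin.hasDerivAt_eq_zero (Filter.Eventually.of_forall fun s => by
          rw [ht]; exact hs s) (hd t)
      · exact IsLocalMax.hasDerivAt_eq_zero (Filter.Eventually.of_forall fun s => by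
          rw [ht]; exact hs s) (hd t)
    exact false_of_three_zeros hL hz ha.1 ha.2 h21 (hext _ h1) ha0 (hext _ h2)
  have hsplit : ∀ s ∈ Icc t₁ (t₁ + L), s = t₁ ∨ s ∈ Ioo t₁ t₂ ∨ s = t₂ ∨ s ∈ Ioo t₂ (t₁ + L) ∨
      s = t₁ + L := by
    intro s hs
    rcases eq_or_lt_of_le hs.1 with e | e
    · exact Or.inl e.symm
    rcases lt_trichotomy s t₂ with e' | e' | e'
    · exact Or.inr (Or.inl ⟨e, e'⟩)
    · exact Or.inr (Or.inr (Or.inl e'))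
    rcases eq_or_lt_of_le hs.2 with e'' | e''
    · exact Or.inr (Or.inr (Or.inr (Or.inr e'')))
    · exact Or.inr (Or.inr (Or.inr (Or.inl ⟨e', e''⟩)))
  rcases pos_or_neg_of_ne_zero hc hne1 with p1 | p1 <;>
    rcases pos_or_neg_of_ne_zero hc hne2 with p2 | p2
  · exfalso
    refine hcrit (Or.inl fun t => ?_)
    obtain ⟨s, hs, e⟩ := hcover t
    rw [e]
    rcases hsplit s hs with rfl | hs | rfl | hs | rfl
    exacts [h1.ge, (p1 s hs).le, h2.ge, (p2 s hs).le, h3.ge]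
  · exact Or.inl ⟨p1, p2⟩
  · exact Or.inr ⟨p1, p2⟩
  · exfalso
    refine hcrit (Or.inr fun t => ?_)
    obtain ⟨s, hs, e⟩ := hcover t
    rw [e]
    rcases hsplit s hs with rfl | hs | rfl | hs | rfl
    exacts [h1.le, (p1 s hs).le, h2.le, (p2 s hs).le, h3.le]

/-- A weighted integral of the derivative of a periodic function with only two critical points
cannot vanish if the weight changes sign exactly at these points. -/
theorem false_of_two_critical {L t₁ t₂ : ℝ} {k k' h Θ : ℝ → ℝ}
    (hk : ∀ t, HasDerivAt k (k' t) t) (hk' : Continuous k') (hkL : Function.Periodic k L)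
    (hΘ : ∀ t, HasDerivAt Θ (k' t * h t) t) (hΘL : Function.Periodic Θ L)
    (h12 : t₁ < t₂) (h21 : t₂ < t₁ + L) (hk1 : ∀ t ∈ Ioo t₁ t₂, k' t ≠ 0)
    (hk2 : ∀ t ∈ Ioo t₂ (t₁ + L), k' t ≠ 0)
    (hh : ((∀ t ∈ Ioo t₁ t₂, 0 < h t) ∧ ∀ t ∈ Ioo t₂ (t₁ + L), h t < 0) ∨
    ((∀ t ∈ Ioo t₁ t₂, h t < 0) ∧ ∀ t ∈ Ioo t₂ (t₁ + L), 0 < h t)) : False := by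
  have hpos : ∀ {f f' : ℝ → ℝ}, (∀ t, HasDerivAt f (f' t) t) → Function.Periodic f L →
      (∀ t ∈ Ioo t₁ t₂, 0 < f' t) → (∀ t ∈ Ioo t₂ (t₁ + L), 0 < f' t) → False := by
    intro f f' hf hfL a b
    have e1 := lt_of_hasDerivAt_pos h12 hf a
    have e2 := lt_of_hasDerivAt_pos h21 hf b
    rw [hfL] at e2
    linarith
  have hneg : ∀ {f f' : ℝ → ℝ}, (∀ t, HasDerivAt f (f' t) t) → Function.Periodic f L →
      (∀ t ∈ Ioo t₁ t₂, f' t < 0) → (∀ t ∈ Ioo t₂ (t₁ + L), f' t < 0) → False := by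
    intro f f' hf hfL a b
    exact hpos (f := fun t => -f t) (f' := fun t => -f' t) (fun t => (hf t).neg)
      (fun t => by simp only [hfL t]) (fun t ht => neg_pos.mpr (a t ht))
      (fun t ht => neg_pos.mpr (b t ht))
  -- If `k'` has the same sign on both arcs, `k` would grow or decrease over a period. Otherwise `k'
  -- * h` has the same sign on both arcs and `Θ` would do so.
  rcases pos_or_neg_of_ne_zero hk' hk1 with p1 | p1 <;>
    rcases pos_or_neg_of_ne_zero hk' hk2 with p2 | p2 <;> rcases hh with ⟨q1, q2⟩ | ⟨q1, q2⟩
  · exact hpos hk hkL p1 p2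
  · exact hpos hk hkL p1 p2
  · exact hpos hΘ hΘL (fun t ht => mul_pos (p1 t ht) (q1 t ht))
      (fun t ht => mul_pos_of_neg_of_neg (p2 t ht) (q2 t ht))
  · exact hneg hΘ hΘL (fun t ht => mul_neg_of_pos_of_neg (p1 t ht) (q1 t ht))
      (fun t ht => mul_neg_of_neg_of_pos (p2 t ht) (q2 t ht))
  · exact hneg hΘ hΘL (fun t ht => mul_neg_of_neg_of_pos (p1 t ht) (q1 t ht))
      (fun t ht => mul_neg_of_pos_of_neg (p2 t ht) (q2 t ht))
  · exact hpos hΘ hΘL (fun t ht => mul_pos_of_neg_of_neg (p1 t ht) (q1 t ht))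
      (fun t ht => mul_pos (p2 t ht) (q2 t ht))
  · exact hneg hk hkL p1 p2
  · exact hneg hk hkL p1 p2

theorem exists_of_encard_eq_two {L : ℝ} {k' : ℝ → ℝ} (hper : Function.Periodic k' L)
    (h : {t ∈ Ico 0 L | k' t = 0}.encard = 2) : ∃ t₁ t₂, t₁ < t₂ ∧ t₂ < t₁ + L ∧
      (∀ t ∈ Ioo t₁ t₂, k' t ≠ 0) ∧ ∀ t ∈ Ioo t₂ (t₁ + L), k' t ≠ 0 := by
  obtain ⟨x, y, hxy, hS⟩ := encard_eq_two.mp h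
  obtain ⟨t₁, t₂, h12, hS⟩ : ∃ t₁ t₂, t₁ < t₂ ∧ {t ∈ Ico 0 L | k' t = 0} = {t₁, t₂} := by
    rcases lt_or_gt_of_ne hxy with h | h
    · exact ⟨x, y, h, hS⟩
    · exact ⟨y, x, h, by rw [hS, pair_comm]⟩
  have m1 : t₁ ∈ {t ∈ Ico 0 L | k' t = 0} := by rw [hS]; simp
  have m2 : t₂ ∈ {t ∈ Ico 0 L | k' t = 0} := by rw [hS]; simp
  have key : ∀ t ∈ Ico 0 L, k' t = 0 → t = t₁ ∨ t = t₂ := fun t ht h0 => by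
    have : t ∈ {t ∈ Ico 0 L | k' t = 0} := ⟨ht, h0⟩
    rw [hS] at this
    simpa using this
  obtain ⟨⟨a1, a2⟩, -⟩ := m1
  obtain ⟨⟨b1, b2⟩, -⟩ := m2
  refine ⟨t₁, t₂, h12, by linarith, fun t ht h0 => ?_, fun t ht h0 => ?_⟩
  · rcases key t ⟨by linarith [ht.1], by linarith [ht.2]⟩ h0 with e | e
    · exact ht.1.ne' e
    · exact ht.2.ne e
  · rcases lt_or_ge t L with hlt | hge
    · rcases key t ⟨by linarith [ht.1], hlt⟩ h0 with e | e
      · linarith [ht.1]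
      · exact ht.1.ne' e
    · have h0' : k' (t - L) = 0 := by rw [hper.sub_eq, h0]
      rcases key (t - L) ⟨by linarith, by linarith [ht.2]⟩ h0' with e | e
      · linarith [ht.2]
      · linarith [ht.2]

end RealAnalysis

/-! ### Geodesic curvature and Hessian solutions along smooth curves. -/

namespace CoordMetric

variable {G : Plane → Matrix (Fin 2) (Fin 2) ℝ} {O : Set Plane} {K : ℝ} {b : ℝ → Plane}

theorem MetricOn.contDiff_geodesicCurvature (hG : MetricOn G O) (hb : ContDiff ℝ ∞ b)
    (hm : ∀ t, b t ∈ O) (hreg : ∀ t, deriv b t ≠ 0) : ContDiff ℝ ∞ (geodesicCurvature G b) := by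
  have h1 : ContDiff ℝ ∞ (deriv b) := (contDiff_infty_iff_deriv.mp hb).2
  have h2 : ContDiff ℝ ∞ (deriv (deriv b)) := (contDiff_infty_iff_deriv.mp h1).2
  have hO : MapsTo b univ O := fun t _ => hm t
  have hbil : ContDiff ℝ ∞ fun t => bil (G (b t)) (deriv b t) (deriv b t) := by
    rw [← contDiffOn_univ]
    exact ((hG.contDiffOn_bil.comp hb.contDiffOn hO).clm_apply h1.contDiffOn).clm_apply
      h1.contDiffOn
  have hgam : ContDiff ℝ ∞ fun t => gam G (b t) (deriv b t) (deriv b t) := by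
    rw [← contDiffOn_univ]
    exact ((hG.contDiffOn_gam.comp hb.contDiffOn hO).clm_apply h1.contDiffOn).clm_apply
      h1.contDiffOn
  have hdet : ContDiff ℝ ∞ fun t => (G (b t)).det := by
    have : ContDiffOn ℝ ∞ (fun z => (G z).det) O := by
      simp only [Matrix.det_fin_two]
      exact ((hG.smooth 0 0).mul (hG.smooth 1 1)).sub ((hG.smooth 0 1).mul (hG.smooth 1 0))
    rw [← contDiffOn_univ]
    exact this.comp hb.contDiffOn hO
  have hcr : ContDiff ℝ ∞ fun t => cross (deriv b t) (acc G b t) := by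
    have := IsStripMetric.contDiffOn_cross h1.contDiffOn (h2.add hgam).contDiffOn (O := univ)
    exact contDiffOn_univ.mp this
  have hpos : ∀ t, 0 < bil (G (b t)) (deriv b t) (deriv b t) := fun t => hG.pos _ (hm t) _ (hreg t)
  have := ((hdet.sqrt fun t => (hG.det_pos (hm t)).ne').mul hcr).div
    ((hbil.sqrt fun t => (hpos t).ne').pow 3) fun t => pow_ne_zero 3 (Real.sqrt_pos.mpr (hpos t)).ne'
  have he : geodesicCurvature G b = _ :=
    funext fun t => geodesicCurvature_eq (G := G) (t := t) (hb.of_le two_le_infty).contDiffAt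
  rw [he]
  exact this

theorem IsHessianSolution.hasDerivAt_comp {f : Plane → ℝ} {η : Plane → Plane →L[ℝ] ℝ}
    (h : IsHessianSolution G O K f η) (hb : ContDiff ℝ ∞ b) {t : ℝ} (hm : b t ∈ O) :
    HasDerivAt (fun s => f (b s)) (η (b t) (deriv b t)) t :=
  (h.hasFDerivAt _ hm).comp_hasDerivAt t (hb.differentiable (by simp) t).hasDerivAt

theorem IsHessianSolution.hasDerivAt_deriv_comp {f : Plane → ℝ} {η : Plane → Plane →L[ℝ] ℝ}
    (h : IsHessianSolution G O K f η) (hb : ContDiff ℝ ∞ b) {t : ℝ} (hm : b t ∈ O) :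
    HasDerivAt (fun s => η (b s) (deriv b s)) (η (b t) (gam G (b t) (deriv b t) (deriv b t)) -
      K * f (b t) * bil (G (b t)) (deriv b t) (deriv b t) + η (b t) (deriv (deriv b) t)) t := by
  have h1 : ContDiff ℝ ∞ (deriv b) := (contDiff_infty_iff_deriv.mp hb).2
  have h2 := hasDerivAt_comp_plane (F := Plane →L[ℝ] ℝ) (T := η) (h.differentiableAt _ hm)
    (hb.differentiable (by simp) t).hasDerivAt
  have h3 := h2.clm_apply (h1.differentiable (by simp) t).hasDerivAt
  rwa [h.hessian _ hm] at h3

end CoordMetric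

/-! ### Curves `C²` close to the axis in the resonant case `K = (2π / L)²`. -/

namespace IsStripMetric
open CoordMetric

variable {G : Plane → Matrix (Fin 2) (Fin 2) ℝ} {L δ K : ℝ}

/-- A closed curve in the strip which is `C²` close to the axis. -/
structure IsCloseToAxis (L ρ : ℝ) (b : ℝ → Plane) : Prop where
  smooth : ContDiff ℝ ∞ b
  periodic : ∀ t, b (t + L) = b t + pt L 0
  dist_lt : ∀ t, ‖b t - pt t 0‖ < ρ
  deriv_lt : ∀ t, ‖deriv b t - e_ 0‖ < ρ
  deriv_deriv_lt : ∀ t, ‖deriv (deriv b) t‖ < ρ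

theorem IsCloseToAxis.mono {ρ ρ' : ℝ} {b : ℝ → Plane} (h : IsCloseToAxis L ρ b) (hρ : ρ ≤ ρ') :
    IsCloseToAxis L ρ' b :=
  ⟨h.smooth, h.periodic, fun t => (h.dist_lt t).trans_le hρ, fun t => (h.deriv_lt t).trans_le hρ,
    fun t => (h.deriv_deriv_lt t).trans_le hρ⟩

theorem IsCloseToAxis.mem_strip {ρ : ℝ} {b : ℝ → Plane} (h : IsCloseToAxis L ρ b) (t : ℝ) :
    b t ∈ strip ρ := by
  have h1 := PiLp.norm_apply_le (b t - pt t 0) 1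
  have h2 : (b t - pt t 0) 1 = b t 1 := by simp
  rw [h2, Real.norm_eq_abs] at h1
  exact h1.trans_lt (h.dist_lt t)

theorem IsCloseToAxis.deriv_ne_zero {ρ : ℝ} {b : ℝ → Plane} (h : IsCloseToAxis L ρ b) (hρ : ρ ≤ 1)
    (t : ℝ) : deriv b t ≠ 0 := fun h0 => by
  have h1 := h.deriv_lt t
  rw [h0, zero_sub, norm_neg] at h1
  have h2 : ‖(e_ 0 : Plane)‖ = 1 := by simp
  linarith

theorem IsCloseToAxis.deriv_periodic {ρ : ℝ} {b : ℝ → Plane} (h : IsCloseToAxis L ρ b) (t : ℝ) :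
    deriv b (t + L) = deriv b t := by
  rw [← deriv_comp_add_const]
  simp only [h.periodic, deriv_add_const]

/-- The three arguments stand for position, velocity and second derivative of a curve. Continuity at
the points of the compact arc suffices for a uniform radius. -/
theorem exists_uniform_close {Q : Plane × Plane × Plane → ℝ}
    (hQ : ∀ t, ContinuousAt Q (pt t 0, e_ 0, 0)) {ε : ℝ} (hε : 0 < ε) (L : ℝ) :
    ∃ ρ > 0, ∀ t ∈ Icc 0 L, ∀ z u w : Plane, ‖z - pt t 0‖ < ρ → ‖u - e_ 0‖ < ρ → ‖w‖ < ρ →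
      |Q (z, u, w) - Q (pt t 0, e_ 0, 0)| < ε := by
  have hev : ∀ᶠ v : Plane × Plane × Plane in 𝓝 0, ∀ t ∈ Icc 0 L,
      |Q (pt t 0 + v.1, e_ 0 + v.2.1, v.2.2) - Q (pt t 0, e_ 0, 0)| < ε := by
    refine isCompact_Icc.eventually_forall_of_forall_eventually fun t _ => ?_
    have h1 : Filter.Tendsto (fun p : (Plane × Plane × Plane) × ℝ =>
        (pt p.2 0 + p.1.1, e_ 0 + p.1.2.1, p.1.2.2)) (𝓝 (0, t)) (𝓝 (pt t 0, e_ 0, 0)) := by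
      have hc : Continuous fun p : (Plane × Plane × Plane) × ℝ => pt p.2 0 :=
        continuous_pt.comp (continuous_snd.prodMk continuous_const)
      have : Continuous fun p : (Plane × Plane × Plane) × ℝ =>
        (pt p.2 0 + p.1.1, e_ 0 + p.1.2.1, p.1.2.2) := by fun_prop
      simpa using this.tendsto (0, t)
    have h2 : Filter.Tendsto (fun p : (Plane × Plane × Plane) × ℝ =>
        (pt p.2 0, (e_ 0 : Plane), (0 : Plane))) (𝓝 (0, t)) (𝓝 (pt t 0, e_ 0, 0)) := by
      have hc : Continuous fun p : (Plane × Plane × Plane) × ℝ => pt p.2 0 :=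
        continuous_pt.comp (continuous_snd.prodMk continuous_const)
      have : Continuous fun p : (Plane × Plane × Plane) × ℝ =>
        (pt p.2 0, (e_ 0 : Plane), (0 : Plane)) := by fun_prop
      exact this.tendsto (0, t)
    have h3 := (((hQ t).tendsto.comp h1).sub ((hQ t).tendsto.comp h2)).abs
    rw [sub_self, abs_zero] at h3
    exact h3.eventually (gt_mem_nhds hε)
  obtain ⟨ρ, hρ, hball⟩ := Metric.eventually_nhds_iff.mp hev
  refine ⟨ρ, hρ, fun t ht z u w hz hu hw => ?_⟩
  have := hball (y := (z - pt t 0, u - e_ 0, w)) (by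
    rw [dist_zero_right, Prod.norm_def, Prod.norm_def]
    exact max_lt hz (max_lt hu hw)) t ht
  simpa using this

/-- The first two derivatives of `f` along `b` are continuous expressions in `b`, `b'` and `b''`, by
the Hessian equation. On the axis they are `F'` and `-K F`, since the axis is a unit speed geodesic
there. -/
theorem exists_derivatives_close (h : IsStripMetric G L δ K) {d : ℝ} (hd : 0 < d)
    {f : Plane → ℝ} {η : Plane → Plane →L[ℝ] ℝ} (hf : IsHessianSolution G (strip d) K f η)
    (hηL : ∀ z, η (z + pt L 0) = η z) {F F' : ℝ → ℝ} (hFL : Function.Periodic F L)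
    (hFL' : Function.Periodic F' L) (hfF : ∀ x, f (pt x 0) = F x)
    (hηF : ∀ x, η (pt x 0) (e_ 0) = F' x) {ε : ℝ} (hε : 0 < ε) :
    ∃ ρ > 0, ρ ≤ d ∧ ∀ b, IsCloseToAxis L ρ b → ∀ t, |η (b t) (deriv b t) - F' t| < ε ∧
      |deriv (fun s => η (b s) (deriv b s)) t - -(K * F t)| < ε := by
  have hax : ∀ t, pt t 0 ∈ strip d := axis_mem_strip hd
  have hη : ∀ t, ContinuousAt (fun p : Plane × Plane × Plane => η p.1) (pt t 0, e_ 0, 0) := fun t =>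
    ContinuousAt.comp (x := (pt t 0, e_ 0, 0)) (f := Prod.fst)
      (hf.differentiableAt _ (hax t)).continuousAt continuousAt_fst
  have hfc : ∀ t, ContinuousAt (fun p : Plane × Plane × Plane => f p.1) (pt t 0, e_ 0, 0) := fun t =>
    ContinuousAt.comp (x := (pt t 0, e_ 0, 0)) (f := Prod.fst)
      (hf.hasFDerivAt _ (hax t)).continuousAt continuousAt_fst
  have hg : ∀ t, ContinuousAt (fun p : Plane × Plane × Plane => gam G p.1) (pt t 0, e_ 0, 0) :=
    fun t => ContinuousAt.comp (x := (pt t 0, e_ 0, 0)) (f := Prod.fst)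
      (h.metric.differentiableAt_gam (axis_mem_strip h.delta_pos t)).continuousAt continuousAt_fst
  have hb : ∀ t, ContinuousAt (fun p : Plane × Plane × Plane => bil (G p.1)) (pt t 0, e_ 0, 0) :=
    fun t => ContinuousAt.comp (x := (pt t 0, e_ 0, 0)) (g := fun z => bil (G z)) (f := Prod.fst)
      (h.metric.differentiableAt_bil (axis_mem_strip h.delta_pos t)).continuousAt continuousAt_fst
  have hu : ∀ t : ℝ, ContinuousAt (fun p : Plane × Plane × Plane => p.2.1) (pt t 0, e_ 0, 0) :=
    fun t => (continuous_fst.comp continuous_snd).continuousAt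
  have hw : ∀ t : ℝ, ContinuousAt (fun p : Plane × Plane × Plane => p.2.2) (pt t 0, e_ 0, 0) :=
    fun t => (continuous_snd.comp continuous_snd).continuousAt
  obtain ⟨ρ₁, hρ₁, H₁⟩ := exists_uniform_close (Q := fun p => η p.1 p.2.1)
    (fun t => (hη t).clm_apply (hu t)) hε L
  obtain ⟨ρ₂, hρ₂, H₂⟩ := exists_uniform_close (Q := fun p => η p.1 (gam G p.1 p.2.1 p.2.1) -
      K * f p.1 * bil (G p.1) p.2.1 p.2.1 + η p.1 p.2.2)
    (fun t => (((hη t).clm_apply (((hg t).clm_apply (hu t)).clm_apply (hu t))).sub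
      ((continuousAt_const.mul (hfc t)).mul (((hb t).clm_apply (hu t)).clm_apply (hu t)))).add
      ((hη t).clm_apply (hw t))) hε L
  refine ⟨min d (min ρ₁ ρ₂), lt_min hd (lt_min hρ₁ hρ₂), min_le_left _ _, fun b hb t => ?_⟩
  have hb₁ := hb.mono ((min_le_right _ _).trans (min_le_left _ _))
  have hb₂ := hb.mono ((min_le_right _ _).trans (min_le_right _ _))
  have hbd := hb.mono (min_le_left _ _)
  have hP : Function.Periodic (fun s => η (b s) (deriv b s)) L := fun s => by
    simp only [hb.periodic, hηL, hb.deriv_periodic]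
  have hP' : Function.Periodic (deriv fun s => η (b s) (deriv b s)) L := fun s => by
    rw [← deriv_comp_add_const]
    congr 1
    exact funext hP
  constructor
  · have hper : Function.Periodic (fun s => |η (b s) (deriv b s) - F' s|) L := fun s => by
      have := hP s
      simp only at this
      simp only [this, hFL' s]
    obtain ⟨s, hs, e⟩ := hper.exists_mem_Ico₀ h.length_pos t
    rw [e, ← hηF]
    -- The first derivative does not involve `b''`, so `0` can stand in for it.
    exact H₁ s ⟨hs.1, hs.2.le⟩ _ _ 0 (hb₁.dist_lt s) (hb₁.deriv_lt s) (by simpa using hρ₁)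
  · have hper : Function.Periodic
        (fun s => |deriv (fun s => η (b s) (deriv b s)) s - -(K * F s)|) L := fun s => by
      simp only [hP' s, hFL s]
    obtain ⟨s, hs, e⟩ := hper.exists_mem_Ico₀ h.length_pos t
    rw [e, (hf.hasDerivAt_deriv_comp hb.smooth (hbd.mem_strip s)).deriv]
    have := H₂ s ⟨hs.1, hs.2.le⟩ _ _ _ (hb₂.dist_lt s) (hb₂.deriv_lt s) (hb₂.deriv_deriv_lt s)
    simpa [h.geodesic, hfF, h.bil_axis] using this

theorem strip_mono {d d' : ℝ} (h : d ≤ d') : strip d ⊆ strip d' := fun _ hz => lt_of_lt_of_le hz h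

/-- If `K = (2 π / L) ^ 2`, then no curve `C²` close to the axis has exactly two vertices. -/
theorem exists_encard_ne_two (h : IsStripMetric G L δ ((2 * Real.pi / L) ^ 2)) :
    ∃ ρ > 0, ρ ≤ δ ∧ ∀ b, IsCloseToAxis L ρ b →
      {t ∈ Ico 0 L | deriv (geodesicCurvature G b) t = 0}.encard ≠ 2 := by
  have hL := h.length_pos
  set l := 2 * Real.pi / L with hl
  have hlpos : 0 < l := by have := Real.pi_pos; positivity
  have hlL : l * L = 2 * Real.pi := by rw [hl]; field_simp
  have hlin : ∀ t : ℝ, HasDerivAt (fun t => l * t) l t := fun t => by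
    simpa using (hasDerivAt_id t).const_mul l
  have hcosd : ∀ t, HasDerivAt (fun t => Real.cos (l * t)) (-(l * Real.sin (l * t))) t := fun t =>
    (hlin t).cos.congr_deriv (by ring)
  have hsind : ∀ t, HasDerivAt (fun t => Real.sin (l * t)) (l * Real.cos (l * t)) t := fun t =>
    (hlin t).sin.congr_deriv (by ring)
  have hcosL : Function.Periodic (fun t => Real.cos (l * t)) L := fun t => by
    simp only [mul_add, hlL, Real.cos_add_two_pi]
  have hsinL : Function.Periodic (fun t => Real.sin (l * t)) L := fun t => by
    simp only [mul_add, hlL, Real.sin_add_two_pi]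
  have hcosL' : Function.Periodic (fun t => l * Real.cos (l * t)) L := fun t => by
    simp only [mul_add, hlL, Real.cos_add_two_pi]
  have hsinL' : Function.Periodic (fun t => -(l * Real.sin (l * t))) L := fun t => by
    simp only [mul_add, hlL, Real.sin_add_two_pi]
  -- Both solutions of `F'' = -K F` are `L`-periodic because `K = l²`.
  obtain ⟨d₁, hd₁, hdδ₁, f₁, η₁, hf₁, hfL₁, hηL₁, hfF₁, hηF₁⟩ := h.exists_isHessianSolution
    (F := fun t => Real.cos (l * t)) (F' := fun t => -(l * Real.sin (l * t))) hcosd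
    (fun t => ((hsind t).const_mul l).neg.congr_deriv (by ring)) hcosL hsinL'
  obtain ⟨d₂, hd₂, hdδ₂, f₂, η₂, hf₂, hfL₂, hηL₂, hfF₂, hηF₂⟩ := h.exists_isHessianSolution
    (F := fun t => Real.sin (l * t)) (F' := fun t => l * Real.cos (l * t)) hsind
    (fun t => ((hcosd t).const_mul l).congr_deriv (by ring)) hsinL hcosL'
  -- A combination of two such errors is below `2 ε`, well within the tolerances `l / 2` and `l² /
  -- 2` of the zero count.
  set ε := min (l / 8) (l * l / 8) with hε
  have hεpos : 0 < ε := lt_min (by positivity) (by positivity)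
  obtain ⟨ρ₁, hρ₁, hρd₁, H₁⟩ := h.exists_derivatives_close hd₁ hf₁ hηL₁ hcosL hsinL' hfF₁ hηF₁
    hεpos
  obtain ⟨ρ₂, hρ₂, hρd₂, H₂⟩ := h.exists_derivatives_close hd₂ hf₂ hηL₂ hsinL hcosL' hfF₂ hηF₂
    hεpos
  refine ⟨min 1 (min ρ₁ ρ₂), lt_min one_pos (lt_min hρ₁ hρ₂),
    (min_le_right _ _).trans ((min_le_left _ _).trans (hρd₁.trans hdδ₁)), fun b hb hcard => ?_⟩
  have hb₁ := hb.mono ((min_le_right _ _).trans (min_le_left _ _))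
  have hb₂ := hb.mono ((min_le_right _ _).trans (min_le_right _ _))
  have hm₁ : ∀ t, b t ∈ strip d₁ := fun t => strip_mono hρd₁ (hb₁.mem_strip t)
  have hm₂ : ∀ t, b t ∈ strip d₂ := fun t => strip_mono hρd₂ (hb₂.mem_strip t)
  have hm : ∀ t, b t ∈ strip δ := fun t => strip_mono hdδ₁ (hm₁ t)
  have hreg : ∀ t, deriv b t ≠ 0 := hb.deriv_ne_zero (min_le_left _ _)
  have hbs := hb.smooth
  have hb2 : ContDiff ℝ 2 b := hbs.of_le two_le_infty
  -- the geodesic curvature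
  set k := geodesicCurvature G b with hk
  have hks : ContDiff ℝ ∞ k := h.metric.contDiff_geodesicCurvature hbs hm hreg
  have hkd : ∀ t, HasDerivAt k (deriv k t) t := fun t => (hks.differentiable (by simp) t).hasDerivAt
  have hkc : Continuous (deriv k) := (contDiff_infty_iff_deriv.mp hks).2.continuous
  have hkL : Function.Periodic k L := fun t => h.geodesicCurvature_periodic hb2 hb.periodic (hm t)
  have hkL' : Function.Periodic (deriv k) L := fun t => by
    rw [← deriv_comp_add_const]
    congr 1
    exact funext hkL
  obtain ⟨t₁, t₂, h12, h21, hk1, hk2⟩ := exists_of_encard_eq_two hkL' hcard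
  -- the linear combination which takes the same value at both vertices
  obtain ⟨θ, hθ⟩ : ∃ θ : ℝ, Real.cos θ * (f₁ (b t₂) - f₁ (b t₁)) +
      Real.sin θ * (f₂ (b t₂) - f₂ (b t₁)) = 0 := by
    set D := f₁ (b t₂) - f₁ (b t₁)
    set D' := f₂ (b t₂) - f₂ (b t₁)
    have hc : Continuous fun θ : ℝ => Real.cos θ * D + Real.sin θ * D' := by fun_prop
    -- The expression is `D` at `θ = 0` and `-D` at `θ = π`, so it vanishes in between.
    rcases le_total D 0 with hD | hD
    · obtain ⟨θ, -, e⟩ := intermediate_value_Icc Real.pi_pos.le hc.continuousOn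
        (show (0 : ℝ) ∈ Icc _ _ by simpa using hD)
      exact ⟨θ, e⟩
    · obtain ⟨θ, -, e⟩ := intermediate_value_Icc' Real.pi_pos.le hc.continuousOn
        (show (0 : ℝ) ∈ Icc _ _ by simpa using hD)
      exact ⟨θ, e⟩
  -- Subtracting the constants makes `F` vanish at `t₁`, and by the choice of `θ` at `t₂`. Being
  -- constants, they do not affect `F'`.
  set F : ℝ → ℝ := fun t => Real.cos θ * (f₁ (b t) - f₁ (b t₁)) +
    Real.sin θ * (f₂ (b t) - f₂ (b t₁)) with hF
  set F' : ℝ → ℝ := fun t => Real.cos θ * η₁ (b t) (deriv b t) + Real.sin θ * η₂ (b t) (deriv b t)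
    with hF'
  have hFd : ∀ t, HasDerivAt F (F' t) t := fun t =>
    (((hf₁.hasDerivAt_comp hbs (hm₁ t)).sub_const _).const_mul _).add
      (((hf₂.hasDerivAt_comp hbs (hm₂ t)).sub_const _).const_mul _)
  have hFL : Function.Periodic F L := fun t => by simp only [hF, hb.periodic, hfL₁, hfL₂]
  have hFL' : Function.Periodic F' L := fun t => by
    simp only [hF', hb.periodic, hηL₁, hηL₂, hb.deriv_periodic]
  have hFd' : ∀ t, HasDerivAt F' (Real.cos θ * deriv (fun s => η₁ (b s) (deriv b s)) t +
      Real.sin θ * deriv (fun s => η₂ (b s) (deriv b s)) t) t := fun t =>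
    ((hf₁.hasDerivAt_deriv_comp hbs (hm₁ t)).differentiableAt.hasDerivAt.const_mul _).add
      ((hf₂.hasDerivAt_deriv_comp hbs (hm₂ t)).differentiableAt.hasDerivAt.const_mul _)
  have hcomb : ∀ x y r : ℝ, |x| < r → |y| < r → |Real.cos θ * x + Real.sin θ * y| < 2 * r := by
    intro x y r hx hy
    have h1 : |Real.cos θ * x| ≤ |x| := by
      rw [abs_mul]; exact mul_le_of_le_one_left (abs_nonneg _) (Real.abs_cos_le_one θ)
    have h2 : |Real.sin θ * y| ≤ |y| := by
      rw [abs_mul]; exact mul_le_of_le_one_left (abs_nonneg _) (Real.abs_sin_le_one θ)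
    have h3 := abs_add_le (Real.cos θ * x) (Real.sin θ * y)
    linarith
  have hlθ : ∀ t, l * (t - θ / l) = l * t - θ := fun t => by field_simp
  have hε1 : ε ≤ l / 8 := min_le_left _ _
  have hε2 : ε ≤ l * l / 8 := min_le_right _ _
  -- On the axis `F'` would be `-l cos θ sin (l t) + l sin θ cos (l t) = -l sin (l t - θ)`.
  obtain ⟨z₁, z₂, -, -, hz⟩ := exists_zeros_of_near_sin (A := -l) (θ := θ / l) hL (neg_ne_zero.mpr
    hlpos.ne') hFd' hFL' (fun t => by
      rw [← hl, hlθ, Real.sin_sub, abs_neg, abs_of_pos hlpos]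
      have h1 := hcomb _ _ _ (H₁ b hb₁ t).1 (H₂ b hb₂ t).1
      refine lt_of_eq_of_lt (congrArg _ ?_) (h1.trans_le (by linarith))
      simp only [hF']; ring)
    (fun t => by
      rw [← hl, hlθ, Real.cos_sub, abs_neg, abs_of_pos hlpos]
      have h1 := hcomb _ _ _ (H₁ b hb₁ t).2 (H₂ b hb₂ t).2
      refine le_of_eq_of_le (congrArg _ ?_) (h1.le.trans (by linarith))
      ring)
  have hsign := sign_of_two_critical hL hFd hFL (fun t ht => (hz t).mp ht) h12 h21
    (by simp [hF]) hθ
  -- the periodic function with derivative of one sign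
  have hq₁ := fun t => hf₁.hasDerivAt_normal (h.metric.mono (isOpen_strip d₁) (strip_mono hdδ₁)) (hm₁ t)
    hb2.contDiffAt (hreg t)
  have hq₂ := fun t => hf₂.hasDerivAt_normal (h.metric.mono (isOpen_strip d₂) (strip_mono hdδ₂)) (hm₂ t)
    hb2.contDiffAt (hreg t)
  have hnL : ∀ t, nrm G b (t + L) = nrm G b t := fun t => by
    simp only [nrm, hb.deriv_periodic, hb.periodic, h.periodic _ (hm t)]
  -- The derivative of `k F` is `k' F + k F'`, and that of the normal derivative is `-k F'`; the sum
  -- is `k' F`.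
  refine false_of_two_critical (Θ := fun t => k t * F t + (Real.cos θ * η₁ (b t) (nrm G b t) +
    Real.sin θ * η₂ (b t) (nrm G b t))) hkd hkc hkL (fun t => ?_) (fun t => ?_) h12 h21 hk1 hk2 hsign
  · refine (((hkd t).mul (hFd t)).add (((hq₁ t).const_mul _).add ((hq₂ t).const_mul _))).congr_deriv ?_
    simp only [hF', ← hk]
    ring
  · simp only [hnL, hb.periodic, hηL₁, hηL₂, hkL t, hFL t]

end IsStripMetric

/-! ### Lifting closed curves near the geodesic to the strip. -/

section Surface
open CoordMetric

variable {M : Type*} [TopologicalSpace M] [ChartedSpace Plane M] [IsManifold (𝓡 2) ∞ M]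
variable {g : Bundle.ContMDiffRiemannianMetric (𝓡 2) ∞ Plane (fun p : M => TangentSpace (𝓡 2) p)}
variable {L δ K : ℝ} {E : Plane → M} {e : OpenPartialHomeomorph M Plane}

theorem IsStripImmersion.exists_equiv (hE : IsStripImmersion E δ)
    (he : e ∈ IsManifold.maximalAtlas (𝓡 2) ∞ M) {z : Plane} (hz : z ∈ strip δ)
    (hzs : E z ∈ e.source) : ∃ A : Plane ≃L[ℝ] Plane, HasFDerivAt (e ∘ E) (A : Plane →L[ℝ] Plane) z := by
  have hd : DifferentiableAt ℝ (e ∘ E) z :=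
    (contDiffAt_chart_comp he (hE z hz).1 hzs).differentiableAt (by simp)
  have hi : Function.Injective (fderiv ℝ (e ∘ E) z) := by
    rw [injective_iff_cross]
    exact (mfderiv_injective_iff he (hE z hz).1 hzs).mp (hE z hz).2
  refine ⟨(LinearEquiv.ofInjectiveEndo (fderiv ℝ (e ∘ E) z : Plane →ₗ[ℝ] Plane)
    hi).toContinuousLinearEquiv, ?_⟩
  exact hd.hasFDerivAt

/-- Local inverses of `E` are charts of the maximal atlas, so they may be used to form basic
neighborhoods of the `C^∞` topology; in such a chart `γ` is the axis. -/
theorem IsStripImmersion.exists_localInverse (hE : IsStripImmersion E δ) {z : Plane}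
    (hz : z ∈ strip δ) : ∃ ψ ∈ IsManifold.maximalAtlas (𝓡 2) ∞ M, z ∈ ψ.target ∧
      ∀ w ∈ ψ.target, ψ.symm w = E w := by
  set e := chartAt Plane (E z) with he_def
  have he : e ∈ IsManifold.maximalAtlas (𝓡 2) ∞ M := chart_mem_maximalAtlas' (E z)
  have hze : E z ∈ e.source := mem_chart_source Plane (E z)
  have hcont : ContinuousOn E (strip δ) := fun z hz => (hE z hz).1.continuousAt.continuousWithinAt
  have hO : IsOpen (strip δ ∩ E ⁻¹' e.source) :=
    hcont.isOpen_inter_preimage (isOpen_strip δ) e.open_source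
  obtain ⟨A, hA⟩ := hE.exists_equiv he hz hze
  have hs := contDiffAt_chart_comp he (hE z hz).1 hze
  set H := (hs.toOpenPartialHomeomorph (e ∘ E) hA (by simp)).restrOpen _ hO with hH
  have hHc : ∀ w, H w = e (E w) := fun w => rfl
  have hHs : ∀ w ∈ H.source, w ∈ strip δ ∧ E w ∈ e.source := fun w hw => by
    rw [hH, OpenPartialHomeomorph.restrOpen_source] at hw
    exact hw.2
  have hzH : z ∈ H.source := by
    rw [hH, OpenPartialHomeomorph.restrOpen_source]
    exact ⟨hs.mem_toOpenPartialHomeomorph_source hA (by simp), hz, hze⟩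
  have hsymm : ∀ w ∈ (e.trans H.symm).target, (e.trans H.symm).symm w = E w := fun w hw => by
    have h1 : w ∈ H.source := by simpa using hw.1
    exact e.left_inv (hHs w h1).2
  refine ⟨e.trans H.symm, ?_, ?_, hsymm⟩
  · refine OpenPartialHomeomorph.mem_maximalAtlas_of_contMDiffOn _ ?_ ?_
    · rintro p ⟨hp1, hp2⟩
      have hp3 : e p ∈ H.target := by simpa using hp2
      have h1 := hHs _ (H.map_target hp3)
      obtain ⟨B, hB⟩ := hE.exists_equiv he h1.1 h1.2
      have h2 : ContDiffAt ℝ ∞ H.symm (e p) := by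
        refine H.contDiffAt_symm hp3 hB ?_
        exact contDiffAt_chart_comp (e := e) (c := E) he (hE _ h1.1).1 h1.2
      exact (h2.contMDiffAt.comp p ((contMDiffOn_of_mem_maximalAtlas he).contMDiffAt
        (e.open_source.mem_nhds hp1))).contMDiffWithinAt
    · have : ContMDiffOn (𝓡 2) (𝓡 2) ∞ E (e.trans H.symm).target := fun w hw => by
        have h1 : w ∈ H.source := by simpa using hw.1
        exact (hE w (hHs w h1).1).1.contMDiffWithinAt
      exact this.congr hsymm
  · rw [OpenPartialHomeomorph.trans_target]
    exact ⟨by simpa using hzH, e.map_source hze⟩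

theorem translate_zsmul_axis {X : Type*} {E : Plane → X} (hper : ∀ z, E (z + pt L 0) = E z)
    (n : ℤ) (z : Plane) : E (z + pt (n * L) 0) = E z := by
  have h1 : Function.Periodic E (pt L 0) := hper
  have h2 : (n : ℤ) • pt L 0 = pt (n * L) 0 := by
    ext i; fin_cases i <;> simp
  rw [← h2]
  exact h1.zsmul n z

/-- Globally `E` is periodic and may have further self-overlaps, but a uniform radius of injectivity
along the axis is enough to make lifts close to the axis unique. It comes from compactness of one
period and translation. -/
theorem IsStripImmersion.exists_injOn_ball (hE : IsStripImmersion E δ) (hδ : 0 < δ) (hL : 0 < L)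
    (hper : ∀ z, E (z + pt L 0) = E z) : ∃ r > 0, ∀ t, InjOn E (Metric.ball (pt t 0) r) := by
  have hev : ∀ᶠ r : ℝ in 𝓝 0, ∀ t ∈ Icc 0 L, InjOn E (Metric.ball (pt t 0) r) := by
    refine isCompact_Icc.eventually_forall_of_forall_eventually fun t _ => ?_
    obtain ⟨ψ, -, hzt, hψ⟩ := hE.exists_localInverse (axis_mem_strip hδ t)
    obtain ⟨ε, hε, hball⟩ := Metric.isOpen_iff.mp ψ.open_target _ hzt
    have hinj : InjOn E (Metric.ball (pt t 0) ε) := fun x hx y hy hxy =>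
      ψ.symm.injOn (hball hx) (hball hy) (by rw [hψ x (hball hx), hψ y (hball hy), hxy])
    have hc : Continuous fun p : ℝ × ℝ => p.1 + dist (pt p.2 0) (pt t 0) :=
      continuous_fst.add ((continuous_pt.comp (continuous_snd.prodMk continuous_const)).dist
        continuous_const)
    have hlt : ∀ᶠ p : ℝ × ℝ in 𝓝 (0, t), p.1 + dist (pt p.2 0) (pt t 0) < ε :=
      hc.continuousAt.eventually_lt_const (by simpa using hε)
    filter_upwards [hlt] with p hp
    exact hinj.mono (Metric.ball_subset_ball' hp.le)
  obtain ⟨ε, hε, hball⟩ := Metric.eventually_nhds_iff.mp hev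
  have h0 := hball (y := ε / 2) (by rw [Real.dist_eq, sub_zero, abs_of_pos] <;> linarith)
  refine ⟨ε / 2, by linarith, fun t x hx y hy hxy => ?_⟩
  have hper' := translate_zsmul_axis hper
  obtain ⟨n, hn, -⟩ := existsUnique_add_zsmul_mem_Ico hL t 0
  have hn' : t + n * L ∈ Icc 0 L := by
    have := Ico_subset_Icc_self hn
    simpa using this
  have key : ∀ z ∈ Metric.ball (pt t 0) (ε / 2),
      z + pt (n * L) 0 ∈ Metric.ball (pt (t + n * L) 0) (ε / 2) := fun z hz => by
    have h3 : pt (t + n * L) 0 = pt t 0 + pt (n * L) 0 := by rw [pt_add]; simp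
    rw [Metric.mem_ball, h3, dist_add_right]
    exact hz
  exact add_right_cancel (h0 _ hn' (key x hx) (key y hy) (by rw [hper', hper', hxy]))

/-- A closed curve close to the axis lifts to the strip. -/
theorem IsStripImmersion.exists_lift (hE : IsStripImmersion E δ) {γ : SmoothCurve M}
    (hγ : IsAxisExtension γ L E) (hδ : 0 < δ) (hL : 0 < L) {ρ : ℝ} (hρ : 0 < ρ) :
    ∃ N : Set (SmoothCurve M), IsOpen[smoothTopology M] N ∧ γ ∈ N ∧
      ∀ c ∈ N, Function.Periodic c L →
        ∃ b, IsStripMetric.IsCloseToAxis L ρ b ∧ ∀ s, c s = E (b s) := by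
  obtain ⟨r, hr, hinj⟩ := hE.exists_injOn_ball hδ hL hγ.periodic
  set ε := min r ρ with hεdef
  have hε : 0 < ε := lt_min hr hρ
  have hptc : Continuous fun t : ℝ => pt t 0 :=
    continuous_pt.comp (continuous_id.prodMk continuous_const)
  have hloc : ∀ s : ℝ, ∃ ψ ∈ IsManifold.maximalAtlas (𝓡 2) ∞ M, (∀ w ∈ ψ.target, ψ.symm w = E w) ∧
      ∃ η > 0, ∀ t ∈ Icc (s - η) (s + η), pt t 0 ∈ ψ.target := fun s => by
    obtain ⟨ψ, hψ, hs, hinv⟩ := hE.exists_localInverse (axis_mem_strip hδ s)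
    have hev : ∀ᶠ t in 𝓝 s, pt t 0 ∈ ψ.target :=
      hptc.continuousAt.eventually (ψ.open_target.mem_nhds hs)
    obtain ⟨η, hη, hball⟩ := Metric.nhds_basis_closedBall.eventually_iff.mp hev
    exact ⟨ψ, hψ, hinv, η, hη, fun t ht => hball (by rwa [Real.closedBall_eq_Icc])⟩
  choose ψ hψ hinv η hη hS using hloc
  obtain ⟨T, -, hT⟩ := isCompact_Icc.elim_nhds_subcover (s := Icc 0 L)
    (fun s => Ioo (s - η s) (s + η s))
    (fun s _ => Ioo_mem_nhds (by linarith [hη s]) (by linarith [hη s]))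
  have hγψ : ∀ s, ∀ t ∈ Icc (s - η s) (s + η s), γ t ∈ (ψ s).source := fun s t ht => by
    rw [← hγ.axis, ← hinv s _ (hS s t ht)]
    exact (ψ s).map_target (hS s t ht)
  have hγe : ∀ s, ∀ t ∈ Icc (s - η s) (s + η s), ψ s ∘ γ =ᶠ[𝓝 t] fun u => pt u 0 :=
    fun s t ht => by
      filter_upwards [hptc.continuousAt.eventually ((ψ s).open_target.mem_nhds (hS s t ht))] with u hu
      rw [Function.comp_apply, ← hγ.axis, ← hinv s _ hu, (ψ s).right_inv hu]
  have hd1 : deriv (fun u : ℝ => pt u 0) = fun _ => e_ 0 := funext fun u => by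
    have : HasDerivAt (fun s => pt s 0) (e_ 0) u := by
      simpa [pt] using hasDerivAt_pt (hasDerivAt_id u) (hasDerivAt_const u 0)
    exact this.deriv
  -- Order `2` is what the definition of closeness to the axis requires. The bound `ε` lies below
  -- `ρ` and below the radius of injectivity.
  refine ⟨⋂ s ∈ T, basicNeighborhood γ (ψ s) (Icc (s - η s) (s + η s)) 2 ε, ?_, ?_, ?_⟩
  · refine @isOpen_biInter_finset _ _ (smoothTopology M) _ _ fun s _ => ?_
    exact TopologicalSpace.GenerateOpen.basic _
      ⟨γ, ψ s, _, 2, ε, hψ s, isCompact_Icc, hγψ s, hε, rfl⟩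
  · refine mem_iInter₂.mpr fun s _ t ht => ⟨hγψ s t ht, fun j _ => ?_⟩
    rw [sub_self, norm_zero]
    exact hε
  intro c hc hcL
  have hloc0 : ∀ t ∈ Icc 0 L, ∃ f : ℝ → Plane, ContDiffAt ℝ ∞ f t ∧
      (∀ᶠ u in 𝓝 t, ‖f u - pt u 0‖ < ε ∧ E (f u) = c u) ∧ ‖deriv f t - e_ 0‖ < ε ∧
      ‖deriv (deriv f) t‖ < ε := fun t ht => by
    obtain ⟨s, hsT, hs⟩ := mem_iUnion₂.mp (hT ht)
    have hcs := mem_iInter₂.mp hc s hsT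
    have ht' := Ioo_subset_Icc_self hs
    have hsm : ContDiffAt ℝ ∞ (ψ s ∘ c) t :=
      contDiffAt_chart_comp (hψ s) c.contMDiff.contMDiffAt (hcs t ht').1
    have hd : ‖(ψ s ∘ c) t - pt t 0‖ < ε := by
      have h0 := (hcs t ht').2 0 (by norm_num)
      rw [iteratedDeriv_zero, iteratedDeriv_zero, (hγe s t ht').eq_of_nhds] at h0
      exact h0
    refine ⟨ψ s ∘ c, hsm, ?_, ?_, ?_⟩
    · have h1 : ContinuousAt (fun u => ‖(ψ s ∘ c) u - pt u 0‖) t :=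
        (hsm.continuousAt.sub hptc.continuousAt).norm
      have h2 : ∀ᶠ u in 𝓝 t, u ∈ Ioo (s - η s) (s + η s) := Ioo_mem_nhds hs.1 hs.2
      filter_upwards [h2] with u hu
      have hu' := Ioo_subset_Icc_self hu
      have h0 := (hcs u hu').2 0 (by norm_num)
      rw [iteratedDeriv_zero, iteratedDeriv_zero, (hγe s u hu').eq_of_nhds] at h0
      have h3 := (hcs u hu').1
      refine ⟨h0, ?_⟩
      rw [Function.comp_apply, ← hinv s _ ((ψ s).map_source h3), (ψ s).left_inv h3]
    · have h0 := (hcs t ht').2 1 (by norm_num)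
      rw [iteratedDeriv_one, iteratedDeriv_one, (hγe s t ht').deriv_eq, hd1] at h0
      exact h0
    · have h0 := (hcs t ht').2 2 le_rfl
      rw [iteratedDeriv_succ, iteratedDeriv_one, iteratedDeriv_succ, iteratedDeriv_one,
        (hγe s t ht').deriv.deriv_eq, hd1] at h0
      simpa using h0
  -- Local lifts at arbitrary parameters are obtained from those over one period by translating by a
  -- multiple of `L`.
  have hloc1 : ∀ t, ∃ f : ℝ → Plane, ContDiffAt ℝ ∞ f t ∧
      (∀ᶠ u in 𝓝 t, ‖f u - pt u 0‖ < ε ∧ E (f u) = c u) ∧ ‖deriv f t - e_ 0‖ < ε ∧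
      ‖deriv (deriv f) t‖ < ε := fun t => by
    obtain ⟨n, hn, -⟩ := existsUnique_add_zsmul_mem_Ico hL t 0
    have hn' : t + n * L ∈ Icc 0 L := by
      have := Ico_subset_Icc_self hn
      simpa using this
    obtain ⟨f, hf, hev, h1, h2⟩ := hloc0 _ hn'
    have hder : deriv (fun u => f (u + n * L) - pt (n * L) 0) = fun u => deriv f (u + n * L) :=
      funext fun u => by rw [deriv_sub_const, deriv_comp_add_const]
    refine ⟨fun u => f (u + n * L) - pt (n * L) 0, ?_, ?_, ?_, ?_⟩
    · exact (ContDiffAt.comp (g := f) t hf (contDiffAt_id.add contDiffAt_const)).sub contDiffAt_const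
    · have hsh : Filter.Tendsto (fun u => u + n * L) (𝓝 t) (𝓝 (t + n * L)) :=
        (continuous_id.add continuous_const).tendsto t
      filter_upwards [hsh.eventually hev] with u hu
      have h3 : pt (u + n * L) 0 = pt u 0 + pt (n * L) 0 := by rw [pt_add]; simp
      refine ⟨?_, ?_⟩
      · rw [sub_sub, add_comm (pt _ _), ← h3]
        exact hu.1
      · rw [← translate_zsmul_axis hγ.periodic n, sub_add_cancel, hu.2]
        have := hcL.zsmul n u
        simpa using this
    · rw [hder]
      exact h1
    · rw [hder, deriv_comp_add_const]
      exact h2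
  choose f hf hev h1 h2 using hloc1
  have hεr : ε ≤ r := min_le_left _ _
  have huniq : ∀ t x y, ‖x - pt t 0‖ < ε → ‖y - pt t 0‖ < ε → E x = E y → x = y :=
    fun t x y hx hy hxy => hinj t (mem_ball_iff_norm.mpr (hx.trans_le hεr))
      (mem_ball_iff_norm.mpr (hy.trans_le hεr)) hxy
  have hself := fun t => (hev t).self_of_nhds
  -- The lift is the diagonal of the local lifts. By uniqueness it agrees with `f t` near `t`,
  -- whence its smoothness and the bounds on its derivatives.
  have hbf : ∀ t, (fun u => f u u) =ᶠ[𝓝 t] f t := fun t => by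
    filter_upwards [hev t] with u hu
    exact huniq u _ _ (hself u).1 hu.1 ((hself u).2.trans hu.2.symm)
  refine ⟨fun u => f u u, IsStripMetric.IsCloseToAxis.mono (ρ := ε)
    ⟨?_, fun t => ?_, fun t => (hself t).1, fun t => ?_, fun t => ?_⟩ (min_le_right _ _),
    fun s => (hself s).2.symm⟩
  · exact contDiff_iff_contDiffAt.mpr fun t => (hf t).congr_of_eventuallyEq (hbf t)
  -- The value at `t + L` and the translate of the value at `t` are both lifts of `c (t + L)` close
  -- to the axis point over `t + L`.
  · refine huniq (t + L) _ _ (hself _).1 ?_ ?_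
    · have h3 : pt (t + L) 0 = pt t 0 + pt L 0 := by rw [pt_add]; simp
      rw [h3, add_sub_add_right_eq_sub]
      exact (hself t).1
    · rw [hγ.periodic, (hself _).2, (hself _).2, hcL]
  · rw [(hbf t).deriv_eq]
    exact h1 t
  · rw [(hbf t).deriv.deriv_eq]
    exact h2 t

end Surface

end

/-! ### The equivalence. -/

theorem mainTheorem5 {M : Type*} [TopologicalSpace M] [T2Space M] [ChartedSpace Plane M]
    [IsManifold (𝓡 2) ∞ M]
    (g : Bundle.ContMDiffRiemannianMetric (𝓡 2) ∞ Plane (fun p : M => TangentSpace (𝓡 2) p))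
    (K : ℝ) (hK : HasConstantCurvature g K)
    (L : ℝ) (γ : SmoothCurve M) (hγ : IsClosedGeodesic g γ L)
    (hor : ∃ V : Set M, IsOpen V ∧ range γ ⊆ V ∧ IsOrientableOn V) :
    (∀ U : Set M, IsOpen U → range γ ⊆ U →
      ∀ N : Set (SmoothCurve M), IsOpen[smoothTopology M] N → γ ∈ N →
        ∃ c ∈ N, range c ⊆ U ∧ IsClosedCurve c L ∧ HasOnlyTwoVertices g c L) ↔
      K ≠ (2 * Real.pi / L) ^ 2 := by
  obtain ⟨E, δ, hE, hE', hG⟩ := exists_isStripMetric hK hγ hor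
  refine ⟨fun hi => ?_, fun hne U hU hγU N hN hγN =>
    exists_hasOnlyTwoVertices hE hE' hG hne hU hγU hN hγN⟩
  rintro rfl
  obtain ⟨ρ, hρ, hρδ, hne⟩ := hG.exists_encard_ne_two
  obtain ⟨N, hN, hγN, hlift⟩ := hE'.exists_lift hE hG.delta_pos hG.length_pos hρ
  -- Closeness to `γ` already forces the curve into the image of the strip, so the whole surface
  -- serves as `U`.
  obtain ⟨c, hcN, -, hc, htwo⟩ := hi univ isOpen_univ (subset_univ _) N hN hγN
  obtain ⟨b, hb, hcb⟩ := hlift c hcN hc.periodic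
  refine hne b hb ?_
  rw [← htwo]
  congr 1
  ext t
  exact and_congr_right fun _ => (hE'.isVertex_iff hcb (hb.smooth.contDiffAt.of_le CoordMetric.two_le_infty)
    (IsStripMetric.strip_mono hρδ (hb.mem_strip t))).symm
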